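/- **Conventions.** Let $\mathbf K$ be a 2-category. *Tangentads.* An additive bundle in a category is a morphism $q\colon E\to B$ all of whose $n$-fold pullbacks $E_n$ along itself ($n\ge 1$) exist, with a section $z\colon B\to E$ of $q$ and a morphism $s\colon E_2\to E$ over $B$ that is associative, commutative and has unit $z$. A morphism of additive bundles $(f,g)$, with $f\colon B\to B'$ and $g\colon E\to E'$, commutes with $q$, $z$ and $s$. A *tangentad* $(\mathbb X,\mathbb T)$ in $\mathbf K$ is an object $\mathbb X$ with a 1-morphism $T\colon\mathbb X\to\mathbb X$ and 2-morphisms $p\colon T\Rightarrow\mathrm{id}$, $z\colon\mathrm{id}\Rightarrow T$, $s\colon T_2\Rightarrow T$, $l\colon T\Rightarrow T^2$, $c\colon T^2\Rightarrow T^2$ such that: $(p,z,s)$ is an additive bundle in $\mathbf K(\mathbb X,\mathbb X)$ whose $n$-fold pullbacks $T_n$ of $p$ along itself are pointwise (preserved by $-\circ F$ for every $F\colon\mathbb Y\to\mathbb X$) and preserved by all $T^m\circ-$; $(z,l)\colon p\to Tp$ and $(\mathrm{id},c)\colon Tp\to p_T$ are morphisms of additive bundles; $Tl\circ l=l_T\circ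 l$, $c\circ l=l$, $c^2=\mathrm{id}$, $Tc\circ c_T\circ Tl=l_T\circ c$, $c_T\circ Tc\circ c_T=Tc\circ c_T\circ Tc$; and the square with top $Ts\circ\langle l\circ\pi_1,z_T\circ\pi_2\rangle\colon T_2\Rightarrow T^2$, left side $p\circ\pi_1\colon T_2\Rightarrow\mathrm{id}$, right side $Tp\colon T^2\Rightarrow T$ and bottom $z\colon\mathrm{id}\Rightarrow T$ is a pointwise pullback. *The 2-category $\mathsf{Tng}(\mathbf K)$.* A lax tangent morphism $(F,\alpha)\colon(\mathbb X',\mathbb T')\to(\mathbb X,\mathbb T)$ is a 1-morphism $F\colon\mathbb X'\to\mathbb X$ with a 2-morphism $\alpha\colon F\circ T'\Rightarrow T\circ F$ compatible with $p,z,s,l,c$; it is strict if $\alpha$ is an identity. A tangent 2-morphism $(F,\alpha)\Rightarrow(G,\beta)$ is a 2-morphism $\varphi\colon F\Rightarrow G$ with $T\varphi\circ\alpha=\beta\circ\varphi_{T'}$. These form a 2-category $\mathsf{Tng}(\mathbf K)$. Its hom-category $[\mathbb X',\mathbb T'\,|\,\mathbb X,\mathbb T]$ is a tangent category, with tangent bundle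 functor $\bar T(F,\alpha)=(T,c)\circ(F,\alpha)$ and structure transformations those of $\mathbb T$ whiskered with $F$. *Vector fields.* For a tangent category $(\mathbb Y,\mathbb T)$, $\mathsf{VF}(\mathbb Y,\mathbb T)$ is the category of pairs $(M,v)$ with $v\colon M\to TM$, $p\circ v=\mathrm{id}_M$, and of the morphisms $f\colon (M,v)\to(M',v')$ with $Tf\circ v=v'\circ f$; its tangent bundle functor is $(M,v)\mapsto(TM,c\circ Tv)$, $f\mapsto Tf$, and its structure transformations are those of $\mathbb T$. Write $\mathsf{VF}[\mathbb X',\mathbb T'\,|\,\mathbb X,\mathbb T]$ for the vector fields of the hom-tangent category. A tangentad $(\mathbb X,\mathbb T)$ *admits the construction of vector fields* if there are a tangentad $(\mathbb V,\mathbb T^{\mathbb V})$, a strict tangent morphism $U\colon(\mathbb V,\mathbb T^{\mathbb V})\to(\mathbb X,\mathbb T)$ and a vector field $\hat v\colon U\Rightarrow\bar TU$ in $[\mathbb V,\mathbb T^{\mathbb V}\,|\,\mathbb X,\mathbb T]$ such that for every tangentad $(\mathbb X',\mathbb T')$ the induced lax tangent morphism $$\Gamma\colon[\mathbb X',\mathbb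 T'\,|\,\mathbb V,\mathbb T^{\mathbb V}]\to\mathsf{VF}[\mathbb X',\mathbb T'\,|\,\mathbb X,\mathbb T],\qquad H\mapsto(U\circ H,\hat v_H),$$ is invertible, i.e. its underlying functor is an isomorphism of categories and its distributive law is invertible. Then $(\mathbb V,\mathbb T^{\mathbb V})$ is called the tangentad of vector fields of $(\mathbb X,\mathbb T)$, with universal vector field $\hat v$. The 2-category $\mathbf K$ *admits the construction of vector fields* if each of its tangentads does. *Tangent monads.* $\mathsf{Mnd}$ is the 2-category of categories equipped with a monad, morphisms of monads $(F,\varphi)\colon(\mathbb X',S')\to(\mathbb X,S)$, i.e. functors $F\colon \mathbb X'\to\mathbb X$ with a natural transformation $\varphi\colon SF\Rightarrow FS'$ compatible with units and multiplications, and natural transformations compatible with these $\varphi$. A tangent monad $(S,\alpha)$ on a tangent category $(\mathbb X,\mathbb T)$ is a tangentad of $\mathsf{Mnd}$ with base $(\mathbb X,S)$ and tangent bundle 1-morphism $(T,\alpha)$, $\alpha\colon ST\Rightarrow TS$. **Theorem.** The 2-category $\mathsf{Mnd}$ of monads admits the construction of vector fields. Moreover, for every tangent monad $(S,\alpha)$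 on a tangent category $(\mathbb X,\mathbb T)$, its tangentad of vector fields is the lifted tangent monad $\mathsf{VF}(S,\alpha)$ on $\mathsf{VF}(\mathbb X,\mathbb T)$: the functor of the monad is $(M,v)\mapsto(SM,\alpha_M\circ Sv)$, $f\mapsto Sf$, its unit and multiplication are those of $S$, the tangent bundle functor is $(M,v)\mapsto(TM,c_M\circ Tv)$, $f\mapsto Tf$, with distributive law $\alpha$, the strict tangent morphism $U$ is the forgetful functor $(M,v)\mapsto M$, whose compatibility with the monads is the identity, and the universal vector field $\hat v\colon U\Rightarrow\bar TU$ is $\hat v_{(M,v)}=v$. -/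

import Mathlib

open CategoryTheory Bicategory

namespace TangentTheory

universe w v u w₁ v₁ u₁ v₂ u₂

-- pin the category structure on `X ⟶ X` to `Bicategory.homCategory`
attribute [-instance] CategoryTheory.instCategoryEndMonoidal CategoryTheory.catToReflQuiver

/-! ## Additive bundles in a category -/

section AdditiveBundles

variable {C : Type u₁} [Category.{v₁} C] {D : Type u₂} [Category.{v₂} D]

/-- `π` exhibits `P` as the `n`-fold pullback of `q : E ⟶ B` along itself (meant for `n ≥ 1`). -/
def IsFibrePower {E B P : C} (q : E ⟶ B) {n : ℕ} (π : Fin n → (P ⟶ E)) : Prop :=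
  (∀ i j, π i ≫ q = π j ≫ q) ∧
    ∀ {A : C} (a : Fin n → (A ⟶ E)), (∀ i j, a i ≫ q = a j ≫ q) →
      ∃! h : A ⟶ P, ∀ i, h ≫ π i = a i

/-- The data of an additive bundle `q : E ⟶ B`: the object `E₂` with its projections, the
projection `q`, the zero morphism `z` and the sum morphism `s`. -/
structure AddBundleData (E B : C) where
  /-- the 2-fold pullback of `q` along itself -/
  E₂ : C
  /-- first projection -/
  π₁ : E₂ ⟶ E
  /-- second projection -/
  π₂ : E₂ ⟶ E
  /-- the projection -/
  q : E ⟶ B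
  /-- the zero morphism -/
  z : B ⟶ E
  /-- the sum morphism -/
  s : E₂ ⟶ E

/-- The image of the data of an additive bundle under a functor. -/
@[simps]
def AddBundleData.map {E B : C} (A : AddBundleData E B) (Φ : C ⥤ D) :
    AddBundleData (Φ.obj E) (Φ.obj B) where
  E₂ := Φ.obj A.E₂
  π₁ := Φ.map A.π₁
  π₂ := Φ.map A.π₂
  q := Φ.map A.q
  z := Φ.map A.z
  s := Φ.map A.s

/-- The axioms of an additive bundle. -/
structure AddBundleData.IsAdditive {E B : C} (A : AddBundleData E B) : Prop where
  isPullback : IsPullback A.π₁ A.π₂ A.q A.q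
  fibrePower : ∀ n : ℕ, 0 < n → ∃ (P : C) (π : Fin n → (P ⟶ E)), IsFibrePower A.q π
  z_q : A.z ≫ A.q = 𝟙 B
  s_q : A.s ≫ A.q = A.π₁ ≫ A.q
  assoc : ∀ {Y : C} (a b c : Y ⟶ E) (hab : a ≫ A.q = b ≫ A.q) (hbc : b ≫ A.q = c ≫ A.q),
    isPullback.lift (isPullback.lift a b hab ≫ A.s) c
        (by rw [Category.assoc, s_q, isPullback.lift_fst_assoc, hab, hbc]) ≫ A.s =
      isPullback.lift a (isPullback.lift b c hbc ≫ A.s)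
        (by rw [Category.assoc, s_q, isPullback.lift_fst_assoc, hab]) ≫ A.s
  zero_add : isPullback.lift (A.q ≫ A.z) (𝟙 E)
    (by rw [Category.assoc, z_q, Category.comp_id, Category.id_comp]) ≫ A.s = 𝟙 E
  comm : isPullback.lift A.π₂ A.π₁ isPullback.w.symm ≫ A.s = A.s

/-- `(f, g)` is a morphism of additive bundles; `g₂` is the morphism `g ×_f g`. -/
structure IsAddBundleHom {E B E' B' : C} (A : AddBundleData E B) (A' : AddBundleData E' B')
    (f : B ⟶ B') (g : E ⟶ E') : Prop where
  q_comm : g ≫ A'.q = A.q ≫ f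
  z_comm : A.z ≫ g = f ≫ A'.z
  s_comm : ∃ g₂ : A.E₂ ⟶ A'.E₂,
    g₂ ≫ A'.π₁ = A.π₁ ≫ g ∧ g₂ ≫ A'.π₂ = A.π₂ ≫ g ∧ A.s ≫ g = g₂ ≫ A'.s

end AdditiveBundles

/-! ## Tangentads in a 2-category

`f ≫ g` is the composite `g ∘ f` of 1-morphisms, so that `F ◁ η` is the 2-morphism `η_F` and
`η ▷ G` is the 2-morphism `G η`. -/

section Tangentads

variable {K : Type u} [Bicategory.{w, v} K]

/-- The iterates `T ^ m` of an endomorphism. -/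
def iter {X : K} (T : X ⟶ X) : ℕ → (X ⟶ X)
  | 0 => 𝟙 X
  | m + 1 => iter T m ≫ T

/-- The functor `H ↦ T ^ m ∘ H ∘ F` from `K(X, X)` to `K(Y, X)`. -/
abbrev shift {X Y : K} (T : X ⟶ X) (F : Y ⟶ X) (m : ℕ) : (X ⟶ X) ⥤ (Y ⟶ X) :=
  precomp X F ⋙ postcomp Y (iter T m)

/-- A tangent structure on an object `X` of a 2-category. -/
structure TangentStructure (X : K) where
  /-- the tangent bundle 1-morphism -/
  T : X ⟶ X
  /-- `T₂`, the projection `p`, the zero morphism `z` and the sum morphism `s` -/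
  p : AddBundleData T (𝟙 X)
  isAdditive : p.IsAdditive
  /-- `T₂` is a pointwise pullback, preserved by the iterates of `T` -/
  isPullback : ∀ {Y : K} (F : Y ⟶ X) (m : ℕ),
    IsPullback ((shift T F m).map p.π₁) ((shift T F m).map p.π₂)
      ((shift T F m).map p.q) ((shift T F m).map p.q)
  /-- the `n`-fold pullbacks of `p` exist pointwise, and are preserved by the iterates of `T` -/
  fibrePower : ∀ n : ℕ, 0 < n → ∃ (Tn : X ⟶ X) (π : Fin n → (Tn ⟶ T)),
    ∀ {Y : K} (F : Y ⟶ X) (m : ℕ),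
      IsFibrePower ((shift T F m).map p.q) (fun i => (shift T F m).map (π i))
  /-- the vertical lift -/
  l : T ⟶ T ≫ T
  /-- `(z, l) : p ⟶ T p` is a morphism of additive bundles -/
  l_hom : IsAddBundleHom p (p.map (postcomp X T)) (p.z ≫ (λ_ T).inv) l
  /-- the canonical flip -/
  c : T ≫ T ⟶ T ≫ T
  /-- `(id, c) : T p ⟶ p_T` is a morphism of additive bundles -/
  c_hom : IsAddBundleHom (p.map (postcomp X T)) (p.map (precomp X T)) ((λ_ T).hom ≫ (ρ_ T).inv) c
  l_coassoc : l ≫ l ▷ T ≫ (α_ T T T).hom = l ≫ T ◁ l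
  l_c : l ≫ c = l
  l_c_c : T ◁ l ≫ (α_ T T T).inv ≫ c ▷ T ≫ (α_ T T T).hom ≫ T ◁ c =
    c ≫ l ▷ T ≫ (α_ T T T).hom
  c_c : c ≫ c = 𝟙 (T ≫ T)
  c_braid : c ▷ T ≫ (α_ T T T).hom ≫ T ◁ c ≫ (α_ T T T).inv ≫ c ▷ T =
    (α_ T T T).hom ≫ T ◁ c ≫ (α_ T T T).inv ≫ c ▷ T ≫ (α_ T T T).hom ≫ T ◁ c ≫
      (α_ T T T).inv
  /-- universality of the vertical lift; `ν` is the 2-morphism `⟨l ∘ π₁, z_T ∘ π₂⟩` -/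
  l_universal : ∃ ν : p.E₂ ⟶ p.E₂ ≫ T,
    ν ≫ p.π₁ ▷ T = p.π₁ ≫ l ∧ ν ≫ p.π₂ ▷ T = p.π₂ ≫ (ρ_ T).inv ≫ T ◁ p.z ∧
      ∀ {Y : K} (F : Y ⟶ X), IsPullback (F ◁ (ν ≫ p.s ▷ T)) (F ◁ (p.π₁ ≫ p.q))
        (F ◁ (p.q ▷ T)) (F ◁ (p.z ≫ (λ_ T).inv))

variable (K) in
/-- A tangentad in the 2-category `K`. -/
structure Tangentad where
  /-- the base object -/
  base : K
  /-- the tangent structure -/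
  str : TangentStructure base

/-- The 2-morphism `T α ∘ α_{T'} : F ∘ T' ∘ T' ⟶ T ∘ T ∘ F`. -/
def distSq {X' X : K} {T' : X' ⟶ X'} {T : X ⟶ X} {F : X' ⟶ X} (α : T' ≫ F ⟶ F ≫ T) :
    (T' ≫ T') ≫ F ⟶ F ≫ (T ≫ T) :=
  (α_ T' T' F).hom ≫ T' ◁ α ≫ (α_ T' F T).inv ≫ α ▷ T ≫ (α_ F T T).hom

/-- `α : F ∘ T' ⟶ T ∘ F` is a lax distributive law. -/
structure IsLaxLaw {X' X : K} (S' : TangentStructure X') (S : TangentStructure X)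
    (F : X' ⟶ X) (α : S'.T ≫ F ⟶ F ≫ S.T) : Prop where
  p_comm : α ≫ F ◁ S.p.q = S'.p.q ▷ F ≫ (λ_ F).hom ≫ (ρ_ F).inv
  z_comm : S'.p.z ▷ F ≫ α = (λ_ F).hom ≫ (ρ_ F).inv ≫ F ◁ S.p.z
  s_comm : ∃ α₂ : S'.p.E₂ ≫ F ⟶ F ≫ S.p.E₂,
    α₂ ≫ F ◁ S.p.π₁ = S'.p.π₁ ▷ F ≫ α ∧ α₂ ≫ F ◁ S.p.π₂ = S'.p.π₂ ▷ F ≫ α ∧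
      S'.p.s ▷ F ≫ α = α₂ ≫ F ◁ S.p.s
  l_comm : S'.l ▷ F ≫ distSq α = α ≫ F ◁ S.l
  c_comm : S'.c ▷ F ≫ distSq α = distSq α ≫ F ◁ S.c

/-- A lax tangent morphism. -/
structure LaxTangentHom (𝕏' 𝕏 : Tangentad K) where
  /-- the underlying 1-morphism -/
  F : 𝕏'.base ⟶ 𝕏.base
  /-- the lax distributive law -/
  α : 𝕏'.str.T ≫ F ⟶ F ≫ 𝕏.str.T
  isLaxLaw : IsLaxLaw 𝕏'.str 𝕏.str F α

/-- A strict tangent morphism: its distributive law is an identity. -/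
def LaxTangentHom.IsStrict {𝕏' 𝕏 : Tangentad K} (f : LaxTangentHom 𝕏' 𝕏) : Prop :=
  ∃ h : 𝕏'.str.T ≫ f.F = f.F ≫ 𝕏.str.T, f.α = eqToHom h

/-- `φ` is compatible with the distributive laws of `f` and `g`. -/
def IsTangentTwoCell {𝕏' 𝕏 : Tangentad K} (f g : LaxTangentHom 𝕏' 𝕏) (φ : f.F ⟶ g.F) : Prop :=
  f.α ≫ φ ▷ 𝕏.str.T = 𝕏'.str.T ◁ φ ≫ g.α

/-- A tangent 2-morphism. -/
@[ext]
structure TangentTwoCell {𝕏' 𝕏 : Tangentad K} (f g : LaxTangentHom 𝕏' 𝕏) where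
  /-- the underlying 2-morphism -/
  φ : f.F ⟶ g.F
  comm : IsTangentTwoCell f g φ

/-- The composite of two distributive laws. -/
def compLaw {X'' X' X : K} {T'' : X'' ⟶ X''} {T' : X' ⟶ X'} {T : X ⟶ X}
    {F : X'' ⟶ X'} {G : X' ⟶ X} (α : T'' ≫ F ⟶ F ≫ T') (β : T' ≫ G ⟶ G ≫ T) :
    T'' ≫ F ≫ G ⟶ (F ≫ G) ≫ T :=
  (α_ T'' F G).inv ≫ α ▷ G ≫ (α_ F T' G).hom ≫ F ◁ β ≫ (α_ F G T).inv

lemma distSq_compLaw {X'' X' X : K} {T'' : X'' ⟶ X''} {T' : X' ⟶ X'} {T : X ⟶ X}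
    {F : X'' ⟶ X'} {G : X' ⟶ X} (α : T'' ≫ F ⟶ F ≫ T') (β : T' ≫ G ⟶ G ≫ T) :
    distSq (compLaw α β) = (α_ _ F G).inv ≫ distSq α ▷ G ≫ (α_ F _ G).hom ≫
      F ◁ distSq β ≫ (α_ F G _).inv := by
  calc
    _ = 𝟙 _ ⊗≫ T'' ◁ α ▷ G ⊗≫ ((T'' ≫ F) ◁ β ≫ α ▷ (G ≫ T)) ⊗≫ F ◁ β ▷ T ⊗≫ 𝟙 _ := by
      simp only [distSq, compLaw]; bicategory
    _ = _ := by
      rw [whisker_exchange]; simp only [distSq]; bicategory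


lemma compLaw_naturality {X'' X' X : K} {A'' B'' : X'' ⟶ X''} {A' B' : X' ⟶ X'} {A B : X ⟶ X}
    {F : X'' ⟶ X'} {G : X' ⟶ X} {α : A'' ≫ F ⟶ F ≫ A'} {α' : B'' ≫ F ⟶ F ≫ B'}
    {β : A' ≫ G ⟶ G ≫ A} {β' : B' ≫ G ⟶ G ≫ B} {x'' : A'' ⟶ B''} {x' : A' ⟶ B'} {x : A ⟶ B}
    (h : x'' ▷ F ≫ α' = α ≫ F ◁ x') (k : x' ▷ G ≫ β' = β ≫ G ◁ x) :
    x'' ▷ (F ≫ G) ≫ compLaw α' β' = compLaw α β ≫ (F ≫ G) ◁ x := by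
  calc
    _ = 𝟙 _ ⊗≫ (x'' ▷ F ≫ α') ▷ G ⊗≫ F ◁ β' ⊗≫ 𝟙 _ := by simp only [compLaw]; bicategory
    _ = 𝟙 _ ⊗≫ α ▷ G ⊗≫ F ◁ (x' ▷ G ≫ β') ⊗≫ 𝟙 _ := by rw [h]; bicategory
    _ = _ := by rw [k]; simp only [compLaw]; bicategory

lemma isLaxLaw_comp {X'' X' X : K} {S'' : TangentStructure X''} {S' : TangentStructure X'}
    {S : TangentStructure X} {F : X'' ⟶ X'} {G : X' ⟶ X} {α : S''.T ≫ F ⟶ F ≫ S'.T}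
    {β : S'.T ≫ G ⟶ G ≫ S.T} (hα : IsLaxLaw S'' S' F α) (hβ : IsLaxLaw S' S G β) :
    IsLaxLaw S'' S (F ≫ G) (compLaw α β) where
  p_comm := by
    calc
      _ = 𝟙 _ ⊗≫ α ▷ G ⊗≫ F ◁ (β ≫ G ◁ S.p.q) ⊗≫ 𝟙 _ := by simp only [compLaw]; bicategory
      _ = 𝟙 _ ⊗≫ (α ≫ F ◁ S'.p.q) ▷ G ⊗≫ 𝟙 _ := by rw [hβ.p_comm]; bicategory
      _ = _ := by rw [hα.p_comm]; bicategory
  z_comm := by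
    calc
      _ = 𝟙 _ ⊗≫ (S''.p.z ▷ F ≫ α) ▷ G ⊗≫ F ◁ β ⊗≫ 𝟙 _ := by simp only [compLaw]; bicategory
      _ = 𝟙 _ ⊗≫ F ◁ (S'.p.z ▷ G ≫ β) ⊗≫ 𝟙 _ := by rw [hα.z_comm]; bicategory
      _ = _ := by rw [hβ.z_comm]; bicategory
  s_comm := by
    obtain ⟨α₂, h1, h2, h3⟩ := hα.s_comm
    obtain ⟨β₂, k1, k2, k3⟩ := hβ.s_comm
    exact ⟨compLaw α₂ β₂, (compLaw_naturality h1.symm k1.symm).symm,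
      (compLaw_naturality h2.symm k2.symm).symm, compLaw_naturality h3 k3⟩
  l_comm := by
    rw [distSq_compLaw]
    exact compLaw_naturality hα.l_comm hβ.l_comm
  c_comm := by
    rw [distSq_compLaw]
    exact compLaw_naturality hα.c_comm hβ.c_comm

lemma isLaxLaw_id {X : K} (S : TangentStructure X) :
    IsLaxLaw S S (𝟙 X) ((ρ_ S.T).hom ≫ (λ_ S.T).inv) where
  p_comm := by bicategory
  z_comm := by bicategory
  s_comm := ⟨(ρ_ _).hom ≫ (λ_ _).inv, by bicategory, by bicategory, by bicategory⟩
  l_comm := by simp only [distSq]; bicategory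
  c_comm := by simp only [distSq]; bicategory

/-! ## The 2-category of tangentads and lax tangent morphisms -/

instance (𝕏' 𝕏 : Tangentad K) : Category (LaxTangentHom 𝕏' 𝕏) where
  Hom f g := TangentTwoCell f g
  id f := ⟨𝟙 _, by simp [IsTangentTwoCell]⟩
  comp {f g h} φ ψ := ⟨φ.φ ≫ ψ.φ, by
    have h1 := φ.comm
    have h2 := ψ.comm
    simp only [IsTangentTwoCell] at h1 h2 ⊢
    rw [comp_whiskerRight, reassoc_of% h1, h2, whiskerLeft_comp, Category.assoc]⟩
  id_comp _ := TangentTwoCell.ext (Category.id_comp _)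
  comp_id _ := TangentTwoCell.ext (Category.comp_id _)
  assoc _ _ _ := TangentTwoCell.ext (Category.assoc _ _ _)

@[simp]
lemma id_φ {𝕏' 𝕏 : Tangentad K} (f : LaxTangentHom 𝕏' 𝕏) : TangentTwoCell.φ (𝟙 f) = 𝟙 f.F := rfl

@[simp]
lemma comp_φ {𝕏' 𝕏 : Tangentad K} {f g h : LaxTangentHom 𝕏' 𝕏} (a : f ⟶ g) (b : g ⟶ h) :
    TangentTwoCell.φ (a ≫ b) = a.φ ≫ b.φ := rfl

@[ext]
lemma twoCell_ext {𝕏' 𝕏 : Tangentad K} {f g : LaxTangentHom 𝕏' 𝕏} {a b : f ⟶ g}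
    (h : a.φ = b.φ) : a = b :=
  TangentTwoCell.ext h

/-- An invertible 2-morphism compatible with the distributive laws is invertible as a
tangent 2-morphism. -/
@[simps]
def mkIso {𝕏' 𝕏 : Tangentad K} {f g : LaxTangentHom 𝕏' 𝕏} (e : f.F ≅ g.F)
    (h : IsTangentTwoCell f g e.hom) : f ≅ g where
  hom := ⟨e.hom, h⟩
  inv := ⟨e.inv, by
    simp only [IsTangentTwoCell] at h ⊢
    rw [← cancel_epi (𝕏'.str.T ◁ e.hom), ← reassoc_of% h]
    simp⟩
  hom_inv_id := by ext; simp
  inv_hom_id := by ext; simp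

/-- The identity tangent morphism. -/
@[simps]
def idHom (𝕏 : Tangentad K) : LaxTangentHom 𝕏 𝕏 :=
  ⟨𝟙 _, (ρ_ _).hom ≫ (λ_ _).inv, isLaxLaw_id _⟩

/-- The composite of lax tangent morphisms. -/
@[simps]
def compHom {𝕏'' 𝕏' 𝕏 : Tangentad K} (f : LaxTangentHom 𝕏'' 𝕏') (g : LaxTangentHom 𝕏' 𝕏) :
    LaxTangentHom 𝕏'' 𝕏 :=
  ⟨f.F ≫ g.F, compLaw f.α g.α, isLaxLaw_comp f.isLaxLaw g.isLaxLaw⟩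

lemma isTangentTwoCell_whiskerLeft {𝕏'' 𝕏' 𝕏 : Tangentad K} (f : LaxTangentHom 𝕏'' 𝕏')
    {g h : LaxTangentHom 𝕏' 𝕏} (η : g ⟶ h) :
    IsTangentTwoCell (compHom f g) (compHom f h) (f.F ◁ η.φ) := by
  have k := η.comm
  simp only [IsTangentTwoCell] at k
  change compLaw f.α g.α ≫ (f.F ◁ η.φ) ▷ 𝕏.str.T =
    𝕏''.str.T ◁ f.F ◁ η.φ ≫ compLaw f.α h.α
  calc
    _ = 𝟙 _ ⊗≫ f.α ▷ g.F ⊗≫ f.F ◁ (g.α ≫ η.φ ▷ 𝕏.str.T) ⊗≫ 𝟙 _ := by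
      simp only [compLaw]; bicategory
    _ = 𝟙 _ ⊗≫ (f.α ▷ g.F ≫ (f.F ≫ 𝕏'.str.T) ◁ η.φ) ⊗≫ f.F ◁ h.α ⊗≫ 𝟙 _ := by
      rw [k]; bicategory
    _ = _ := by
      rw [← whisker_exchange]; simp only [compLaw]; bicategory

lemma isTangentTwoCell_whiskerRight {𝕏'' 𝕏' 𝕏 : Tangentad K} {f g : LaxTangentHom 𝕏'' 𝕏'}
    (η : f ⟶ g) (h : LaxTangentHom 𝕏' 𝕏) :
    IsTangentTwoCell (compHom f h) (compHom g h) (η.φ ▷ h.F) := by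
  have k := η.comm
  simp only [IsTangentTwoCell] at k
  change compLaw f.α h.α ≫ (η.φ ▷ h.F) ▷ 𝕏.str.T =
    𝕏''.str.T ◁ (η.φ ▷ h.F) ≫ compLaw g.α h.α
  calc
    _ = 𝟙 _ ⊗≫ f.α ▷ h.F ⊗≫ (f.F ◁ h.α ≫ η.φ ▷ (h.F ≫ 𝕏.str.T)) ⊗≫ 𝟙 _ := by
      simp only [compLaw]; bicategory
    _ = 𝟙 _ ⊗≫ (f.α ≫ η.φ ▷ 𝕏'.str.T) ▷ h.F ⊗≫ g.F ◁ h.α ⊗≫ 𝟙 _ := by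
      rw [whisker_exchange]; bicategory
    _ = _ := by
      rw [k]; simp only [compLaw]; bicategory

/-- The 2-category `Tng(K)` of tangentads, lax tangent morphisms and tangent 2-morphisms. -/
instance : Bicategory (Tangentad K) where
  Hom := LaxTangentHom
  id := idHom
  comp := compHom
  homCategory := inferInstance
  whiskerLeft f _ _ η := ⟨f.F ◁ η.φ, isTangentTwoCell_whiskerLeft f η⟩
  whiskerRight η h := ⟨η.φ ▷ h.F, isTangentTwoCell_whiskerRight η h⟩
  associator f g h := mkIso (α_ f.F g.F h.F) (by
    simp only [IsTangentTwoCell, compHom_α, compLaw]; bicategory)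
  leftUnitor f := mkIso (λ_ f.F) (by
    simp only [IsTangentTwoCell, compHom_α, idHom_α, compLaw]; bicategory)
  rightUnitor f := mkIso (ρ_ f.F) (by
    simp only [IsTangentTwoCell, compHom_α, idHom_α, compLaw]; bicategory)
  whiskerLeft_id _ _ := twoCell_ext (whiskerLeft_id _ _)
  whiskerLeft_comp _ _ _ _ _ _ := twoCell_ext (whiskerLeft_comp _ _ _)
  id_whiskerLeft _ := twoCell_ext (id_whiskerLeft _)
  comp_whiskerLeft _ _ _ _ _ := twoCell_ext (comp_whiskerLeft _ _ _)
  id_whiskerRight _ _ := twoCell_ext (id_whiskerRight _ _)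
  comp_whiskerRight _ _ _ := twoCell_ext (comp_whiskerRight _ _ _)
  whiskerRight_id _ := twoCell_ext (whiskerRight_id _)
  whiskerRight_comp _ _ _ := twoCell_ext (whiskerRight_comp _ _ _)
  whisker_assoc _ _ _ _ _ := twoCell_ext (whisker_assoc _ _ _)
  whisker_exchange _ _ := twoCell_ext (whisker_exchange _ _)
  pentagon _ _ _ _ := twoCell_ext (pentagon _ _ _ _)
  triangle _ _ := twoCell_ext (triangle _ _)


/-! ## The Hom-tangent categories -/

section Auxiliary

variable {X Y Z : K} {s : Y ⟶ Y} {t : X ⟶ X} {g : Y ⟶ X}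

lemma aux_flip_proj {q : t ⟶ 𝟙 X} {c : t ≫ t ⟶ t ≫ t}
    (h : c ≫ t ◁ q = q ▷ t ≫ (λ_ t).hom ≫ (ρ_ t).inv) (f : Y ⟶ X) :
    ((α_ f t t).hom ≫ f ◁ c ≫ (α_ f t t).inv) ≫ (f ≫ t) ◁ q ≫ (ρ_ (f ≫ t)).hom =
      (f ◁ q ≫ (ρ_ f).hom) ▷ t := by
  calc
    _ = 𝟙 _ ⊗≫ f ◁ (c ≫ t ◁ q) ⊗≫ 𝟙 _ := by bicategory
    _ = _ := by rw [h]; bicategory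

lemma aux_sec {q : t ⟶ 𝟙 X} {u : g ⟶ g ≫ t} (h : u ≫ g ◁ q ≫ (ρ_ g).hom = 𝟙 g) (H : Z ⟶ Y) :
    (H ◁ u ≫ (α_ H g t).inv) ≫ (H ≫ g) ◁ q ≫ (ρ_ (H ≫ g)).hom = 𝟙 (H ≫ g) := by
  calc
    _ = H ◁ (u ≫ g ◁ q ≫ (ρ_ g).hom) := by bicategory
    _ = _ := by rw [h, whiskerLeft_id]

lemma aux_map (u : g ⟶ g ≫ t) {H H' : Z ⟶ Y} (η : H ⟶ H') :
    (H ◁ u ≫ (α_ H g t).inv) ≫ (η ▷ g) ▷ t = η ▷ g ≫ H' ◁ u ≫ (α_ H' g t).inv := by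
  rw [← whisker_exchange_assoc]; simp

lemma aux_law {c : t ≫ t ⟶ t ≫ t} {u : g ⟶ g ≫ t} {b : s ≫ g ⟶ g ≫ t}
    (h : s ◁ u ≫ (α_ s g t).inv ≫ b ▷ t =
      b ≫ u ▷ t ≫ (α_ g t t).hom ≫ g ◁ c ≫ (α_ g t t).inv) (H : Z ⟶ Y) :
    ((H ≫ s) ◁ u ≫ (α_ (H ≫ s) g t).inv) ≫ ((α_ H s g).hom ≫ H ◁ b ≫ (α_ H g t).inv) ▷ t =
      ((α_ H s g).hom ≫ H ◁ b ≫ (α_ H g t).inv) ≫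
        (H ◁ u ≫ (α_ H g t).inv) ▷ t ≫
          (α_ (H ≫ g) t t).hom ≫ (H ≫ g) ◁ c ≫ (α_ (H ≫ g) t t).inv := by
  calc
    _ = 𝟙 _ ⊗≫ H ◁ (s ◁ u ≫ (α_ s g t).inv ≫ b ▷ t) ⊗≫ 𝟙 _ := by bicategory
    _ = _ := by rw [h]; bicategory

lemma aux_naturality (b : s ≫ g ⟶ g ≫ t) {H H' : Z ⟶ Y} (η : H ⟶ H') :
    (η ▷ s) ▷ g ≫ (α_ H' s g).hom ≫ H' ◁ b ≫ (α_ H' g t).inv =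
      ((α_ H s g).hom ≫ H ◁ b ≫ (α_ H g t).inv) ≫ (η ▷ g) ▷ t := by
  calc
    _ = 𝟙 _ ⊗≫ (η ▷ (s ≫ g) ≫ H' ◁ b) ⊗≫ 𝟙 _ := by bicategory
    _ = _ := by rw [← whisker_exchange]; bicategory

lemma aux_lawCell {c : t ≫ t ⟶ t ≫ t} (hc : c ≫ c = 𝟙 _) {u : g ⟶ g ≫ t} {b : s ≫ g ⟶ g ≫ t}
    (h : b ≫ u ▷ t = s ◁ u ≫ compLaw b c) :
    s ◁ u ≫ (α_ s g t).inv ≫ b ▷ t =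
      b ≫ u ▷ t ≫ (α_ g t t).hom ≫ g ◁ c ≫ (α_ g t t).inv := by
  rw [reassoc_of% h]
  simp only [compLaw, Category.assoc, Iso.inv_hom_id_assoc]
  rw [← whiskerLeft_comp_assoc, hc]
  simp

end Auxiliary


lemma isLaxLaw_c {X : K} (S : TangentStructure X) : IsLaxLaw S S S.T S.c where
  p_comm := S.c_hom.q_comm
  z_comm := by
    have h : S.p.z ▷ S.T ≫ S.c = ((λ_ S.T).hom ≫ (ρ_ S.T).inv) ≫ S.T ◁ S.p.z := S.c_hom.z_comm
    rw [h, Category.assoc]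
  s_comm := S.c_hom.s_comm
  l_comm := by
    have h : S.l ▷ S.T ≫ (α_ S.T S.T S.T).hom = S.c ≫ S.T ◁ S.l ≫ (α_ S.T S.T S.T).inv ≫
        S.c ▷ S.T ≫ (α_ S.T S.T S.T).hom ≫ S.T ◁ S.c := by
      rw [S.l_c_c, reassoc_of% S.c_c]
    simp only [distSq]
    rw [reassoc_of% h, ← whiskerLeft_comp_assoc, S.c_c, whiskerLeft_id, Category.id_comp,
      Iso.hom_inv_id_assoc, ← comp_whiskerRight_assoc, S.c_c, id_whiskerRight, Category.id_comp,
      Iso.inv_hom_id, Category.comp_id]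
  c_comm := by
    have h := S.c_braid
    simp only [distSq, Category.assoc]
    rw [reassoc_of% h, Iso.inv_hom_id, Category.comp_id]

/-- The tangent bundle 1-morphism as a lax tangent morphism `(T, c)`. -/
def tangentHom (𝕏 : Tangentad K) : 𝕏 ⟶ 𝕏 :=
  LaxTangentHom.mk 𝕏.str.T 𝕏.str.c (isLaxLaw_c _)

/-- The projection, as a tangent 2-morphism `(T, c) ⟶ id`. -/
def projCell (𝕏 : Tangentad K) : tangentHom 𝕏 ⟶ 𝟙 𝕏 :=
  TangentTwoCell.mk 𝕏.str.p.q (by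
    change 𝕏.str.c ≫ 𝕏.str.p.q ▷ 𝕏.str.T = 𝕏.str.T ◁ 𝕏.str.p.q ≫ (ρ_ _).hom ≫ (λ_ _).inv
    have h : 𝕏.str.c ≫ 𝕏.str.T ◁ 𝕏.str.p.q =
      𝕏.str.p.q ▷ 𝕏.str.T ≫ (λ_ 𝕏.str.T).hom ≫ (ρ_ 𝕏.str.T).inv := 𝕏.str.c_hom.q_comm
    have h' : 𝕏.str.p.q ▷ 𝕏.str.T = 𝕏.str.c ≫ 𝕏.str.T ◁ 𝕏.str.p.q ≫ (ρ_ _).hom ≫ (λ_ _).inv := by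
      rw [reassoc_of% h]; simp
    rw [h', reassoc_of% 𝕏.str.c_c])

/-- The canonical flip, as a tangent 2-morphism. -/
def flipCell (𝕏 : Tangentad K) : tangentHom 𝕏 ≫ tangentHom 𝕏 ⟶ tangentHom 𝕏 ≫ tangentHom 𝕏 :=
  TangentTwoCell.mk 𝕏.str.c (by
    change compLaw 𝕏.str.c 𝕏.str.c ≫ 𝕏.str.c ▷ 𝕏.str.T =
      𝕏.str.T ◁ 𝕏.str.c ≫ compLaw 𝕏.str.c 𝕏.str.c
    have h := 𝕏.str.c_braid
    simp only [compLaw, Category.assoc]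
    rw [h, Iso.inv_hom_id_assoc])

/-- The distributive law of a lax tangent morphism, as a tangent 2-morphism
`F ∘ (T', c') ⟶ (T, c) ∘ F`. -/
def lawCell {𝕏' 𝕏 : Tangentad K} (f : 𝕏' ⟶ 𝕏) : tangentHom 𝕏' ≫ f ⟶ f ≫ tangentHom 𝕏 :=
  TangentTwoCell.mk (LaxTangentHom.α f) (by
    change compLaw 𝕏'.str.c (LaxTangentHom.α f) ≫ (LaxTangentHom.α f) ▷ 𝕏.str.T =
      𝕏'.str.T ◁ (LaxTangentHom.α f) ≫ compLaw (LaxTangentHom.α f) 𝕏.str.c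
    have h := (LaxTangentHom.isLaxLaw f).c_comm
    simp only [distSq, Category.assoc] at h
    simp only [compLaw, Category.assoc]
    rw [← cancel_epi (α_ _ _ _).hom, ← cancel_mono (α_ _ _ _).hom]
    simpa using h)

variable (𝕏' 𝕏 : Tangentad K)

/-- The tangent bundle functor of the Hom-tangent category `[𝕏' | 𝕏]`: postcomposition
with `(T, c)`. -/
abbrev homT : (𝕏' ⟶ 𝕏) ⥤ (𝕏' ⟶ 𝕏) := postcomp 𝕏' (tangentHom 𝕏)

/-- The projection of the Hom-tangent category `[𝕏' | 𝕏]`. -/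
def homP : homT 𝕏' 𝕏 ⟶ 𝟭 (𝕏' ⟶ 𝕏) where
  app f := f ◁ projCell 𝕏 ≫ (ρ_ f).hom
  naturality f g η := by
    change η ▷ tangentHom 𝕏 ≫ g ◁ projCell 𝕏 ≫ (ρ_ g).hom = (f ◁ projCell 𝕏 ≫ (ρ_ f).hom) ≫ η
    rw [← whisker_exchange_assoc]; simp

/-- The canonical flip of the Hom-tangent category `[𝕏' | 𝕏]`. -/
def homC : homT 𝕏' 𝕏 ⋙ homT 𝕏' 𝕏 ⟶ homT 𝕏' 𝕏 ⋙ homT 𝕏' 𝕏 where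
  app f := (α_ f _ _).hom ≫ f ◁ flipCell 𝕏 ≫ (α_ f _ _).inv
  naturality f g η := by
    change (η ▷ tangentHom 𝕏) ▷ tangentHom 𝕏 ≫ (α_ g _ _).hom ≫ g ◁ flipCell 𝕏 ≫ (α_ g _ _).inv =
      ((α_ f _ _).hom ≫ f ◁ flipCell 𝕏 ≫ (α_ f _ _).inv) ≫ (η ▷ tangentHom 𝕏) ▷ tangentHom 𝕏
    rw [associator_naturality_left_assoc, ← whisker_exchange_assoc]; simp

lemma homC_homP (f : 𝕏' ⟶ 𝕏) :
    (homC 𝕏' 𝕏).app f ≫ (homP 𝕏' 𝕏).app ((homT 𝕏' 𝕏).obj f) =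
      (homT 𝕏' 𝕏).map ((homP 𝕏' 𝕏).app f) := by
  exact aux_flip_proj (twoCell_ext 𝕏.str.c_hom.q_comm) f

end Tangentads

/-! ## Vector fields -/

section VectorFields

variable {C : Type u₁} [Category.{v₁} C] {T : C ⥤ C}

/-- A vector field on an object `M`: a section of the projection `p : T M ⟶ M`. -/
structure VectorField (p : T ⟶ 𝟭 C) where
  /-- the base object -/
  M : C
  /-- the section -/
  v : M ⟶ T.obj M
  sec : v ≫ p.app M = 𝟙 M

/-- A morphism of vector fields. -/
@[ext]
structure VectorField.Hom {p : T ⟶ 𝟭 C} (V W : VectorField p) where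
  /-- the underlying morphism -/
  f : V.M ⟶ W.M
  comm : V.v ≫ T.map f = f ≫ W.v

instance (p : T ⟶ 𝟭 C) : Category (VectorField p) where
  Hom V W := VectorField.Hom V W
  id V := ⟨𝟙 _, by simp⟩
  comp a b := ⟨a.f ≫ b.f, by rw [T.map_comp, reassoc_of% a.comm, b.comm, Category.assoc]⟩
  id_comp _ := VectorField.Hom.ext (Category.id_comp _)
  comp_id _ := VectorField.Hom.ext (Category.comp_id _)
  assoc _ _ _ := VectorField.Hom.ext (Category.assoc _ _ _)

namespace VectorField

variable {p : T ⟶ 𝟭 C}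

@[simp]
lemma id_f (V : VectorField p) : VectorField.Hom.f (𝟙 V) = 𝟙 V.M := rfl

@[simp]
lemma comp_f {V W Z : VectorField p} (a : V ⟶ W) (b : W ⟶ Z) :
    VectorField.Hom.f (a ≫ b) = a.f ≫ b.f := rfl

@[ext]
lemma hom_ext {V W : VectorField p} {a b : V ⟶ W} (h : a.f = b.f) : a = b :=
  VectorField.Hom.ext h

/-- The forgetful functor `(M, v) ↦ M`. -/
@[simps]
def forget (p : T ⟶ 𝟭 C) : VectorField p ⥤ C where
  obj V := V.M
  map a := a.f

/-- The tangent bundle functor of vector fields: `(M, v) ↦ (T M, c ∘ T v)`. -/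
@[simps]
def tangent (p : T ⟶ 𝟭 C) (c : T ⋙ T ⟶ T ⋙ T)
    (hc : ∀ M, c.app M ≫ p.app (T.obj M) = T.map (p.app M)) : VectorField p ⥤ VectorField p where
  obj V := ⟨T.obj V.M, T.map V.v ≫ c.app V.M, by
    have h := congrArg T.map V.sec
    rw [T.map_comp] at h
    rw [Category.assoc, hc]
    exact h.trans (T.map_id _)⟩
  map {V W} a := ⟨T.map a.f, by
    have h := c.naturality a.f
    simp only [Functor.comp_map] at h
    change (T.map V.v ≫ c.app V.M) ≫ T.map (T.map a.f) = T.map a.f ≫ T.map W.v ≫ c.app W.M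
    rw [Category.assoc, ← h, ← T.map_comp_assoc, a.comm, T.map_comp_assoc]⟩
  map_id V := hom_ext (T.map_id _)
  map_comp a b := hom_ext (T.map_comp _ _)

end VectorField

end VectorFields

/-! ## The construction of vector fields for tangentads -/

section Construction

variable {K : Type u} [Bicategory.{w, v} K]

/-- The category `VF[𝕏' | 𝕏]` of vector fields of the Hom-tangent category `[𝕏' | 𝕏]`. -/
abbrev HomVF (𝕏' 𝕏 : Tangentad K) := VectorField (homP 𝕏' 𝕏)

/-- The tangent bundle functor of `VF[𝕏' | 𝕏]`. -/
abbrev homVFT (𝕏' 𝕏 : Tangentad K) : HomVF 𝕏' 𝕏 ⥤ HomVF 𝕏' 𝕏 :=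
  VectorField.tangent (homP 𝕏' 𝕏) (homC 𝕏' 𝕏) (homC_homP 𝕏' 𝕏)

/-- The functor `Γ : [𝕏' | 𝕍] ⥤ VF[𝕏' | 𝕏]` induced by a vector field in `[𝕍 | 𝕏]`: it sends `H`
to `u_H : G ∘ H ⟶ T ∘ G ∘ H`. -/
def Gam {𝕍 𝕏 : Tangentad K} (u : HomVF 𝕍 𝕏) (𝕏' : Tangentad K) : (𝕏' ⟶ 𝕍) ⥤ HomVF 𝕏' 𝕏 where
  obj H := ⟨H ≫ u.M, H ◁ u.v ≫ (α_ H u.M (tangentHom 𝕏)).inv, aux_sec u.sec H⟩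
  map η := ⟨η ▷ u.M, aux_map u.v η⟩
  map_id _ := VectorField.hom_ext (id_whiskerRight _ _)
  map_comp _ _ := VectorField.hom_ext (comp_whiskerRight _ _ _)

/-- The distributive law `Γ ∘ T ⟶ T ∘ Γ` of the lax tangent morphism
`Γ : [𝕏' | 𝕍] ⟶ VF[𝕏' | 𝕏]`, induced by the distributive law of the base of `u`. -/
def GamLaw {𝕍 𝕏 : Tangentad K} (u : HomVF 𝕍 𝕏) (𝕏' : Tangentad K) :
    homT 𝕏' 𝕍 ⋙ Gam u 𝕏' ⟶ Gam u 𝕏' ⋙ homVFT 𝕏' 𝕏 where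
  app H := VectorField.Hom.mk ((α_ H _ _).hom ≫ H ◁ lawCell u.M ≫ (α_ H _ _).inv)
    (aux_law (twoCell_ext (aux_lawCell 𝕏.str.c_c u.v.comm)) H)
  naturality _ _ η := VectorField.hom_ext (aux_naturality (lawCell u.M) η)

/-- The vector field of `[𝕍 | 𝕏]` with base `(F, α)` and underlying 2-morphism `v`. -/
def mkHomVF {𝕍 𝕏 : Tangentad K} (F : 𝕍.base ⟶ 𝕏.base) (α : 𝕍.str.T ≫ F ⟶ F ≫ 𝕏.str.T)
    (hα : IsLaxLaw 𝕍.str 𝕏.str F α) (v : F ⟶ F ≫ 𝕏.str.T)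
    (hv : α ≫ v ▷ 𝕏.str.T = 𝕍.str.T ◁ v ≫ compLaw α 𝕏.str.c)
    (sec : v ≫ F ◁ 𝕏.str.p.q ≫ (ρ_ F).hom = 𝟙 F) : HomVF 𝕍 𝕏 where
  M := LaxTangentHom.mk F α hα
  v := TangentTwoCell.mk v hv
  sec := twoCell_ext sec

/-- `u` is a universal vector field of `𝕏`: its base is a strict tangent morphism `𝕍 ⟶ 𝕏`, and the
induced tangent morphism `Γ : [𝕏' | 𝕍] ⟶ VF[𝕏' | 𝕏]` is invertible for every tangentad `𝕏'`, that
is, its underlying functor and its distributive law are invertible. -/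
structure IsUniversalVectorField {𝕍 𝕏 : Tangentad K} (u : HomVF 𝕍 𝕏) : Prop where
  isStrict : LaxTangentHom.IsStrict u.M
  invertible : ∀ 𝕏' : Tangentad K,
    (∃ Λ : HomVF 𝕏' 𝕏 ⥤ (𝕏' ⟶ 𝕍), Gam u 𝕏' ⋙ Λ = 𝟭 _ ∧ Λ ⋙ Gam u 𝕏' = 𝟭 _) ∧
      IsIso (GamLaw u 𝕏')

variable (K) in
/-- The 2-category `K` admits the construction of vector fields. -/
def AdmitsVectorFields [Bicategory.Strict K] : Prop :=
  ∀ 𝕏 : Tangentad K, ∃ (𝕍 : Tangentad K) (u : HomVF 𝕍 𝕏), IsUniversalVectorField u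

end Construction

/-! ## The 2-category of monads -/

section Monads

set_option linter.checkUnivs false in
/-- A monad: a category together with a monad on it. -/
structure MndCat : Type (max (v₁ + 1) (u₁ + 1)) where
  /-- the base category -/
  C : Type u₁
  [cat : Category.{v₁} C]
  /-- the monad -/
  S : CategoryTheory.Monad C

attribute [instance] MndCat.cat

/-- A (lax) morphism of monads `(C, S) ⟶ (D, R)`: a functor `F : C ⥤ D` with a natural
transformation `φ : R F ⟶ F S` compatible with the units and the multiplications. -/
structure MonadMor (𝔸 𝔹 : MndCat.{v₁, u₁}) where
  /-- the underlying functor -/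
  F : 𝔸.C ⥤ 𝔹.C
  /-- the distributive law -/
  φ : F ⋙ 𝔹.S.toFunctor ⟶ 𝔸.S.toFunctor ⋙ F
  unit : ∀ M, 𝔹.S.η.app (F.obj M) ≫ φ.app M = F.map (𝔸.S.η.app M)
  mult : ∀ M, 𝔹.S.μ.app (F.obj M) ≫ φ.app M =
    𝔹.S.map (φ.app M) ≫ φ.app (𝔸.S.obj M) ≫ F.map (𝔸.S.μ.app M)

/-- A 2-morphism of monad morphisms: a natural transformation compatible with the
distributive laws. -/
@[ext]
structure MonadMorTwoCell {𝔸 𝔹 : MndCat.{v₁, u₁}} (f g : MonadMor 𝔸 𝔹) where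
  /-- the underlying natural transformation -/
  τ : f.F ⟶ g.F
  comm : ∀ M, 𝔹.S.map (τ.app M) ≫ g.φ.app M = f.φ.app M ≫ τ.app (𝔸.S.obj M)

namespace MonadMor

instance (𝔸 𝔹 : MndCat.{v₁, u₁}) : Category (MonadMor 𝔸 𝔹) where
  Hom f g := MonadMorTwoCell f g
  id f := ⟨𝟙 _, by simp⟩
  comp {f g h} a b := ⟨a.τ ≫ b.τ, fun M => by
    simp [b.comm, reassoc_of% a.comm]⟩
  id_comp _ := MonadMorTwoCell.ext (Category.id_comp _)
  comp_id _ := MonadMorTwoCell.ext (Category.comp_id _)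
  assoc _ _ _ := MonadMorTwoCell.ext (Category.assoc _ _ _)

variable {𝔸 𝔹 𝔻 : MndCat.{v₁, u₁}}

@[simp]
lemma id_τ (f : MonadMor 𝔸 𝔹) : MonadMorTwoCell.τ (𝟙 f) = 𝟙 f.F := rfl

@[simp]
lemma comp_τ {f g h : MonadMor 𝔸 𝔹} (a : f ⟶ g) (b : g ⟶ h) :
    MonadMorTwoCell.τ (a ≫ b) = a.τ ≫ b.τ := rfl

@[ext]
lemma hom_ext_app {f g : MonadMor 𝔸 𝔹} {a b : f ⟶ g} (h : ∀ M, a.τ.app M = b.τ.app M) :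
    a = b :=
  MonadMorTwoCell.ext (NatTrans.ext (funext h))

/-- The identity morphism of monads. -/
@[simps]
def idFunctor (𝔸 : MndCat.{v₁, u₁}) : MonadMor 𝔸 𝔸 where
  F := 𝟭 _
  φ := { app := fun M => 𝟙 (𝔸.S.obj M) }
  unit M := by simp
  mult M := by simp

/-- The composite of two morphisms of monads. -/
@[simps]
def compFunctor (f : MonadMor 𝔸 𝔹) (g : MonadMor 𝔹 𝔻) : MonadMor 𝔸 𝔻 where
  F := f.F ⋙ g.F
  φ :=
    { app := fun M => g.φ.app (f.F.obj M) ≫ g.F.map (f.φ.app M)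
      naturality := fun M N a => by
        have h1 := g.φ.naturality (f.F.map a)
        have h2 := congrArg g.F.map (f.φ.naturality a)
        simp only [Functor.comp_map, Functor.map_comp] at h1 h2
        simp only [Functor.comp_map, Category.assoc]
        rw [reassoc_of% h1, h2] }
  unit M := by
    have h := congrArg g.F.map (f.unit M)
    rw [Functor.map_comp] at h
    simp only [Functor.comp_obj, Functor.comp_map]
    rw [reassoc_of% (g.unit (f.F.obj M)), h]
  mult M := by
    have h := congrArg g.F.map (f.mult M)
    have h' := g.φ.naturality (f.φ.app M)
    simp only [Functor.comp_map, Functor.map_comp] at h h'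
    simp only [Functor.comp_obj, Functor.comp_map, Functor.map_comp, Category.assoc]
    rw [reassoc_of% (g.mult (f.F.obj M)), h]
    rw [reassoc_of% h']

/-- A monad 2-morphism with invertible underlying natural transformation, as an isomorphism. -/
@[simps]
def isoOf {f g : MonadMor 𝔸 𝔹} (e : f.F ≅ g.F)
    (h : ∀ M, 𝔹.S.map (e.hom.app M) ≫ g.φ.app M = f.φ.app M ≫ e.hom.app (𝔸.S.obj M)) :
    f ≅ g where
  hom := ⟨e.hom, h⟩
  inv := ⟨e.inv, fun M => by
    rw [← cancel_epi (𝔹.S.map (e.hom.app M)), reassoc_of% h M, ← Functor.map_comp_assoc]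
    simp⟩
  hom_inv_id := by ext; simp
  inv_hom_id := by ext; simp

/-- Left whiskering. -/
@[simps]
def wLeft (f : MonadMor 𝔸 𝔹) {g h : MonadMor 𝔹 𝔻} (η : g ⟶ h) :
    compFunctor f g ⟶ compFunctor f h where
  τ := Functor.whiskerLeft f.F η.τ
  comm M := by
    have e := η.τ.naturality (f.φ.app M)
    change 𝔻.S.map (η.τ.app (f.F.obj M)) ≫ h.φ.app (f.F.obj M) ≫ h.F.map (f.φ.app M) =
      (g.φ.app (f.F.obj M) ≫ g.F.map (f.φ.app M)) ≫ η.τ.app (f.F.obj (𝔸.S.obj M))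
    rw [reassoc_of% (η.comm (f.F.obj M)), Category.assoc]
    exact congrArg (_ ≫ ·) e.symm

/-- Right whiskering. -/
@[simps]
def wRight {f g : MonadMor 𝔸 𝔹} (η : f ⟶ g) (h : MonadMor 𝔹 𝔻) :
    compFunctor f h ⟶ compFunctor g h where
  τ := Functor.whiskerRight η.τ h.F
  comm M := by
    have e := h.φ.naturality (η.τ.app M)
    have e' := congrArg h.F.map (η.comm M)
    simp only [Functor.comp_map, Functor.map_comp] at e e'
    change 𝔻.S.map (h.F.map (η.τ.app M)) ≫ h.φ.app (g.F.obj M) ≫ h.F.map (g.φ.app M) =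
      (h.φ.app (f.F.obj M) ≫ h.F.map (f.φ.app M)) ≫ h.F.map (η.τ.app (𝔸.S.obj M))
    rw [reassoc_of% e, e', Category.assoc]

lemma ext_of_app {f g : MonadMor 𝔸 𝔹} (hF : f.F = g.F)
    (hφ : ∀ M, f.φ.app M = 𝔹.S.map (eqToHom (congrArg (·.obj M) hF)) ≫ g.φ.app M ≫
      eqToHom (congrArg (·.obj (𝔸.S.obj M)) hF.symm)) : f = g := by
  obtain ⟨F, φ, _, _⟩ := f
  obtain ⟨G, ψ, _, _⟩ := g
  obtain rfl : F = G := hF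
  obtain rfl : φ = ψ := by
    ext M
    simpa using hφ M
  rfl

lemma eqToHom_τ_app {f g : MonadMor 𝔸 𝔹} (h : f = g) (M : 𝔸.C) :
    (MonadMorTwoCell.τ (eqToHom h)).app M = eqToHom (by rw [h]) := by
  subst h; rfl

end MonadMor

section Auxiliary

variable {C : Type u₁} [Category.{v₁} C] {D : Type u₂} [Category.{v₂} D]

lemma aux_id {x y : C} (a : x ⟶ y) : a = 𝟙 x ≫ a ≫ 𝟙 y := by simp

lemma aux_left (S : D ⥤ D) (F : C ⥤ D) {x : D} {y : C} (a : S.obj x ⟶ F.obj y) :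
    S.map (𝟙 x) ≫ a = (a ≫ F.map (𝟙 y)) ≫ 𝟙 _ := by simp

lemma aux_right (S : C ⥤ C) {x y : C} (a : S.obj x ⟶ y) :
    S.map (𝟙 x) ≫ a = (𝟙 _ ≫ a) ≫ 𝟙 _ := by simp

lemma aux_eq (S : C ⥤ C) {x y : C} {a b : S.obj x ⟶ y} (h : a = b) :
    a = S.map (𝟙 x) ≫ b ≫ 𝟙 _ := by simp [h]

lemma aux_assoc (S : D ⥤ D) (G : C ⥤ D) {x : D} {y z w : C} (a : S.obj x ⟶ G.obj y)
    (b : y ⟶ z) (c : z ⟶ w) :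
    S.map (𝟙 x) ≫ (a ≫ G.map b) ≫ G.map c = (a ≫ G.map (b ≫ c)) ≫ 𝟙 _ := by simp

lemma aux_assoc' (G : C ⥤ D) {x : D} {y z w : C} (a : x ⟶ G.obj y)
    (b : y ⟶ z) (c : z ⟶ w) :
    a ≫ G.map (b ≫ c) = (a ≫ G.map b) ≫ G.map c := by simp

lemma aux_pentagon (F : C ⥤ D) (x : C) :
    F.map (𝟙 x) ≫ 𝟙 (F.obj x) ≫ 𝟙 (F.obj x) = 𝟙 (F.obj x) ≫ 𝟙 (F.obj x) := by simp

lemma aux_triangle (F : C ⥤ D) (x : C) :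
    𝟙 (F.obj x) ≫ 𝟙 (F.obj x) = F.map (𝟙 x) := by simp

end Auxiliary

open MonadMor in
/-- The 2-category `Mnd` of monads. -/
instance : Bicategory MndCat.{v₁, u₁} where
  Hom := MonadMor
  id := idFunctor
  comp := compFunctor
  homCategory := inferInstance
  whiskerLeft f _ _ η := wLeft f η
  whiskerRight η h := wRight η h
  associator {_ _ _ d} f g h := isoOf (f := compFunctor (compFunctor f g) h)
    (g := compFunctor f (compFunctor g h)) (Functor.associator f.F g.F h.F)
    (fun M => aux_assoc d.S.toFunctor h.F (h.φ.app (g.F.obj (f.F.obj M)))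
      (g.φ.app (f.F.obj M)) (g.F.map (f.φ.app M)))
  leftUnitor {_ b} f := isoOf (f := compFunctor (idFunctor _) f) (Functor.leftUnitor f.F)
    (fun M => aux_left b.S.toFunctor f.F (f.φ.app M))
  rightUnitor {_ b} f := isoOf (f := compFunctor f (idFunctor _)) (Functor.rightUnitor f.F)
    (fun M => aux_right b.S.toFunctor (f.φ.app M))
  whiskerLeft_id _ _ := hom_ext_app fun _ => rfl
  whiskerLeft_comp _ _ _ _ _ _ := hom_ext_app fun _ => rfl
  id_whiskerLeft a := hom_ext_app fun M => aux_id (a.τ.app M)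
  comp_whiskerLeft f g _ _ a := hom_ext_app fun M => aux_id (a.τ.app (g.F.obj (f.F.obj M)))
  id_whiskerRight f g := hom_ext_app fun M => g.F.map_id (f.F.obj M)
  comp_whiskerRight a b h := hom_ext_app fun M => h.F.map_comp (a.τ.app M) (b.τ.app M)
  whiskerRight_id a := hom_ext_app fun M => aux_id (a.τ.app M)
  whiskerRight_comp a g h := hom_ext_app fun M => aux_id (h.F.map (g.F.map (a.τ.app M)))
  whisker_assoc f _ _ a h := hom_ext_app fun M => aux_id (h.F.map (a.τ.app (f.F.obj M)))
  whisker_exchange a b := hom_ext_app fun M => (b.τ.naturality (a.τ.app M)).symm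
  pentagon f g h i := hom_ext_app fun M => aux_pentagon i.F (h.F.obj (g.F.obj (f.F.obj M)))
  triangle f g := hom_ext_app fun M => aux_triangle g.F (f.F.obj M)

namespace MonadMor

variable {𝔸 𝔹 𝔻 𝔼 : MndCat.{v₁, u₁}}

lemma idFunctor_compFunctor (f : MonadMor 𝔸 𝔹) : compFunctor (idFunctor 𝔸) f = f :=
  ext_of_app rfl fun M =>
    aux_eq 𝔹.S.toFunctor (show f.φ.app M ≫ f.F.map (𝟙 _) = f.φ.app M by simp)

lemma compFunctor_idFunctor (f : MonadMor 𝔸 𝔹) : compFunctor f (idFunctor 𝔹) = f :=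
  ext_of_app rfl fun M => aux_eq 𝔹.S.toFunctor (Category.id_comp (f.φ.app M))

lemma compFunctor_assoc (f : MonadMor 𝔸 𝔹) (g : MonadMor 𝔹 𝔻) (h : MonadMor 𝔻 𝔼) :
    compFunctor (compFunctor f g) h = compFunctor f (compFunctor g h) :=
  ext_of_app rfl fun M => aux_eq 𝔼.S.toFunctor
    (aux_assoc' h.F (h.φ.app (g.F.obj (f.F.obj M))) (g.φ.app (f.F.obj M)) (g.F.map (f.φ.app M)))

end MonadMor

open MonadMor in
instance : Bicategory.Strict MndCat.{v₁, u₁} where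
  id_comp f := idFunctor_compFunctor f
  comp_id f := compFunctor_idFunctor f
  assoc f g h := compFunctor_assoc f g h
  leftUnitor_eqToIso f := Iso.ext (hom_ext_app fun M =>
    (eqToHom_τ_app (idFunctor_compFunctor f) M).symm)
  rightUnitor_eqToIso f := Iso.ext (hom_ext_app fun M =>
    (eqToHom_τ_app (compFunctor_idFunctor f) M).symm)
  associator_eqToIso f g h := Iso.ext (hom_ext_app fun M =>
    (eqToHom_τ_app (compFunctor_assoc f g h) M).symm)

end Monads

/-! ## Tangent monads and the lifted tangent monad on vector fields

A tangent monad `(S, α)` on a tangent category `(X, T)` is a tangentad `𝕏` of `Mnd`: its base is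
`(X, S)`, and the tangent bundle 1-morphism is `(T, α)` with `α : S T ⟶ T S`. -/

section TangentMonads

variable (𝕏 : Tangentad MndCat.{v₁, u₁})

/-- The tangent bundle functor `T` of a tangent monad. -/
def tanF : 𝕏.base.C ⥤ 𝕏.base.C := MonadMor.F 𝕏.str.T

/-- The distributive law `α : S T ⟶ T S` of a tangent monad. -/
def tanLaw : tanF 𝕏 ⋙ 𝕏.base.S.toFunctor ⟶ 𝕏.base.S.toFunctor ⋙ tanF 𝕏 := MonadMor.φ 𝕏.str.T

/-- The projection `p : T ⟶ id` of a tangent monad. -/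
def tanProj : tanF 𝕏 ⟶ 𝟭 _ := MonadMorTwoCell.τ 𝕏.str.p.q

/-- The canonical flip `c : T T ⟶ T T` of a tangent monad. -/
def tanFlip : tanF 𝕏 ⋙ tanF 𝕏 ⟶ tanF 𝕏 ⋙ tanF 𝕏 := MonadMorTwoCell.τ 𝕏.str.c

variable {𝕏}

lemma tanLaw_proj (M : 𝕏.base.C) : (tanLaw 𝕏).app M ≫ (tanProj 𝕏).app (𝕏.base.S.obj M) =
    𝕏.base.S.map ((tanProj 𝕏).app M) := by
  have h : 𝕏.base.S.map ((tanProj 𝕏).app M) ≫ 𝟙 _ =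
      (tanLaw 𝕏).app M ≫ (tanProj 𝕏).app (𝕏.base.S.obj M) := MonadMorTwoCell.comm 𝕏.str.p.q M
  rw [← h, Category.comp_id]

lemma tanLaw_flip (M : 𝕏.base.C) : 𝕏.base.S.map ((tanFlip 𝕏).app M) ≫
      (tanLaw 𝕏).app ((tanF 𝕏).obj M) ≫ (tanF 𝕏).map ((tanLaw 𝕏).app M) =
    ((tanLaw 𝕏).app ((tanF 𝕏).obj M) ≫ (tanF 𝕏).map ((tanLaw 𝕏).app M)) ≫
      (tanFlip 𝕏).app (𝕏.base.S.obj M) :=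
  MonadMorTwoCell.comm 𝕏.str.c M

lemma tanFlip_proj (M : 𝕏.base.C) : (tanFlip 𝕏).app M ≫ (tanProj 𝕏).app ((tanF 𝕏).obj M) =
    (tanF 𝕏).map ((tanProj 𝕏).app M) := by
  have h := congrArg (fun a => (MonadMorTwoCell.τ a).app M) 𝕏.str.c_hom.q_comm
  have h' : (tanFlip 𝕏).app M ≫ (tanProj 𝕏).app ((tanF 𝕏).obj M) =
    (tanF 𝕏).map ((tanProj 𝕏).app M) ≫ 𝟙 _ ≫ 𝟙 _ := h
  simpa using h'

lemma tanLaw_unit (M : 𝕏.base.C) : 𝕏.base.S.η.app ((tanF 𝕏).obj M) ≫ (tanLaw 𝕏).app M =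
    (tanF 𝕏).map (𝕏.base.S.η.app M) :=
  MonadMor.unit 𝕏.str.T M

lemma tanLaw_mult (M : 𝕏.base.C) : 𝕏.base.S.μ.app ((tanF 𝕏).obj M) ≫ (tanLaw 𝕏).app M =
    𝕏.base.S.map ((tanLaw 𝕏).app M) ≫ (tanLaw 𝕏).app (𝕏.base.S.obj M) ≫
      (tanF 𝕏).map (𝕏.base.S.μ.app M) :=
  MonadMor.mult 𝕏.str.T M

variable (𝕏)

/-- The lifted endofunctor on vector fields: `(M, v) ↦ (S M, α ∘ S v)`, `f ↦ S f`. -/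
@[simps]
def vfFunctor : VectorField (tanProj 𝕏) ⥤ VectorField (tanProj 𝕏) where
  obj V := ⟨𝕏.base.S.obj V.M, 𝕏.base.S.map V.v ≫ (tanLaw 𝕏).app V.M, by
    have h := congrArg 𝕏.base.S.map V.sec
    rw [CategoryTheory.Functor.map_comp, CategoryTheory.Functor.map_id] at h
    rw [Category.assoc, tanLaw_proj]
    exact h⟩
  map {V W} a := ⟨𝕏.base.S.map a.f, by
    have h := (tanLaw 𝕏).naturality a.f
    simp only [Functor.comp_map] at h
    change (𝕏.base.S.map V.v ≫ (tanLaw 𝕏).app V.M) ≫ (tanF 𝕏).map (𝕏.base.S.map a.f) =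
      𝕏.base.S.map a.f ≫ 𝕏.base.S.map W.v ≫ (tanLaw 𝕏).app W.M
    rw [Category.assoc, ← h, ← Functor.map_comp_assoc, a.comm, Functor.map_comp_assoc]⟩
  map_id V := VectorField.hom_ext (𝕏.base.S.map_id V.M)
  map_comp a b := VectorField.hom_ext (𝕏.base.S.map_comp a.f b.f)

/-- The lifted monad `VF(S, α)` on vector fields, with the unit and multiplication of `S`. -/
def vfMonad : CategoryTheory.Monad (VectorField (tanProj 𝕏)) where
  toFunctor := vfFunctor 𝕏
  η :=
    { app := fun V => ⟨𝕏.base.S.η.app V.M, by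
        change V.v ≫ (tanF 𝕏).map (𝕏.base.S.η.app V.M) =
          𝕏.base.S.η.app V.M ≫ 𝕏.base.S.map V.v ≫ (tanLaw 𝕏).app V.M
        rw [← tanLaw_unit, ← Category.assoc, ← Category.assoc, Monad.unit_naturality]⟩
      naturality := fun _ _ a => VectorField.hom_ext (𝕏.base.S.η.naturality a.f) }
  μ :=
    { app := fun V => ⟨𝕏.base.S.μ.app V.M, by
        change (𝕏.base.S.map (𝕏.base.S.map V.v ≫ (tanLaw 𝕏).app V.M) ≫
            (tanLaw 𝕏).app (𝕏.base.S.obj V.M)) ≫ (tanF 𝕏).map (𝕏.base.S.μ.app V.M) =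
          𝕏.base.S.μ.app V.M ≫ 𝕏.base.S.map V.v ≫ (tanLaw 𝕏).app V.M
        rw [← Monad.mu_naturality_assoc, tanLaw_mult, Functor.map_comp, Category.assoc,
          Category.assoc]⟩
      naturality := fun _ _ a => VectorField.hom_ext (𝕏.base.S.μ.naturality a.f) }
  assoc V := VectorField.hom_ext (𝕏.base.S.assoc V.M)
  left_unit V := VectorField.hom_ext (𝕏.base.S.left_unit V.M)
  right_unit V := VectorField.hom_ext (𝕏.base.S.right_unit V.M)

end TangentMonads

section LiftedTangentMonad

variable (𝕏 : Tangentad MndCat.{v₁, max u₁ v₁})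

/-- The base `(VF(X, T), VF(S, α))` of the lifted tangent monad. -/
def vfBase : MndCat.{v₁, max u₁ v₁} where
  C := VectorField (tanProj 𝕏)
  S := vfMonad 𝕏

/-- The tangent bundle 1-morphism of the lifted tangent monad: the functor
`(M, v) ↦ (T M, c ∘ T v)`, `f ↦ T f`, with the distributive law `α`. -/
def vfT : vfBase 𝕏 ⟶ vfBase 𝕏 :=
  MonadMor.mk (VectorField.tangent (tanProj 𝕏) (tanFlip 𝕏) tanFlip_proj)
    { app := fun (V : VectorField (tanProj 𝕏)) => VectorField.Hom.mk ((tanLaw 𝕏).app V.M) (by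
        have h := (tanLaw 𝕏).naturality V.v
        have h' := tanLaw_flip V.M
        simp only [Functor.comp_map] at h
        change (𝕏.base.S.map ((tanF 𝕏).map V.v ≫ (tanFlip 𝕏).app V.M) ≫
            (tanLaw 𝕏).app ((tanF 𝕏).obj V.M)) ≫ (tanF 𝕏).map ((tanLaw 𝕏).app V.M) =
          (tanLaw 𝕏).app V.M ≫ (tanF 𝕏).map (𝕏.base.S.map V.v ≫ (tanLaw 𝕏).app V.M) ≫
            (tanFlip 𝕏).app (𝕏.base.S.obj V.M)
        rw [Functor.map_comp, Functor.map_comp, Category.assoc, Category.assoc, h',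
          Category.assoc, Category.assoc, ← reassoc_of% h])
      naturality := fun (V W : VectorField (tanProj 𝕏)) (a : V ⟶ W) =>
        VectorField.hom_ext ((tanLaw 𝕏).naturality a.f) }
    (fun V => VectorField.hom_ext (tanLaw_unit (VectorField.M V)))
    (fun V => VectorField.hom_ext (tanLaw_mult (VectorField.M V)))

/-- The forgetful 1-morphism `(M, v) ↦ M` of `Mnd`, with identity distributive law. -/
def vfForget : vfBase 𝕏 ⟶ 𝕏.base :=
  MonadMor.mk (VectorField.forget (tanProj 𝕏))
    { app := fun (V : VectorField (tanProj 𝕏)) => 𝟙 (𝕏.base.S.obj V.M)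
      naturality := fun (V W : VectorField (tanProj 𝕏)) (a : V ⟶ W) =>
        (Category.comp_id (𝕏.base.S.map a.f)).trans (Category.id_comp (𝕏.base.S.map a.f)).symm }
    (fun V => Category.comp_id (𝕏.base.S.η.app (VectorField.M V)))
    (fun V => by
      change 𝕏.base.S.μ.app (VectorField.M V) ≫ 𝟙 _ =
        𝕏.base.S.map (𝟙 _) ≫ 𝟙 _ ≫ 𝕏.base.S.μ.app (VectorField.M V)
      simp)

/-- The universal 2-morphism `(M, v) ↦ (v : M ⟶ T M)`. -/
def vfUniv : vfForget 𝕏 ⟶ vfForget 𝕏 ≫ 𝕏.str.T :=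
  MonadMorTwoCell.mk
    { app := fun (V : VectorField (tanProj 𝕏)) => V.v
      naturality := fun (V W : VectorField (tanProj 𝕏)) (a : V ⟶ W) => a.comm.symm }
    (fun V => by
      change 𝕏.base.S.map (VectorField.v V) ≫ (tanLaw 𝕏).app (VectorField.M V) ≫
          (tanF 𝕏).map (𝟙 _) =
        𝟙 _ ≫ 𝕏.base.S.map (VectorField.v V) ≫ (tanLaw 𝕏).app (VectorField.M V)
      simp)

end LiftedTangentMonad

end TangentTheory

open TangentTheory

universe v u

namespace TangentTheory

universe w w₁ v₁ u₁ v₂ u₂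

attribute [-instance] CategoryTheory.instCategoryEndMonoidal CategoryTheory.catToReflQuiver
  CategoryTheory.StrictBicategory.category

/-! ## Fibre powers and additive bundles -/

section FibrePowers

variable {C : Type u₁} [Category.{v₁} C] {D : Type u₂} [Category.{v₂} D]

/-! Write U for the forgetful 1-morphism `vfForget`. The monad `vfBase` represents vector fields
before any tangent structure is put on it. A 1-morphism `Y ⟶ vfBase 𝕏` amounts to a 1-morphism G
into the base of `𝕏` with a section x : G ⟶ T G of the projection (`vfMk`, `vfMor_ext`), because
compatibility of x with the monads says exactly that the distributive law of G consists of morphisms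
of vector fields. A 2-morphism into `vfBase` amounts to a 2-morphism after U that commutes with the
vector fields (`liftCell`, `whiskerRight_vfForget_injective`).

The tangent structure is then lifted along U. By naturality and the axioms on the flip c, the
2-morphisms p, z, l, c respect the vector fields c ∘ Tv. Since T preserves the n-fold pullbacks of
p, these also carry vector fields (`exists_powCell`). The sum lifts because the comparison T T₂ ⟶ T₂
T induced by c turns the vector field on T₂ into T₂ v (`isVFCell_sum`). Equations lift because
postcomposition with U is faithful.

Limits are created by U: a mediating 2-morphism found after U commutes with the vector fields as
soon as the images under T of the projections are jointly monic (`isVFCell_of_jointlyMono`). For the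
pullbacks of p this is part of the axioms. For the square of the vertical lift preservation by T is
not an axiom; `vertical_jointlyMono` deduces the joint monicity from universality at 1-morphisms of
the form T ∘ G, by moving T past T₂ with the flip.

For the universal property, a vector field in the Hom-tangent category is a tangent 2-morphism. With
c² = 1 this condition says that the distributive law α respects the vector fields, so α lifts too.
Hence Γ is bijective on objects and fully faithful, and its distributive law is invertible because
that of U is. -/

lemma isFibrePower_two_iff {E B P : C} (q : E ⟶ B) (π : Fin 2 → (P ⟶ E)) :
    IsFibrePower q π ↔ IsPullback (π 0) (π 1) q q := by
  constructor
  · rintro ⟨h, hu⟩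
    have hu' : ∀ s : Limits.PullbackCone q q, ∃! k : s.pt ⟶ P,
        ∀ i, k ≫ π i = (![s.fst, s.snd] : Fin 2 → (s.pt ⟶ E)) i := fun s => hu _ fun i j => by
      fin_cases i <;> fin_cases j <;> simp [s.condition]
    refine ⟨⟨h 0 1⟩, ⟨Limits.PullbackCone.IsLimit.mk _ (fun s => (hu' s).choose)
      (fun s => (hu' s).choose_spec.1 0) (fun s => (hu' s).choose_spec.1 1) ?_⟩⟩
    · intro s m h0 h1
      refine (hu' s).choose_spec.2 m fun i => ?_
      fin_cases i
      · exact h0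
      · exact h1
  · intro h
    refine ⟨fun i j => ?_, fun a ha => ⟨h.lift (a 0) (a 1) (ha 0 1), fun i => ?_, fun m hm => ?_⟩⟩
    · fin_cases i <;> fin_cases j <;> simp [h.w]
    · fin_cases i <;> simp
    · apply h.hom_ext
      · simp [hm 0]
      · simp [hm 1]

lemma IsFibrePower.hom_ext {E B P : C} {q : E ⟶ B} {n : ℕ} {π : Fin n → (P ⟶ E)}
    (h : IsFibrePower q π) {A : C} {a b : A ⟶ P} (hab : ∀ i, a ≫ π i = b ≫ π i) : a = b := by
  obtain ⟨_, _, hu⟩ := h.2 (fun i => b ≫ π i) fun i j => by simp [h.1 i j]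
  rw [hu a hab, hu b fun _ => rfl]

lemma IsFibrePower.of_iso {E B P E' B' P' : C} {q : E ⟶ B} {q' : E' ⟶ B'} {n : ℕ}
    {π : Fin n → (P ⟶ E)} {π' : Fin n → (P' ⟶ E')} (h : IsFibrePower q' π')
    (eP : P ≅ P') (eE : E ≅ E') (eB : B ≅ B')
    (hπ : ∀ i, π i ≫ eE.hom = eP.hom ≫ π' i) (hq : q ≫ eB.hom = eE.hom ≫ q') :
    IsFibrePower q π := by
  refine ⟨fun i j => ?_, fun a ha => ?_⟩
  · rw [← cancel_mono eB.hom]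
    simp only [Category.assoc, hq]
    rw [reassoc_of% (hπ i), reassoc_of% (hπ j), h.1 i j]
  · obtain ⟨m, hm, hu⟩ := h.2 (fun i => a i ≫ eE.hom) fun i j => by
      simp only [Category.assoc, ← hq]
      rw [reassoc_of% (ha i j)]
    refine ⟨m ≫ eP.inv, fun i => ?_, fun k hk => ?_⟩
    · rw [← cancel_mono eE.hom, Category.assoc, Category.assoc, hπ, Iso.inv_hom_id_assoc, hm]
    · rw [← hu (k ≫ eP.hom) fun i => by rw [Category.assoc, ← hπ, reassoc_of% (hk i)]]
      simp

lemma IsFibrePower.of_natIso {E B P : C} {q : E ⟶ B} {n : ℕ} {π : Fin n → (P ⟶ E)}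
    {Φ Ψ : C ⥤ D} (h : IsFibrePower (Φ.map q) (fun i => Φ.map (π i))) (e : Ψ ≅ Φ) :
    IsFibrePower (Ψ.map q) (fun i => Ψ.map (π i)) :=
  h.of_iso (e.app P) (e.app E) (e.app B) (fun _ => e.hom.naturality _) (e.hom.naturality _)

/-- If two morphisms into `Φ.obj E` factor through images of x and y along the same k, their sum is
the image of the sum of x and y. Identities for sums in `D` thereby reduce to identities for
universal elements in `C`. -/
lemma lift_comp_map {E B Z E₂ : C} {π₁ π₂ : E₂ ⟶ E} {q : E ⟶ B} {s : E₂ ⟶ E} {Φ : C ⥤ D}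
    (h : IsPullback π₁ π₂ q q) (hΦ : IsPullback (Φ.map π₁) (Φ.map π₂) (Φ.map q) (Φ.map q))
    (x y : Z ⟶ E) (hxy : x ≫ q = y ≫ q) {Y : D} (k : Y ⟶ Φ.obj Z) (x' y' : Y ⟶ Φ.obj E)
    (hxy' : x' ≫ Φ.map q = y' ≫ Φ.map q) (hx : x' = k ≫ Φ.map x) (hy : y' = k ≫ Φ.map y) :
    hΦ.lift x' y' hxy' ≫ Φ.map s = k ≫ Φ.map (h.lift x y hxy ≫ s) := by
  rw [Φ.map_comp, ← Category.assoc]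
  congr 1
  apply hΦ.hom_ext
  · rw [hΦ.lift_fst, Category.assoc, ← Φ.map_comp, h.lift_fst, hx]
  · rw [hΦ.lift_snd, Category.assoc, ← Φ.map_comp, h.lift_snd, hy]

/-- A functor that preserves the fibre powers of `q` preserves additive bundles. -/
lemma AddBundleData.IsAdditive.map {E B : C} {A : AddBundleData E B} (hA : A.IsAdditive)
    (Φ : C ⥤ D) (h : IsPullback (Φ.map A.π₁) (Φ.map A.π₂) (Φ.map A.q) (Φ.map A.q))
    (hn : ∀ n : ℕ, 0 < n → ∃ (P : C) (π : Fin n → (P ⟶ E)), IsFibrePower A.q π ∧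
      IsFibrePower (Φ.map A.q) (fun i => Φ.map (π i))) : (A.map Φ).IsAdditive where
  isPullback := h
  fibrePower n h0 := by
    obtain ⟨P, π, _, hπ⟩ := hn n h0
    exact ⟨_, _, hπ⟩
  z_q := by simp [← Φ.map_comp, hA.z_q]
  s_q := by
    simp only [AddBundleData.map_s, AddBundleData.map_q, AddBundleData.map_π₁]
    exact (Φ.map_comp _ _).symm.trans ((congrArg Φ.map hA.s_q).trans (Φ.map_comp _ _))
  assoc {Y} a b c hab hbc := by
    -- The morphisms a, b, c need not be images under Φ. The threefold fibre power supplies a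
    -- universal triple in `C`, and its image, again a fibre power, classifies (a, b, c).
    obtain ⟨P, π, hπ, hΦ⟩ := hn 3 (by norm_num)
    obtain ⟨m, hm, -⟩ := hΦ.2 (![a, b, c] : Fin 3 → (Y ⟶ Φ.obj E)) (by
      simp only [AddBundleData.map_q] at hab hbc
      intro i j
      fin_cases i <;> fin_cases j <;> simp [hab, hbc])
    obtain rfl : m ≫ Φ.map (π 0) = a := hm 0
    obtain rfl : m ≫ Φ.map (π 1) = b := hm 1
    obtain rfl : m ≫ Φ.map (π 2) = c := hm 2
    have h01 := hπ.1 0 1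
    have h12 := hπ.1 1 2
    have e := hA.assoc (π 0) (π 1) (π 2) h01 h12
    refine (lift_comp_map hA.isPullback h _ _ ?_ m _ _ _
      (lift_comp_map hA.isPullback h _ _ h01 m _ _ _ rfl rfl) rfl).trans
      (Eq.trans (by rw [e]) (lift_comp_map hA.isPullback h _ _ ?_ m _ _ _ rfl
        (lift_comp_map hA.isPullback h _ _ h12 m _ _ _ rfl rfl)).symm)
    rw [Category.assoc, hA.s_q, hA.isPullback.lift_fst_assoc, h01, h12]
  zero_add := by
    refine (lift_comp_map hA.isPullback h (A.q ≫ A.z) (𝟙 E) (by simp [hA.z_q]) (𝟙 _) _ _ _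
      (by simp) (by simp)).trans ?_
    rw [hA.zero_add]
    simp
  comm := by
    refine (lift_comp_map hA.isPullback h A.π₂ A.π₁ hA.isPullback.w.symm (𝟙 _) _ _ _
      (by simp) (by simp)).trans ?_
    rw [hA.comm]
    simp

lemma lift_precomp {P E₁ E₂ B W Y Z : C} {π₁ : P ⟶ E₁} {π₂ : P ⟶ E₂} {q₁ : E₁ ⟶ B}
    {q₂ : E₂ ⟶ B} (h : IsPullback π₁ π₂ q₁ q₂) (s : P ⟶ W) (k : Y ⟶ Z) (x : Z ⟶ E₁) (y : Z ⟶ E₂)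
    (hxy : x ≫ q₁ = y ≫ q₂) (x' : Y ⟶ E₁) (y' : Y ⟶ E₂) (hxy' : x' ≫ q₁ = y' ≫ q₂)
    (hx : x' = k ≫ x) (hy : y' = k ≫ y) : h.lift x' y' hxy' ≫ s = k ≫ h.lift x y hxy ≫ s := by
  rw [← Category.assoc]
  congr 1
  apply h.hom_ext <;> simp [hx, hy]

/-- A faithful functor reflects additive bundles. -/
lemma AddBundleData.IsAdditive.of_faithful {E B : C} {A : AddBundleData E B} (Φ : C ⥤ D)
    [Φ.Faithful] {E' B' : D} {A' : AddBundleData E' B'} (hA' : A'.IsAdditive)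
    (f : Φ.obj B ⟶ B') (g : Φ.obj E ⟶ E') (g₂ : Φ.obj A.E₂ ⟶ A'.E₂) (_ : Mono g)
    (h₁ : g₂ ≫ A'.π₁ = Φ.map A.π₁ ≫ g) (h₂ : g₂ ≫ A'.π₂ = Φ.map A.π₂ ≫ g)
    (hs : Φ.map A.s ≫ g = g₂ ≫ A'.s) (hz : Φ.map A.z ≫ g = f ≫ A'.z)
    (hq : g ≫ A'.q = Φ.map A.q ≫ f)
    (isPullback : IsPullback A.π₁ A.π₂ A.q A.q)
    (fibrePower : ∀ n : ℕ, 0 < n → ∃ (P : C) (π : Fin n → (P ⟶ E)), IsFibrePower A.q π)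
    (z_q : A.z ≫ A.q = 𝟙 B) (s_q : A.s ≫ A.q = A.π₁ ≫ A.q) : A.IsAdditive := by
  -- Φ carries sums to sums. It is not assumed to preserve the pullback `A.E₂`; the comparison `g₂`
  -- suffices, since only equations have to be reflected.
  have key : ∀ {Z : C} (x y : Z ⟶ E) (hxy : x ≫ A.q = y ≫ A.q)
      (x' y' : Φ.obj Z ⟶ E') (hxy' : x' ≫ A'.q = y' ≫ A'.q)
      (_ : Φ.map x ≫ g = x') (_ : Φ.map y ≫ g = y'),
      Φ.map (isPullback.lift x y hxy ≫ A.s) ≫ g = hA'.isPullback.lift x' y' hxy' ≫ A'.s := by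
    intro Z x y hxy x' y' hxy' hx hy
    rw [Φ.map_comp, Category.assoc, hs, ← Category.assoc]
    congr 1
    apply hA'.isPullback.hom_ext
    · rw [hA'.isPullback.lift_fst, Category.assoc, h₁, ← Φ.map_comp_assoc,
        isPullback.lift_fst, hx]
    · rw [hA'.isPullback.lift_snd, Category.assoc, h₂, ← Φ.map_comp_assoc,
        isPullback.lift_snd, hy]
  have key' : ∀ {Z : C} {x y : Z ⟶ E}, x ≫ A.q = y ≫ A.q →
      (Φ.map x ≫ g) ≫ A'.q = (Φ.map y ≫ g) ≫ A'.q := by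
    intro Z x y hxy
    rw [Category.assoc, Category.assoc, hq, ← Φ.map_comp_assoc, hxy, Φ.map_comp_assoc]
  have inj : ∀ {Z : C} {x y : Z ⟶ E}, Φ.map x ≫ g = Φ.map y ≫ g → x = y := fun h =>
    Φ.map_injective ((cancel_mono g).1 h)
  refine ⟨isPullback, fibrePower, z_q, s_q, fun a b c hab hbc => inj ?_, inj ?_, inj ?_⟩
  · rw [key _ _ _ _ _ _ (key _ _ hab _ _ (key' hab) rfl rfl) rfl,
      key _ _ _ _ _ _ rfl (key _ _ hbc _ _ (key' hbc) rfl rfl)]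
    exact hA'.assoc _ _ _ _ _
  · have e : Φ.map (A.q ≫ A.z) ≫ g = g ≫ A'.q ≫ A'.z := by
      rw [Φ.map_comp, Category.assoc, hz, reassoc_of% hq]
    have e' : Φ.map (𝟙 E) ≫ g = g := by simp
    rw [key _ _ _ _ _ (by simp [hA'.z_q]) e e', e']
    refine (lift_precomp hA'.isPullback _ g (A'.q ≫ A'.z) (𝟙 _) (by simp [hA'.z_q]) _ _ _ rfl
      (Category.comp_id g).symm).trans ?_
    rw [hA'.zero_add, Category.comp_id]
  · rw [key _ _ _ _ _ (by rw [Category.assoc, Category.assoc, hA'.isPullback.w]) h₂.symm h₁.symm,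
      hs]
    exact (lift_precomp hA'.isPullback _ g₂ _ _ hA'.isPullback.w.symm _ _ _ rfl rfl).trans
      (congrArg (g₂ ≫ ·) hA'.comm)

end FibrePowers

/-! ## Isomorphisms of categories -/

section IsoOfCategories

variable {C : Type u₁} [Category.{v₁} C] {D : Type u₂} [Category.{v₂} D]

lemma exists_inverse_of_bijective (Φ : C ⥤ D) [Φ.Full] [Φ.Faithful]
    (h : Function.Bijective Φ.obj) : ∃ Ψ : D ⥤ C, Φ ⋙ Ψ = 𝟭 _ ∧ Ψ ⋙ Φ = 𝟭 _ := by
  let o : D → C := (Equiv.ofBijective _ h).symm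
  have ho : ∀ d, Φ.obj (o d) = d := fun d => (Equiv.ofBijective _ h).apply_symm_apply d
  have ho' : ∀ c, o (Φ.obj c) = c := fun c => (Equiv.ofBijective _ h).symm_apply_apply c
  let Ψ : D ⥤ C :=
    { obj := o
      -- The inverse on objects satisfies `Φ.obj (o d) = d` only as a propositional equality, so f
      -- is conjugated by transports before its preimage is taken.
      map := fun {d d'} f => Φ.preimage (eqToHom (ho d) ≫ f ≫ eqToHom (ho d').symm)
      map_id := fun d => Φ.map_injective (by simp)
      map_comp := fun f g => Φ.map_injective (by simp) }
  refine ⟨Ψ, CategoryTheory.Functor.ext ho' fun c c' f => Φ.map_injective ?_,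
    CategoryTheory.Functor.ext ho fun d d' f => ?_⟩
  · simp [Ψ, eqToHom_map]
  · simp [Ψ]

end IsoOfCategories

/-! ## Whiskering of squares in a bicategory -/

section Squares

variable {K : Type u} [Bicategory.{w, v} K]

/-- A 1-morphism `A'` over `A` along `U`, placed between `F` and a 1-morphism `I'` over `I`. -/
def shiftLaw {Y V X : K} {U : V ⟶ X} {A' I' : V ⟶ V} {A I : X ⟶ X} (F : Y ⟶ V)
    (e : A' ≫ U ≅ U ≫ A) (d : I' ≫ U ≅ U ≫ I) :
    ((F ≫ A') ≫ I') ≫ U ≅ ((F ≫ U) ≫ A) ≫ I :=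
  α_ _ _ _ ≪≫ whiskerLeftIso _ d ≪≫ (α_ _ _ _).symm ≪≫
    whiskerRightIso (α_ _ _ _ ≪≫ whiskerLeftIso F e ≪≫ (α_ _ _ _).symm) I

lemma shiftLaw_naturality {Y V X : K} {U : V ⟶ X} {A' B' I' : V ⟶ V} {A B I : X ⟶ X} (F : Y ⟶ V)
    {a : A' ≫ U ≅ U ≫ A} {b : B' ≫ U ≅ U ≫ B} (d : I' ≫ U ≅ U ≫ I) {x' : A' ⟶ B'} {x : A ⟶ B}
    (h : x' ▷ U ≫ b.hom = a.hom ≫ U ◁ x) :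
    ((F ◁ x') ▷ I') ▷ U ≫ (shiftLaw F b d).hom =
      (shiftLaw F a d).hom ≫ ((F ≫ U) ◁ x) ▷ I := by
  calc
    _ = 𝟙 _ ⊗≫ ((F ◁ x') ▷ (I' ≫ U) ≫ (F ≫ B') ◁ d.hom) ⊗≫ F ◁ b.hom ▷ I ⊗≫ 𝟙 _ := by
      simp only [shiftLaw, Iso.trans_hom, Iso.symm_hom, whiskerLeftIso_hom, whiskerRightIso_hom]
      bicategory
    _ = 𝟙 _ ⊗≫ (F ≫ A') ◁ d.hom ⊗≫ F ◁ (x' ▷ U ≫ b.hom) ▷ I ⊗≫ 𝟙 _ := by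
      rw [← whisker_exchange]; bicategory
    _ = _ := by
      rw [h]
      simp only [shiftLaw, Iso.trans_hom, Iso.symm_hom, whiskerLeftIso_hom, whiskerRightIso_hom]
      bicategory

/-- If `T'` lies over `T` along `U`, so do its iterates. -/
def iterLaw {V X : K} {U : V ⟶ X} {T' : V ⟶ V} {T : X ⟶ X} (e : T' ≫ U ≅ U ≫ T) :
    ∀ m : ℕ, iter T' m ≫ U ≅ U ≫ iter T m
  | 0 => λ_ U ≪≫ (ρ_ U).symm
  | m + 1 => α_ _ _ _ ≪≫ whiskerLeftIso _ e ≪≫ (α_ _ _ _).symm ≪≫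
      whiskerRightIso (iterLaw e m) T ≪≫ α_ _ _ _

/-- Whiskering by identities. -/
def shiftIdIso (X : K) (T : X ⟶ X) : 𝟭 (X ⟶ X) ≅ shift T (𝟙 X) 0 :=
  NatIso.ofComponents (fun A => (λ_ A).symm ≪≫ (ρ_ _).symm)
    (fun {A B} f => by
      change f ≫ (λ_ B).inv ≫ (ρ_ (𝟙 X ≫ B)).inv =
        ((λ_ A).inv ≫ (ρ_ (𝟙 X ≫ A)).inv) ≫ (𝟙 X ◁ f) ▷ 𝟙 X
      simp)

/-- Precomposition with `F` is the zeroth shift. -/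
def precompIsoShift {Y X : K} (T : X ⟶ X) (F : Y ⟶ X) : precomp X F ≅ shift T F 0 :=
  NatIso.ofComponents (fun A => (ρ_ (F ≫ A)).symm) (fun {A B} f => by
    change F ◁ f ≫ (ρ_ (F ≫ B)).inv = (ρ_ (F ≫ A)).inv ≫ (F ◁ f) ▷ 𝟙 X
    simp)

end Squares

/-! ## The universal property of the monad of vector fields -/

section Components

variable {𝔸 𝔹 : MndCat.{v₁, u₁}}

lemma cell_ext {f g : 𝔸 ⟶ 𝔹} {a b : f ⟶ g}
    (h : ∀ M, (MonadMorTwoCell.τ a).app M = (MonadMorTwoCell.τ b).app M) : a = b :=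
  MonadMor.hom_ext_app h

lemma cell_congr {f g : 𝔸 ⟶ 𝔹} {a b : f ⟶ g} (h : a = b) (M : 𝔸.C) :
    (MonadMorTwoCell.τ a).app M = (MonadMorTwoCell.τ b).app M := by
  rw [h]

end Components

section Lifting

variable {𝕏 : Tangentad MndCat.{v₁, max u₁ v₁}} {Y : MndCat.{v₁, max u₁ v₁}}

/-- The value of `F : Y ⟶ VF` at an object, as a vector field. -/
def vfAt (F : Y ⟶ vfBase 𝕏) (M : Y.C) : VectorField (tanProj 𝕏) := (MonadMor.F F).obj M

/-- The vector field `u_F` of `K(Y, X)` induced by `F : Y ⟶ VF`. -/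
def vfCell (F : Y ⟶ vfBase 𝕏) : F ≫ vfForget 𝕏 ⟶ (F ≫ vfForget 𝕏) ≫ 𝕏.str.T :=
  F ◁ vfUniv 𝕏 ≫ (α_ F (vfForget 𝕏) 𝕏.str.T).inv

lemma vfCell_app (F : Y ⟶ vfBase 𝕏) (M : Y.C) :
    (MonadMorTwoCell.τ (vfCell F)).app M = (vfAt F M).v :=
  Category.comp_id _

lemma vfCell_naturality {F G : Y ⟶ vfBase 𝕏} (r : F ⟶ G) :
    vfCell F ≫ (r ▷ vfForget 𝕏) ▷ 𝕏.str.T = r ▷ vfForget 𝕏 ≫ vfCell G :=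
  aux_map (vfUniv 𝕏) r

/-- `θ` is a morphism between the vector fields induced by `F` and `G`. -/
def IsVFCell {F G : Y ⟶ vfBase 𝕏} (θ : F ≫ vfForget 𝕏 ⟶ G ≫ vfForget 𝕏) : Prop :=
  vfCell F ≫ θ ▷ 𝕏.str.T = θ ≫ vfCell G

/-- The associators hidden in `vfCell` have identity components, so the equation between 2-morphisms
says componentwise that θ is a morphism of vector fields. -/
lemma isVFCell_iff {F G : Y ⟶ vfBase 𝕏} (θ : F ≫ vfForget 𝕏 ⟶ G ≫ vfForget 𝕏) :
    IsVFCell θ ↔ ∀ M, (vfAt F M).v ≫ (tanF 𝕏).map ((MonadMorTwoCell.τ θ).app M) =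
      (MonadMorTwoCell.τ θ).app M ≫ (vfAt G M).v := by
  have e : ∀ M, (MonadMorTwoCell.τ (vfCell F ≫ θ ▷ 𝕏.str.T)).app M =
      (vfAt F M).v ≫ (tanF 𝕏).map ((MonadMorTwoCell.τ θ).app M) := fun M =>
    congrArg (· ≫ (tanF 𝕏).map ((MonadMorTwoCell.τ θ).app M)) (vfCell_app F M)
  have e' : ∀ M, (MonadMorTwoCell.τ (θ ≫ vfCell G)).app M =
      (MonadMorTwoCell.τ θ).app M ≫ (vfAt G M).v := fun M =>
    congrArg ((MonadMorTwoCell.τ θ).app M ≫ ·) (vfCell_app G M)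
  exact ⟨fun h M => (e M).symm.trans ((cell_congr h M).trans (e' M)),
    fun h => cell_ext fun M => (e M).trans ((h M).trans (e' M).symm)⟩

/-- A morphism of induced vector fields lifts to a 2-morphism. -/
def liftCell {F G : Y ⟶ vfBase 𝕏} (θ : F ≫ vfForget 𝕏 ⟶ G ≫ vfForget 𝕏) (h : IsVFCell θ) :
    F ⟶ G :=
  MonadMorTwoCell.mk
    { app := fun M => VectorField.Hom.mk (V := vfAt F M) (W := vfAt G M)
        ((MonadMorTwoCell.τ θ).app M) ((isVFCell_iff θ).1 h M)
      naturality := fun _ _ f => VectorField.hom_ext ((MonadMorTwoCell.τ θ).naturality f) }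
    -- The forgetful 1-morphism has an identity distributive law, so up to composition with
    -- identities this is the compatibility of θ with the monads.
    (fun M => VectorField.hom_ext (by
      have e := MonadMorTwoCell.comm θ M
      have e₁ := Category.id_comp (VectorField.Hom.f ((MonadMor.φ G).app M))
      have e₂ := Category.id_comp (VectorField.Hom.f ((MonadMor.φ F).app M))
      exact (congrArg (_ ≫ ·) e₁.symm).trans (e.trans (congrArg (· ≫ _) e₂))))

lemma liftCell_whiskerRight {F G : Y ⟶ vfBase 𝕏} (θ : F ≫ vfForget 𝕏 ⟶ G ≫ vfForget 𝕏)
    (h : IsVFCell θ) : liftCell θ h ▷ vfForget 𝕏 = θ :=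
  cell_ext fun _ => rfl

lemma whiskerRight_vfForget_injective {F G : Y ⟶ vfBase 𝕏} {a b : F ⟶ G}
    (h : a ▷ vfForget 𝕏 = b ▷ vfForget 𝕏) : a = b :=
  cell_ext fun M => VectorField.hom_ext (cell_congr h M)

instance : (postcomp Y (vfForget 𝕏)).Faithful where
  map_injective h := whiskerRight_vfForget_injective h

/-- A family of morphisms that is jointly monic. -/
def JointlyMono {C : Type u₁} [Category.{v₁} C] {ι : Type} {P : C} {E : ι → C}
    (r : ∀ i, P ⟶ E i) : Prop :=
  ∀ ⦃A : C⦄ (a b : A ⟶ P), (∀ i, a ≫ r i = b ≫ r i) → a = b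

lemma JointlyMono.of_comp {C : Type u₁} [Category.{v₁} C] {ι : Type} {P P' : C} {E E' : ι → C}
    {r : ∀ i, P ⟶ E i} {r' : ∀ i, P' ⟶ E' i} (h : JointlyMono r') (j : P ⟶ P') [Mono j]
    (k : ∀ i, E i ⟶ E' i) (hk : ∀ i, r i ≫ k i = j ≫ r' i) : JointlyMono r := fun A a b hab => by
  rw [← cancel_mono j]
  refine h _ _ fun i => ?_
  rw [Category.assoc, Category.assoc, ← hk, reassoc_of% (hab i)]

/-- The 2-morphisms `r i` and `a i` already live over `vfBase`, so they commute with the vector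
fields. Hence the two sides of the required equation agree after the image under T of each
projection. This is the step that makes the forgetful 1-morphism create limits. -/
lemma isVFCell_of_jointlyMono {ι : Type} {A P : Y ⟶ vfBase 𝕏} {E : ι → (Y ⟶ vfBase 𝕏)}
    {r : ∀ i, P ⟶ E i} (hr : JointlyMono fun i => (r i ▷ vfForget 𝕏) ▷ 𝕏.str.T)
    {θ : A ≫ vfForget 𝕏 ⟶ P ≫ vfForget 𝕏} (a : ∀ i, A ⟶ E i)
    (h : ∀ i, θ ≫ r i ▷ vfForget 𝕏 = a i ▷ vfForget 𝕏) : IsVFCell θ := by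
  refine hr _ _ fun i => ?_
  rw [Category.assoc, Category.assoc, vfCell_naturality, reassoc_of% (h i),
    ← comp_whiskerRight, h, vfCell_naturality]

/-- Fibre powers are created by the forgetful 1-morphism. -/
lemma isFibrePower_of_forget {n : ℕ} {P E B : Y ⟶ vfBase 𝕏} {q : E ⟶ B} {π : Fin n → (P ⟶ E)}
    (h : IsFibrePower (q ▷ vfForget 𝕏) (fun i => π i ▷ vfForget 𝕏))
    (hT : JointlyMono fun i => (π i ▷ vfForget 𝕏) ▷ 𝕏.str.T) : IsFibrePower q π := by
  refine ⟨fun i j => whiskerRight_vfForget_injective ?_, fun a ha => ?_⟩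
  · simpa using h.1 i j
  · obtain ⟨m, hm, hu⟩ := h.2 (fun i => a i ▷ vfForget 𝕏) fun i j => by
      rw [← comp_whiskerRight, ha i j, comp_whiskerRight]
    refine ⟨liftCell m (isVFCell_of_jointlyMono hT a hm), fun i =>
      whiskerRight_vfForget_injective ?_, fun k hk => whiskerRight_vfForget_injective ?_⟩
    · rw [comp_whiskerRight, liftCell_whiskerRight, hm]
    · rw [liftCell_whiskerRight]
      exact hu _ fun i => by rw [← hk i, comp_whiskerRight]

/-- Pullbacks are created by the forgetful 1-morphism. -/
lemma isPullback_of_forget {P E₁ E₂ B : Y ⟶ vfBase 𝕏} {π₁ : P ⟶ E₁} {π₂ : P ⟶ E₂} {q₁ : E₁ ⟶ B}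
    {q₂ : E₂ ⟶ B} (h : IsPullback (π₁ ▷ vfForget 𝕏) (π₂ ▷ vfForget 𝕏) (q₁ ▷ vfForget 𝕏)
      (q₂ ▷ vfForget 𝕏))
    (hT : ∀ ⦃A : Y ⟶ 𝕏.base⦄ (a b : A ⟶ (P ≫ vfForget 𝕏) ≫ 𝕏.str.T),
      a ≫ (π₁ ▷ vfForget 𝕏) ▷ 𝕏.str.T = b ≫ (π₁ ▷ vfForget 𝕏) ▷ 𝕏.str.T →
      a ≫ (π₂ ▷ vfForget 𝕏) ▷ 𝕏.str.T = b ≫ (π₂ ▷ vfForget 𝕏) ▷ 𝕏.str.T → a = b) :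
    IsPullback π₁ π₂ q₁ q₂ := by
  have w : π₁ ≫ q₁ = π₂ ≫ q₂ := whiskerRight_vfForget_injective (by simpa using h.w)
  have key : ∀ s : Limits.PullbackCone q₁ q₂, ∃ m : s.pt ⟶ P, m ≫ π₁ = s.fst ∧ m ≫ π₂ = s.snd := by
    intro s
    have hw : s.fst ▷ vfForget 𝕏 ≫ q₁ ▷ vfForget 𝕏 = s.snd ▷ vfForget 𝕏 ≫ q₂ ▷ vfForget 𝕏 := by
      rw [← comp_whiskerRight, s.condition, comp_whiskerRight]
    have h₁ : h.lift _ _ hw ≫ π₁ ▷ vfForget 𝕏 = s.fst ▷ vfForget 𝕏 := h.lift_fst _ _ _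
    have h₂ : h.lift _ _ hw ≫ π₂ ▷ vfForget 𝕏 = s.snd ▷ vfForget 𝕏 := h.lift_snd _ _ _
    have hl : IsVFCell (h.lift _ _ hw) := by
      refine hT _ _ ?_ ?_
      · rw [Category.assoc, Category.assoc, vfCell_naturality, reassoc_of% h₁,
          ← comp_whiskerRight, h₁, vfCell_naturality]
      · rw [Category.assoc, Category.assoc, vfCell_naturality, reassoc_of% h₂,
          ← comp_whiskerRight, h₂, vfCell_naturality]
    refine ⟨liftCell _ hl, whiskerRight_vfForget_injective ?_,
      whiskerRight_vfForget_injective ?_⟩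
    · rw [comp_whiskerRight, liftCell_whiskerRight, h₁]
    · rw [comp_whiskerRight, liftCell_whiskerRight, h₂]
  refine ⟨⟨w⟩, ⟨Limits.PullbackCone.IsLimit.mk _ (fun s => (key s).choose)
    (fun s => (key s).choose_spec.1) (fun s => (key s).choose_spec.2) ?_⟩⟩
  intro s m h₁ h₂
  apply whiskerRight_vfForget_injective
  apply h.hom_ext
  · rw [← comp_whiskerRight, ← comp_whiskerRight, h₁, (key s).choose_spec.1]
  · rw [← comp_whiskerRight, ← comp_whiskerRight, h₂, (key s).choose_spec.2]

end Lifting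

/-! ## Endomorphisms of vector fields -/

section Endomorphisms

/-- An endomorphism `A` of the base with an action on vector fields: it lifts to the endomorphism
`(M, v) ↦ (A M, w_{(M, v)})` of the monad of vector fields. -/
structure VFEndo (𝕏 : Tangentad MndCat.{v₁, max u₁ v₁}) where
  /-- the endomorphism of the base -/
  A : 𝕏.base ⟶ 𝕏.base
  /-- the action on vector fields -/
  w : ∀ V : VectorField (tanProj 𝕏),
    (MonadMor.F A).obj V.M ⟶ (tanF 𝕏).obj ((MonadMor.F A).obj V.M)
  sec : ∀ V : VectorField (tanProj 𝕏), w V ≫ (tanProj 𝕏).app ((MonadMor.F A).obj V.M) = 𝟙 _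
  natural : ∀ {V W : VectorField (tanProj 𝕏)} (a : V ⟶ W),
    w V ≫ (tanF 𝕏).map ((MonadMor.F A).map (VectorField.Hom.f a)) =
      (MonadMor.F A).map (VectorField.Hom.f a) ≫ w W
  comm : ∀ V : VectorField (tanProj 𝕏),
    (𝕏.base.S.map (w V) ≫ (tanLaw 𝕏).app ((MonadMor.F A).obj V.M)) ≫
        (tanF 𝕏).map ((MonadMor.φ A).app V.M) =
      (MonadMor.φ A).app V.M ≫ w ((vfFunctor 𝕏).obj V)

variable {𝕏 : Tangentad MndCat.{v₁, max u₁ v₁}}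

namespace VFEndo

/-- The lifted endomorphism `(M, v) ↦ (A M, w_{(M, v)})`. -/
def toMor (A : VFEndo 𝕏) : vfBase 𝕏 ⟶ vfBase 𝕏 :=
  MonadMor.mk
    { obj := fun (V : VectorField (tanProj 𝕏)) =>
        VectorField.mk ((MonadMor.F A.A).obj V.M) (A.w V) (A.sec V)
      map := fun {V W : VectorField (tanProj 𝕏)} (a : V ⟶ W) =>
        VectorField.Hom.mk ((MonadMor.F A.A).map a.f) (A.natural a)
      map_id := fun (V : VectorField (tanProj 𝕏)) =>
        VectorField.hom_ext ((MonadMor.F A.A).map_id V.M)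
      map_comp := fun a b =>
        VectorField.hom_ext ((MonadMor.F A.A).map_comp (VectorField.Hom.f a) (VectorField.Hom.f b)) }
    { app := fun (V : VectorField (tanProj 𝕏)) =>
        VectorField.Hom.mk ((MonadMor.φ A.A).app V.M) (A.comm V)
      naturality := fun _ _ a =>
        VectorField.hom_ext ((MonadMor.φ A.A).naturality (VectorField.Hom.f a)) }
    (fun V => VectorField.hom_ext (MonadMor.unit A.A (VectorField.M V)))
    (fun V => VectorField.hom_ext (MonadMor.mult A.A (VectorField.M V)))

variable (𝕏) in
/-- The identity. -/
def one : VFEndo 𝕏 where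
  A := 𝟙 𝕏.base
  w V := V.v
  sec V := V.sec
  natural a := VectorField.Hom.comm a
  comm V := VectorField.Hom.comm ((MonadMor.φ (𝟙 (vfBase 𝕏))).app V)

variable (𝕏) in
/-- The tangent bundle functor. -/
def tan : VFEndo 𝕏 where
  A := 𝕏.str.T
  w V := (tanF 𝕏).map V.v ≫ (tanFlip 𝕏).app V.M
  sec V := VectorField.sec ((MonadMor.F (vfT 𝕏)).obj V)
  natural a := VectorField.Hom.comm ((MonadMor.F (vfT 𝕏)).map a)
  comm V := VectorField.Hom.comm ((MonadMor.φ (vfT 𝕏)).app V)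

/-- The composite. -/
def comp (A B : VFEndo 𝕏) : VFEndo 𝕏 where
  A := A.A ≫ B.A
  w V := B.w ((MonadMor.F A.toMor).obj V)
  sec V := B.sec ((MonadMor.F A.toMor).obj V)
  natural a := VectorField.Hom.comm ((MonadMor.F (A.toMor ≫ B.toMor)).map a)
  comm V := VectorField.Hom.comm ((MonadMor.φ (A.toMor ≫ B.toMor)).app V)

/-- The lifted endomorphism lies over the given one. -/
def forgetIso (A : VFEndo 𝕏) : A.toMor ≫ vfForget 𝕏 ≅ vfForget 𝕏 ≫ A.A :=
  MonadMor.isoOf (f := A.toMor ≫ vfForget 𝕏) (g := vfForget 𝕏 ≫ A.A) (Iso.refl _) (fun V => by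
    change 𝕏.base.S.map (𝟙 _) ≫ (MonadMor.φ A.A).app (VectorField.M V) ≫
        (MonadMor.F A.A).map (𝟙 _) =
      (𝟙 _ ≫ (MonadMor.φ A.A).app (VectorField.M V)) ≫ 𝟙 _
    simp only [CategoryTheory.Functor.map_id, Category.comp_id, Category.id_comp]
    exact Category.comp_id _)

/-- A 2-morphism of the base, whiskered with the forgetful 1-morphism. -/
def cell {A B : VFEndo 𝕏} (x : A.A ⟶ B.A) : A.toMor ≫ vfForget 𝕏 ⟶ B.toMor ≫ vfForget 𝕏 :=
  MonadMorTwoCell.mk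
    { app := fun V => (MonadMorTwoCell.τ x).app (VectorField.M V)
      naturality := fun _ _ a => (MonadMorTwoCell.τ x).naturality (VectorField.Hom.f a) }
    (fun V => by
      have e := MonadMorTwoCell.comm x (VectorField.M V)
      change 𝕏.base.S.map _ ≫ 𝟙 _ ≫ (MonadMor.φ B.A).app (VectorField.M V) =
        (𝟙 _ ≫ (MonadMor.φ A.A).app (VectorField.M V)) ≫ _
      rw [Category.id_comp, Category.id_comp]
      exact e)

/-- A 2-morphism of the base that is compatible with the actions on vector fields lifts. -/
def lift {A B : VFEndo 𝕏} (x : A.A ⟶ B.A) (h : IsVFCell (cell x)) : A.toMor ⟶ B.toMor :=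
  liftCell (cell x) h

lemma isVFCell_cell_iff {A B : VFEndo 𝕏} (x : A.A ⟶ B.A) :
    IsVFCell (cell x) ↔ ∀ V : VectorField (tanProj 𝕏),
      A.w V ≫ (tanF 𝕏).map ((MonadMorTwoCell.τ x).app V.M) =
        (MonadMorTwoCell.τ x).app V.M ≫ B.w V :=
  isVFCell_iff _

lemma forgetIso_naturality {A B : VFEndo 𝕏} (x : A.A ⟶ B.A) (h : IsVFCell (cell x)) :
    lift x h ▷ vfForget 𝕏 ≫ B.forgetIso.hom = A.forgetIso.hom ≫ vfForget 𝕏 ◁ x :=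
  cell_ext fun V => (Category.comp_id _).trans
    (Category.id_comp ((MonadMorTwoCell.τ x).app (VectorField.M V))).symm

end VFEndo

end Endomorphisms

/-! ## Pointwise fibre powers -/

section PointwisePowers

variable {K : Type u} [Bicategory.{w, v} K]

/-- `π` exhibits `P` as a pointwise `n`-fold pullback of `q` along itself that is preserved by the
iterates of `T`. -/
def IsPointwisePower {X : K} {T : X ⟶ X} (q : T ⟶ 𝟙 X) {n : ℕ} {P : X ⟶ X}
    (π : Fin n → (P ⟶ T)) : Prop :=
  ∀ {Y : K} (F : Y ⟶ X) (m : ℕ),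
    IsFibrePower ((shift T F m).map q) (fun i => (shift T F m).map (π i))

lemma IsFibrePower.jointlyMono {C : Type u₁} [Category.{v₁} C] {E B P : C} {q : E ⟶ B} {n : ℕ}
    {π : Fin n → (P ⟶ E)} (h : IsFibrePower q π) : JointlyMono π :=
  fun _ _ _ hab => h.hom_ext hab

namespace IsPointwisePower

variable {X : K} {T : X ⟶ X} {q : T ⟶ 𝟙 X} {n : ℕ} {P : X ⟶ X} {π : Fin n → (P ⟶ T)}

lemma isFibrePower (h : IsPointwisePower q π) : IsFibrePower q π :=
  IsFibrePower.of_natIso (Ψ := 𝟭 (X ⟶ X)) (h (𝟙 X) 0) (shiftIdIso X T)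

lemma isFibrePower_precomp (h : IsPointwisePower q π) {Y : K} (F : Y ⟶ X) :
    IsFibrePower (F ◁ q) (fun i => F ◁ π i) :=
  IsFibrePower.of_natIso (Ψ := precomp X F) (h F 0) (precompIsoShift T F)

lemma isFibrePower_precomp_postcomp (h : IsPointwisePower q π) {Y : K} (F : Y ⟶ X) :
    IsFibrePower ((F ◁ q) ▷ T) (fun i => (F ◁ π i) ▷ T) :=
  -- The first iterate is `𝟙 X ≫ T` and not T itself; the left unitors remove the identity.
  (h F 1).of_iso (whiskerLeftIso _ (λ_ T).symm) (whiskerLeftIso _ (λ_ T).symm)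
    (whiskerLeftIso _ (λ_ T).symm) (fun i => (whisker_exchange (F ◁ π i) (λ_ T).inv).symm)
    (whisker_exchange (F ◁ q) (λ_ T).inv).symm

variable {V : K} {U : V ⟶ X} {T' P' : V ⟶ V} {q' : T' ⟶ 𝟙 V} {π' : Fin n → (P' ⟶ T')}

/-- Since T' lies over T along U, applying an iterate of T' and then U is isomorphic to applying U
and then the same iterate of T. The diagram is thus the one for `F ≫ U` up to isomorphism. -/
lemma isFibrePower_forget (h : IsPointwisePower q π) (e : T' ≫ U ≅ U ≫ T) (f : P' ≫ U ≅ U ≫ P)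
    (hq : q' ▷ U ≫ (λ_ U ≪≫ (ρ_ U).symm).hom = e.hom ≫ U ◁ q)
    (hπ : ∀ i, π' i ▷ U ≫ e.hom = f.hom ≫ U ◁ π i) {Y : K} (F : Y ⟶ V) (m : ℕ) :
    IsFibrePower ((shift T' F m).map q' ▷ U) (fun i => (shift T' F m).map (π' i) ▷ U) :=
  (h (F ≫ U) m).of_iso (shiftLaw F f (iterLaw e m)) (shiftLaw F e (iterLaw e m))
    (shiftLaw F (λ_ U ≪≫ (ρ_ U).symm) (iterLaw e m))
    (fun i => shiftLaw_naturality F (iterLaw e m) (hπ i))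
    (shiftLaw_naturality F (iterLaw e m) hq)

/-- One further application of T turns the m-th iterate into the (m + 1)-st, where the fibre power
is again preserved. This is where preservation by all iterates is needed. -/
lemma jointlyMono_forget (h : IsPointwisePower q π) (e : T' ≫ U ≅ U ≫ T) (f : P' ≫ U ≅ U ≫ P)
    (hπ : ∀ i, π' i ▷ U ≫ e.hom = f.hom ≫ U ◁ π i) {Y : K} (F : Y ⟶ V) (m : ℕ) :
    JointlyMono fun i => ((shift T' F m).map (π' i) ▷ U) ▷ T := by
  let j : ((shift T' F m).obj P' ≫ U) ≫ T ≅ (shift T (F ≫ U) (m + 1)).obj P :=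
    whiskerRightIso (shiftLaw F f (iterLaw e m)) T ≪≫ α_ _ _ _
  refine (h (F ≫ U) (m + 1)).jointlyMono.of_comp j.hom
    (fun i => (shiftLaw F e (iterLaw e m)).hom ▷ T ≫ (α_ _ _ _).hom) fun i => ?_
  have k := congrArg (fun a => a ▷ T ≫ (α_ _ _ T).hom)
    (shiftLaw_naturality F (iterLaw e m) (hπ i))
  simp only [comp_whiskerRight, Category.assoc] at k
  refine k.trans (Eq.trans ?_ (Category.assoc _ _ _).symm)
  exact congrArg (_ ≫ ·) (associator_naturality_left _ _ _)

end IsPointwisePower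

end PointwisePowers

/-! ## Fibre powers of the tangent bundle functor of vector fields -/

section Powers

variable {𝕏 : Tangentad MndCat.{v₁, max u₁ v₁}}

lemma tanFlip_map_proj (M : 𝕏.base.C) :
    (tanFlip 𝕏).app M ≫ (tanF 𝕏).map ((tanProj 𝕏).app M) =
      (tanProj 𝕏).app ((tanF 𝕏).obj M) := by
  have h : (tanFlip 𝕏).app M ≫ (tanFlip 𝕏).app M = 𝟙 _ := cell_congr 𝕏.str.c_c M
  rw [← tanFlip_proj, reassoc_of% h]

lemma comp_map_id {C : Type u₁} [Category.{v₁} C] {D : Type u₂} [Category.{v₂} D] (F : C ⥤ D)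
    {x : D} {y : C} (a : x ⟶ F.obj y) : a ≫ F.map (𝟙 y) = a := by simp

namespace VFEndo

/-- The action of an endomorphism on vector fields, as a 2-morphism. -/
def wCell (A : VFEndo 𝕏) : vfForget 𝕏 ≫ A.A ⟶ (vfForget 𝕏 ≫ A.A) ≫ 𝕏.str.T :=
  A.forgetIso.inv ≫ vfCell A.toMor ≫ A.forgetIso.hom ▷ 𝕏.str.T

lemma wCell_app (A : VFEndo 𝕏) (V : VectorField (tanProj 𝕏)) :
    (MonadMorTwoCell.τ A.wCell).app V = A.w V := by
  have e := vfCell_app A.toMor V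
  change 𝟙 _ ≫ (MonadMorTwoCell.τ (vfCell A.toMor)).app V ≫ (tanF 𝕏).map (𝟙 _) = _
  rw [e, CategoryTheory.Functor.map_id, Category.id_comp]
  exact Category.comp_id _

variable (𝕏) in
/-- The action of the tangent bundle functor on vector fields. -/
def tanCell : vfForget 𝕏 ≫ 𝕏.str.T ⟶ (vfForget 𝕏 ≫ 𝕏.str.T) ≫ 𝕏.str.T := (tan 𝕏).wCell

lemma tanCell_app (V : VectorField (tanProj 𝕏)) : (MonadMorTwoCell.τ (tanCell 𝕏)).app V =
    (tanF 𝕏).map V.v ≫ (tanFlip 𝕏).app V.M :=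
  wCell_app (tan 𝕏) V

/-- The flip exchanges T p with p at T M, after which naturality of p applies. -/
lemma tan_w_comp_map_proj (V : VectorField (tanProj 𝕏)) :
    ((tanF 𝕏).map V.v ≫ (tanFlip 𝕏).app V.M) ≫ (tanF 𝕏).map ((tanProj 𝕏).app V.M) =
      (tanProj 𝕏).app V.M ≫ V.v := by
  rw [Category.assoc, tanFlip_map_proj]
  exact (tanProj 𝕏).naturality V.v

/-- The right-hand side starts with p. Hence precomposing with different projections `π i`, which
agree after p, gives the same result; this is the compatibility required in `exists_powCell`. -/
lemma tanCell_comp_map_proj : tanCell 𝕏 ≫ (vfForget 𝕏 ◁ 𝕏.str.p.q) ▷ 𝕏.str.T =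
    vfForget 𝕏 ◁ 𝕏.str.p.q ≫ (ρ_ (vfForget 𝕏)).hom ≫ vfUniv 𝕏 ≫
      (ρ_ (vfForget 𝕏)).inv ▷ 𝕏.str.T := by
  apply cell_ext
  intro V
  refine (congrArg (· ≫ _) (tanCell_app V)).trans ((tan_w_comp_map_proj V).trans ?_)
  change _ = (tanProj 𝕏).app (VectorField.M V) ≫ 𝟙 _ ≫ VectorField.v V ≫ (tanF 𝕏).map (𝟙 _)
  rw [CategoryTheory.Functor.map_id, Category.comp_id]
  exact congrArg (_ ≫ ·) (Category.id_comp _).symm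

variable {n : ℕ} {P : 𝕏.base ⟶ 𝕏.base} {π : Fin n → (P ⟶ 𝕏.str.T)}

/-- T preserves the n-fold pullback of p, so the vector fields c ∘ Tv on the factors induce a
morphism into its image under T. -/
lemma exists_powCell (h : IsPointwisePower 𝕏.str.p.q π) :
    ∃ k : vfForget 𝕏 ≫ P ⟶ (vfForget 𝕏 ≫ P) ≫ 𝕏.str.T,
      ∀ i, k ≫ (vfForget 𝕏 ◁ π i) ▷ 𝕏.str.T = vfForget 𝕏 ◁ π i ≫ tanCell 𝕏 := by
  obtain ⟨k, hk, -⟩ := (h.isFibrePower_precomp_postcomp (vfForget 𝕏)).2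
    (fun i => vfForget 𝕏 ◁ π i ≫ tanCell 𝕏) fun i j => by
      rw [Category.assoc, Category.assoc, tanCell_comp_map_proj, ← whiskerLeft_comp_assoc,
        ← whiskerLeft_comp_assoc, h.isFibrePower.1 i j]
  exact ⟨k, hk⟩

/-- The projections of the fibre power are jointly monic, and by naturality each of them reduces the
claim to c ∘ Tv being a section. -/
lemma powCell_sec (h : IsPointwisePower 𝕏.str.p.q π)
    {k : vfForget 𝕏 ≫ P ⟶ (vfForget 𝕏 ≫ P) ≫ 𝕏.str.T}
    (hk : ∀ i, k ≫ (vfForget 𝕏 ◁ π i) ▷ 𝕏.str.T = vfForget 𝕏 ◁ π i ≫ tanCell 𝕏) :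
    k ≫ (vfForget 𝕏 ≫ P) ◁ 𝕏.str.p.q ≫ (ρ_ (vfForget 𝕏 ≫ P)).hom = 𝟙 _ := by
  refine (h.isFibrePower_precomp (vfForget 𝕏)).hom_ext fun i => ?_
  have e : tanCell 𝕏 ≫ (vfForget 𝕏 ≫ 𝕏.str.T) ◁ 𝕏.str.p.q ≫ (ρ_ _).hom = 𝟙 _ := by
    apply cell_ext
    intro V
    refine (congrArg (· ≫ _) (tanCell_app V)).trans ?_
    exact (congrArg (_ ≫ ·) (Category.comp_id _)).trans ((tan 𝕏).sec V)
  have e' : ((vfForget 𝕏 ≫ P) ◁ 𝕏.str.p.q ≫ (ρ_ (vfForget 𝕏 ≫ P)).hom) ≫ vfForget 𝕏 ◁ π i =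
      (vfForget 𝕏 ◁ π i) ▷ 𝕏.str.T ≫ (vfForget 𝕏 ≫ 𝕏.str.T) ◁ 𝕏.str.p.q ≫ (ρ_ _).hom := by
    rw [← whisker_exchange_assoc, Category.assoc, rightUnitor_naturality]
  rw [Category.assoc, e', reassoc_of% (hk i), e, Category.comp_id, Category.id_comp]

/-- The `n`-fold pullback of the projection along itself. -/
noncomputable def pow (h : IsPointwisePower 𝕏.str.p.q π) : VFEndo 𝕏 where
  A := P
  w V := (MonadMorTwoCell.τ (exists_powCell h).choose).app V
  sec V := by
    refine Eq.trans ?_ (cell_congr (powCell_sec h (exists_powCell h).choose_spec) V)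
    exact congrArg (_ ≫ ·) (Category.comp_id _).symm
  natural {V W} a := ((MonadMorTwoCell.τ (exists_powCell h).choose).naturality a).symm
  comm V := by
    have e := MonadMorTwoCell.comm (exists_powCell h).choose V
    refine Eq.trans ?_ (e.trans ?_)
    · rw [Category.assoc]
      refine congrArg (_ ≫ ·) ?_
      exact congrArg (fun a => _ ≫ (tanF 𝕏).map a) (comp_map_id (MonadMor.F P) _).symm
    · exact congrArg (· ≫ _) (comp_map_id (MonadMor.F P) _)

lemma isVFCell_pow (h : IsPointwisePower 𝕏.str.p.q π) (i : Fin n) :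
    IsVFCell (cell (A := pow h) (B := tan 𝕏) (π i)) := by
  refine (isVFCell_cell_iff (A := pow h) (B := tan 𝕏) (π i)).2 fun V => ?_
  refine (cell_congr ((exists_powCell h).choose_spec i) V).trans ?_
  exact congrArg ((MonadMorTwoCell.τ (π i)).app V.M ≫ ·) (tanCell_app V)

/-- The projections of the `n`-fold pullback. -/
noncomputable def powProj (h : IsPointwisePower 𝕏.str.p.q π) (i : Fin n) :
    (pow h).toMor ⟶ vfT 𝕏 :=
  lift (A := pow h) (B := tan 𝕏) (π i) (isVFCell_pow h i)

lemma isVFCell_proj : IsVFCell (cell (A := tan 𝕏) (B := one 𝕏) 𝕏.str.p.q) :=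
  (isVFCell_cell_iff (A := tan 𝕏) (B := one 𝕏) 𝕏.str.p.q).2 tan_w_comp_map_proj

variable (𝕏) in
/-- The projection of the tangent bundle functor of vector fields. -/
def proj : vfT 𝕏 ⟶ 𝟙 (vfBase 𝕏) :=
  lift (A := tan 𝕏) (B := one 𝕏) 𝕏.str.p.q isVFCell_proj

lemma proj_naturality : proj 𝕏 ▷ vfForget 𝕏 ≫ (λ_ (vfForget 𝕏) ≪≫ (ρ_ (vfForget 𝕏)).symm).hom =
    (tan 𝕏).forgetIso.hom ≫ vfForget 𝕏 ◁ 𝕏.str.p.q := by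
  apply cell_ext
  intro V
  change (tanProj 𝕏).app (VectorField.M V) ≫ 𝟙 _ ≫ 𝟙 _ =
    𝟙 _ ≫ (tanProj 𝕏).app (VectorField.M V)
  simp only [Category.id_comp]
  exact Category.comp_id _

lemma jointlyMono_powProj (h : IsPointwisePower 𝕏.str.p.q π) {Y : MndCat.{v₁, max u₁ v₁}}
    (F : Y ⟶ vfBase 𝕏) (m : ℕ) :
    JointlyMono fun i => ((shift (vfT 𝕏) F m).map (powProj h i) ▷ vfForget 𝕏) ▷ 𝕏.str.T :=
  h.jointlyMono_forget (tan 𝕏).forgetIso (pow h).forgetIso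
    (fun i => forgetIso_naturality (A := pow h) (B := tan 𝕏) (π i) (isVFCell_pow h i)) F m

lemma isPointwisePower_powProj (h : IsPointwisePower 𝕏.str.p.q π) :
    IsPointwisePower (proj 𝕏) (powProj h) := fun F m =>
  isFibrePower_of_forget
    (h.isFibrePower_forget (tan 𝕏).forgetIso (pow h).forgetIso proj_naturality
      (fun i => forgetIso_naturality (A := pow h) (B := tan 𝕏) (π i) (isVFCell_pow h i)) F m)
    (jointlyMono_powProj h F m)

end VFEndo

end Powers

/-! ## The structure 2-morphisms on vector fields -/

section StructureCells

variable (𝕏 : Tangentad MndCat.{v₁, max u₁ v₁})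

/-- The functor `T₂` of a tangent monad. -/
def tanPair : 𝕏.base.C ⥤ 𝕏.base.C := MonadMor.F 𝕏.str.p.E₂

/-- The projections `T₂ ⟶ T` of a tangent monad. -/
def tanFst : Fin 2 → (𝕏.str.p.E₂ ⟶ 𝕏.str.T) := ![𝕏.str.p.π₁, 𝕏.str.p.π₂]

/-- The projections `T₂ ⟶ T`, as natural transformations. -/
def tanPairProj (i : Fin 2) : tanPair 𝕏 ⟶ tanF 𝕏 := MonadMorTwoCell.τ (tanFst 𝕏 i)

/-- The zero morphism of a tangent monad. -/
def tanZero : 𝟭 _ ⟶ tanF 𝕏 := MonadMorTwoCell.τ 𝕏.str.p.z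

/-- The sum morphism of a tangent monad. -/
def tanSum : tanPair 𝕏 ⟶ tanF 𝕏 := MonadMorTwoCell.τ 𝕏.str.p.s

/-- The vertical lift of a tangent monad. -/
def tanLift : tanF 𝕏 ⟶ tanF 𝕏 ⋙ tanF 𝕏 := MonadMorTwoCell.τ 𝕏.str.l

variable {𝕏}

lemma tanFlip_tanFlip (M : 𝕏.base.C) : (tanFlip 𝕏).app M ≫ (tanFlip 𝕏).app M = 𝟙 _ :=
  cell_congr 𝕏.str.c_c M

lemma tanZero_flip (M : 𝕏.base.C) : (tanZero 𝕏).app ((tanF 𝕏).obj M) ≫ (tanFlip 𝕏).app M =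
    (tanF 𝕏).map ((tanZero 𝕏).app M) := by
  have h : (tanF 𝕏).map ((tanZero 𝕏).app M) ≫ (tanFlip 𝕏).app M =
    (𝟙 _ ≫ 𝟙 _) ≫ (tanZero 𝕏).app ((tanF 𝕏).obj M) := cell_congr 𝕏.str.c_hom.z_comm M
  rw [Category.id_comp] at h
  have h' := h.trans (Category.id_comp _)
  rw [← h', Category.assoc, tanFlip_tanFlip]
  exact Category.comp_id _

lemma tanLift_flip (M : 𝕏.base.C) : (tanLift 𝕏).app ((tanF 𝕏).obj M) ≫
      (tanF 𝕏).map ((tanFlip 𝕏).app M) ≫ (tanFlip 𝕏).app ((tanF 𝕏).obj M) =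
    (tanFlip 𝕏).app M ≫ (tanF 𝕏).map ((tanLift 𝕏).app M) := by
  have h : (tanLift 𝕏).app ((tanF 𝕏).obj M) ≫ 𝟙 _ ≫ (tanF 𝕏).map ((tanFlip 𝕏).app M) ≫ 𝟙 _ ≫
      (tanFlip 𝕏).app ((tanF 𝕏).obj M) =
    (tanFlip 𝕏).app M ≫ (tanF 𝕏).map ((tanLift 𝕏).app M) ≫ 𝟙 _ := cell_congr 𝕏.str.l_c_c M
  rw [Category.comp_id] at h
  refine Eq.trans ?_ h
  rw [Category.id_comp]
  exact congrArg (fun a => _ ≫ _ ≫ a) (Category.id_comp _).symm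

lemma tanFlip_braid (M : 𝕏.base.C) : (tanF 𝕏).map ((tanFlip 𝕏).app M) ≫
      (tanFlip 𝕏).app ((tanF 𝕏).obj M) ≫ (tanF 𝕏).map ((tanFlip 𝕏).app M) =
    (tanFlip 𝕏).app ((tanF 𝕏).obj M) ≫ (tanF 𝕏).map ((tanFlip 𝕏).app M) ≫
      (tanFlip 𝕏).app ((tanF 𝕏).obj M) := by
  have h : (tanF 𝕏).map ((tanFlip 𝕏).app M) ≫ 𝟙 ((tanF 𝕏).obj ((tanF 𝕏).obj ((tanF 𝕏).obj M))) ≫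
        (tanFlip 𝕏).app ((tanF 𝕏).obj M) ≫
        𝟙 ((tanF 𝕏).obj ((tanF 𝕏).obj ((tanF 𝕏).obj M))) ≫ (tanF 𝕏).map ((tanFlip 𝕏).app M) =
      𝟙 ((tanF 𝕏).obj ((tanF 𝕏).obj ((tanF 𝕏).obj M))) ≫ (tanFlip 𝕏).app ((tanF 𝕏).obj M) ≫
        𝟙 ((tanF 𝕏).obj ((tanF 𝕏).obj ((tanF 𝕏).obj M))) ≫ (tanF 𝕏).map ((tanFlip 𝕏).app M) ≫
        𝟙 ((tanF 𝕏).obj ((tanF 𝕏).obj ((tanF 𝕏).obj M))) ≫ (tanFlip 𝕏).app ((tanF 𝕏).obj M) ≫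
        𝟙 ((tanF 𝕏).obj ((tanF 𝕏).obj ((tanF 𝕏).obj M))) :=
    cell_congr 𝕏.str.c_braid M
  have id_comp {x y : 𝕏.base.C} (a : x ⟶ y) := Category.id_comp a
  have comp_id {x y : 𝕏.base.C} (a : x ⟶ y) := Category.comp_id a
  erw [id_comp, id_comp, id_comp, id_comp, id_comp, comp_id] at h
  exact h

variable (𝕏) in
lemma isPointwisePower_two : IsPointwisePower 𝕏.str.p.q (tanFst 𝕏) := fun F m =>
  (isFibrePower_two_iff _ _).2 (𝕏.str.isPullback F m)

/-- The chase behind `isVFCell_sum`: a is the vector field on T₂, b is T₂ v, g the comparison T T₂ ⟶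
T₂ T, d and t are sums, s is T of a sum, e is T v, and c and c' are flips. -/
lemma aux_sum {C : Type u₁} [Category.{v₁} C] {X₂ X₁ Y₂ Y₁ Z₂ Z₁ : C} {a : X₂ ⟶ Y₂}
    {g : Y₂ ⟶ Z₂} {b : X₂ ⟶ Z₂} {s : Y₂ ⟶ Y₁} {c : Y₁ ⟶ Z₁} {t : Z₂ ⟶ Z₁} {d : X₂ ⟶ X₁}
    {e : X₁ ⟶ Z₁} {c' : Z₁ ⟶ Y₁} (h₁ : a ≫ g = b) (h₂ : s ≫ c = g ≫ t) (h₃ : b ≫ t = d ≫ e)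
    (h₄ : c ≫ c' = 𝟙 Y₁) : a ≫ s = d ≫ e ≫ c' := by
  rw [← reassoc_of% h₃, ← h₁, Category.assoc, ← reassoc_of% h₂, h₄, Category.comp_id]

lemma aux_comp_id {C : Type u₁} [Category.{v₁} C] {x y z w : C} (a : x ⟶ y) (b : y ⟶ z)
    (c : z ⟶ w) : (a ≫ 𝟙 _ ≫ b ≫ 𝟙 _) ≫ c = a ≫ b ≫ c := by simp

/-- The same configuration with a projection of T₂ in place of the sum, used to identify the vector
field on T₂ one projection at a time. -/
lemma aux_pair {C : Type u₁} [Category.{v₁} C] {X₂ X₁ Y₂ Y₁ Z₂ Z₁ : C} {a : X₂ ⟶ Y₂}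
    {g : Y₂ ⟶ Z₂} {b : X₂ ⟶ Z₂} {s : Y₂ ⟶ Y₁} {c : Y₁ ⟶ Z₁} {t : Z₂ ⟶ Z₁} {d : X₂ ⟶ X₁}
    {e : X₁ ⟶ Z₁} {c' : Z₁ ⟶ Y₁} (h₁ : a ≫ s = d ≫ e ≫ c') (h₂ : g ≫ t = s ≫ c)
    (h₃ : b ≫ t = d ≫ e) (h₄ : c' ≫ c = 𝟙 Z₁) : a ≫ g ≫ t = b ≫ t := by
  rw [h₂, reassoc_of% h₁, h₄, Category.comp_id, h₃]

namespace VFEndo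

variable (𝕏) in
/-- The 2-fold pullback of the projection of vector fields. -/
noncomputable def two : VFEndo 𝕏 := pow (isPointwisePower_two 𝕏)

variable (𝕏) in
/-- The projections of the 2-fold pullback. -/
noncomputable def twoProj (i : Fin 2) : (two 𝕏).toMor ⟶ vfT 𝕏 := powProj (isPointwisePower_two 𝕏) i

lemma two_w_map (i : Fin 2) (V : VectorField (tanProj 𝕏)) :
    (two 𝕏).w V ≫ (tanF 𝕏).map ((tanPairProj 𝕏 i).app V.M) =
      (tanPairProj 𝕏 i).app V.M ≫ (tanF 𝕏).map V.v ≫ (tanFlip 𝕏).app V.M :=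
  (isVFCell_cell_iff (A := two 𝕏) (B := tan 𝕏) (tanFst 𝕏 i)).1
    (isVFCell_pow (isPointwisePower_two 𝕏) i) V

variable (𝕏) in
-- Naturality of z moves v across z, and c identifies z at T M with T z.
lemma isVFCell_zero : IsVFCell (cell (A := one 𝕏) (B := tan 𝕏) 𝕏.str.p.z) := by
  refine (isVFCell_cell_iff (A := one 𝕏) (B := tan 𝕏) 𝕏.str.p.z).2 fun V => ?_
  have h := (tanZero 𝕏).naturality V.v
  change V.v ≫ (tanF 𝕏).map ((tanZero 𝕏).app V.M) =
    (tanZero 𝕏).app V.M ≫ (tanF 𝕏).map V.v ≫ (tanFlip 𝕏).app V.M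
  rw [← reassoc_of% h, tanZero_flip]

variable (𝕏) in
/-- The zero morphism of vector fields. -/
def zero : 𝟙 (vfBase 𝕏) ⟶ vfT 𝕏 :=
  lift (A := one 𝕏) (B := tan 𝕏) 𝕏.str.p.z (isVFCell_zero 𝕏)

variable (𝕏) in
-- Naturality of l, combined with the axiom relating l to two flips: the vector field on T T M
-- contains exactly these flips.
lemma isVFCell_vlift : IsVFCell (cell (A := tan 𝕏) (B := (tan 𝕏).comp (tan 𝕏)) 𝕏.str.l) := by
  refine (isVFCell_cell_iff (A := tan 𝕏) (B := (tan 𝕏).comp (tan 𝕏)) 𝕏.str.l).2 fun V => ?_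
  have h := (tanLift 𝕏).naturality V.v
  change ((tanF 𝕏).map V.v ≫ (tanFlip 𝕏).app V.M) ≫ (tanF 𝕏).map ((tanLift 𝕏).app V.M) =
    (tanLift 𝕏).app V.M ≫ (tanF 𝕏).map ((tanF 𝕏).map V.v ≫ (tanFlip 𝕏).app V.M) ≫
      (tanFlip 𝕏).app ((tanF 𝕏).obj V.M)
  rw [Category.assoc, ← tanLift_flip, reassoc_of% h, CategoryTheory.Functor.map_comp,
    Category.assoc]

variable (𝕏) in
/-- The vertical lift of vector fields. -/
def vlift : vfT 𝕏 ⟶ vfT 𝕏 ≫ vfT 𝕏 :=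
  lift (A := tan 𝕏) (B := (tan 𝕏).comp (tan 𝕏)) 𝕏.str.l (isVFCell_vlift 𝕏)

variable (𝕏) in
-- Naturality of c, combined with the braid relation for the flips in the vector field on T T M.
lemma isVFCell_flip : IsVFCell (cell (A := (tan 𝕏).comp (tan 𝕏)) (B := (tan 𝕏).comp (tan 𝕏))
    𝕏.str.c) := by
  refine (isVFCell_cell_iff (A := (tan 𝕏).comp (tan 𝕏)) (B := (tan 𝕏).comp (tan 𝕏))
    𝕏.str.c).2 fun V => ?_
  have h := (tanFlip 𝕏).naturality V.v
  change ((tanF 𝕏).map ((tanF 𝕏).map V.v ≫ (tanFlip 𝕏).app V.M) ≫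
      (tanFlip 𝕏).app ((tanF 𝕏).obj V.M)) ≫ (tanF 𝕏).map ((tanFlip 𝕏).app V.M) =
    (tanFlip 𝕏).app V.M ≫ (tanF 𝕏).map ((tanF 𝕏).map V.v ≫ (tanFlip 𝕏).app V.M) ≫
      (tanFlip 𝕏).app ((tanF 𝕏).obj V.M)
  rw [CategoryTheory.Functor.map_comp, Category.assoc, Category.assoc, tanFlip_braid,
    Category.assoc, ← reassoc_of% h]

variable (𝕏) in
/-- The canonical flip of vector fields. -/
def flip : vfT 𝕏 ≫ vfT 𝕏 ⟶ vfT 𝕏 ≫ vfT 𝕏 :=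
  lift (A := (tan 𝕏).comp (tan 𝕏)) (B := (tan 𝕏).comp (tan 𝕏)) 𝕏.str.c (isVFCell_flip 𝕏)

variable (𝕏) in
-- The vector field on T₂ is known only through its projections. The comparison g, which exists
-- because c is additive, turns it into T₂ v; naturality of s and the additivity of c then finish
-- the argument.
lemma isVFCell_sum : IsVFCell (cell (A := two 𝕏) (B := tan 𝕏) 𝕏.str.p.s) := by
  refine (isVFCell_cell_iff (A := two 𝕏) (B := tan 𝕏) 𝕏.str.p.s).2 fun V => ?_
  obtain ⟨g, h₁, h₂, hs⟩ := 𝕏.str.c_hom.s_comm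
  have hg (i : Fin 2) (M : 𝕏.base.C) :
      (MonadMorTwoCell.τ g).app M ≫ (tanPairProj 𝕏 i).app ((tanF 𝕏).obj M) =
        (tanF 𝕏).map ((tanPairProj 𝕏 i).app M) ≫ (tanFlip 𝕏).app M := by
    fin_cases i
    · exact cell_congr h₁ M
    · exact cell_congr h₂ M
  have hs' : (tanF 𝕏).map ((tanSum 𝕏).app V.M) ≫ (tanFlip 𝕏).app V.M =
      (MonadMorTwoCell.τ g).app V.M ≫ (tanSum 𝕏).app ((tanF 𝕏).obj V.M) := cell_congr hs V.M
  let k : vfForget 𝕏 ≫ 𝕏.str.p.E₂ ⟶ (vfForget 𝕏 ≫ 𝕏.str.p.E₂) ≫ 𝕏.str.T := (two 𝕏).wCell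
  -- Followed by g, the vector field on T₂ lands in T₂ T, whose projections are jointly monic. There
  -- it can be compared with T₂ v.
  have hk : k ≫ (α_ _ _ _).hom ≫ vfForget 𝕏 ◁ (show 𝕏.str.p.E₂ ≫ 𝕏.str.T ⟶ _ from g) ≫
      (α_ _ _ _).inv = vfUniv 𝕏 ▷ 𝕏.str.p.E₂ := by
    refine (IsPointwisePower.isFibrePower_precomp (isPointwisePower_two 𝕏)
      (vfForget 𝕏 ≫ 𝕏.str.T)).hom_ext
      fun i => cell_ext fun V => ?_
    have e : (MonadMorTwoCell.τ k).app V = (two 𝕏).w V := wCell_app (two 𝕏) V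
    change ((MonadMorTwoCell.τ k).app V ≫ 𝟙 _ ≫ (MonadMorTwoCell.τ g).app (VectorField.M V) ≫ 𝟙 _) ≫
      (tanPairProj 𝕏 i).app ((tanF 𝕏).obj (VectorField.M V)) =
        (tanPair 𝕏).map (VectorField.v V) ≫
          (tanPairProj 𝕏 i).app ((tanF 𝕏).obj (VectorField.M V))
    refine Eq.trans (b := (two 𝕏).w V ≫ (MonadMorTwoCell.τ g).app (VectorField.M V) ≫
      (tanPairProj 𝕏 i).app ((tanF 𝕏).obj (VectorField.M V))) ?_ ?_
    · rw [e]
      exact aux_comp_id _ _ _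
    · exact aux_pair (two_w_map i V) (hg i (VectorField.M V))
        ((tanPairProj 𝕏 i).naturality (VectorField.v V)) (tanFlip_tanFlip _)
  have hk' : (two 𝕏).w V ≫ (MonadMorTwoCell.τ g).app V.M = (tanPair 𝕏).map V.v := by
    refine Eq.trans ?_ (cell_congr hk V)
    refine Eq.trans ?_ (congrArg (· ≫ _) (wCell_app (two 𝕏) V).symm)
    refine congrArg (_ ≫ ·) (Eq.trans ?_ (Category.id_comp _).symm)
    exact (Category.comp_id _).symm
  exact aux_sum hk' hs' ((tanSum 𝕏).naturality V.v) (tanFlip_tanFlip V.M)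

variable (𝕏) in
/-- The sum morphism of vector fields. -/
noncomputable def sum : (two 𝕏).toMor ⟶ vfT 𝕏 :=
  lift (A := two 𝕏) (B := tan 𝕏) 𝕏.str.p.s (isVFCell_sum 𝕏)

variable (𝕏) in
/-- The additive bundle data of the projection of vector fields. -/
@[simps]
noncomputable def bundle : AddBundleData (vfT 𝕏) (𝟙 (vfBase 𝕏)) where
  E₂ := (two 𝕏).toMor
  π₁ := twoProj 𝕏 0
  π₂ := twoProj 𝕏 1
  q := proj 𝕏
  z := zero 𝕏
  s := sum 𝕏

variable (𝕏) in
lemma isPointwisePower_twoProj : IsPointwisePower (bundle 𝕏).q (twoProj 𝕏) :=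
  isPointwisePower_powProj (isPointwisePower_two 𝕏)

/-- The fibre powers of p are pointwise, hence preserved by precomposition with F. -/
lemma isAdditive_precomp {X Y : MndCat.{v₁, u₁}} (S : TangentStructure X) (F : Y ⟶ X) :
    (S.p.map (precomp X F)).IsAdditive := by
  refine S.isAdditive.map (precomp X F) ?_ fun n hn => ?_
  · have h : IsPointwisePower S.p.q ![S.p.π₁, S.p.π₂] := fun F m =>
      (isFibrePower_two_iff _ _).2 (S.isPullback F m)
    exact (isFibrePower_two_iff _ _).1 (IsPointwisePower.isFibrePower_precomp h F)
  · obtain ⟨P, π, h⟩ := S.fibrePower n hn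
    have h' : IsPointwisePower S.p.q π := h
    exact ⟨P, π, IsPointwisePower.isFibrePower h', IsPointwisePower.isFibrePower_precomp h' F⟩

variable (𝕏) in
-- Postcomposition with the forgetful 1-morphism is faithful and carries this bundle to the bundle p
-- whiskered with that 1-morphism. The laws of the sum are reflected from there, while the fibre
-- powers are the lifted ones.
lemma isAdditive_bundle : (bundle 𝕏).IsAdditive := by
  refine AddBundleData.IsAdditive.of_faithful (postcomp (vfBase 𝕏) (vfForget 𝕏))
    (isAdditive_precomp 𝕏.str (vfForget 𝕏)) (λ_ (vfForget 𝕏) ≪≫ (ρ_ (vfForget 𝕏)).symm).hom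
    (tan 𝕏).forgetIso.hom (two 𝕏).forgetIso.hom
    (inferInstanceAs (Mono (tan 𝕏).forgetIso.hom)) ?_ ?_ ?_ ?_ ?_
    ((isFibrePower_two_iff _ _).1 (IsPointwisePower.isFibrePower
      (isPointwisePower_twoProj 𝕏))) (fun n hn => ?_)
    ?_ ?_
  · exact (forgetIso_naturality (A := two 𝕏) (B := tan 𝕏) 𝕏.str.p.π₁
      (isVFCell_pow (isPointwisePower_two 𝕏) 0)).symm
  · exact (forgetIso_naturality (A := two 𝕏) (B := tan 𝕏) 𝕏.str.p.π₂
      (isVFCell_pow (isPointwisePower_two 𝕏) 1)).symm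
  · exact forgetIso_naturality (A := two 𝕏) (B := tan 𝕏) 𝕏.str.p.s (isVFCell_sum 𝕏)
  · apply cell_ext
    intro V
    change (tanZero 𝕏).app (VectorField.M V) ≫ 𝟙 _ =
      (𝟙 _ ≫ 𝟙 _) ≫ (tanZero 𝕏).app (VectorField.M V)
    rw [Category.comp_id, Category.id_comp]
    exact (Category.id_comp _).symm
  · exact proj_naturality.symm
  · obtain ⟨P, π, h⟩ := 𝕏.str.fibrePower n hn
    have h' : IsPointwisePower 𝕏.str.p.q π := h
    exact ⟨_, _, IsPointwisePower.isFibrePower (isPointwisePower_powProj h')⟩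
  · exact cell_ext fun V => VectorField.hom_ext
      (cell_congr 𝕏.str.isAdditive.z_q (VectorField.M V))
  · exact cell_ext fun V => VectorField.hom_ext
      (cell_congr 𝕏.str.isAdditive.s_q (VectorField.M V))

end VFEndo

end StructureCells

/-! ## The lifted tangent monad -/

section Squares

variable {K : Type u} [Bicategory.{w, v} K]

/-- A 1-morphism over `A` along `U`, precomposed with `F`. -/
def precompLaw {Y V X : K} {U : V ⟶ X} {A' : V ⟶ V} {A : X ⟶ X} (F : Y ⟶ V)
    (e : A' ≫ U ≅ U ≫ A) : (F ≫ A') ≫ U ≅ (F ≫ U) ≫ A :=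
  α_ _ _ _ ≪≫ whiskerLeftIso F e ≪≫ (α_ _ _ _).symm

lemma precompLaw_naturality {Y V X : K} {U : V ⟶ X} {A' B' : V ⟶ V} {A B : X ⟶ X} (F : Y ⟶ V)
    {a : A' ≫ U ≅ U ≫ A} {b : B' ≫ U ≅ U ≫ B} {x' : A' ⟶ B'} {x : A ⟶ B}
    (h : x' ▷ U ≫ b.hom = a.hom ≫ U ◁ x) :
    (F ◁ x') ▷ U ≫ (precompLaw F b).hom = (precompLaw F a).hom ≫ (F ≫ U) ◁ x := by
  calc
    _ = 𝟙 _ ⊗≫ F ◁ (x' ▷ U ≫ b.hom) ⊗≫ 𝟙 _ := by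
      simp only [precompLaw, Iso.trans_hom, Iso.symm_hom, whiskerLeftIso_hom]
      bicategory
    _ = _ := by
      rw [h]
      simp only [precompLaw, Iso.trans_hom, Iso.symm_hom, whiskerLeftIso_hom]
      bicategory

lemma precompLaw_naturality_inv {Y V X : K} {U : V ⟶ X} {A' B' : V ⟶ V} {A B : X ⟶ X}
    (F : Y ⟶ V) {a : A' ≫ U ≅ U ≫ A} {b : B' ≫ U ≅ U ≫ B} {x' : A' ⟶ B'} {x : A ⟶ B}
    (h : x' ▷ U ≫ b.hom = a.hom ≫ U ◁ x) :
    (F ≫ U) ◁ x ≫ (precompLaw F b).inv = (precompLaw F a).inv ≫ (F ◁ x') ▷ U := by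
  rw [Iso.comp_inv_eq, Category.assoc, precompLaw_naturality F h, Iso.inv_hom_id_assoc]

lemma precompLaw_naturality_map {Y V X : K} {U : V ⟶ X} {A' B' : V ⟶ V} {A B : X ⟶ X}
    (F : Y ⟶ V) (T : X ⟶ X) {a : A' ≫ U ≅ U ≫ A} {b : B' ≫ U ≅ U ≫ B} {x' : A' ⟶ B'} {x : A ⟶ B}
    (h : x' ▷ U ≫ b.hom = a.hom ≫ U ◁ x) :
    ((F ◁ x') ▷ U) ▷ T ≫ (whiskerRightIso (precompLaw F b) T ≪≫ α_ _ _ _).hom =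
      (whiskerRightIso (precompLaw F a) T ≪≫ α_ _ _ _).hom ≫ (F ≫ U) ◁ (x ▷ T) := by
  have k := congrArg (fun y => y ▷ T ≫ (α_ _ _ T).hom) (precompLaw_naturality F h)
  simpa using k

/-- The joint monicity of the image under `T` of a lifted family, precomposed with `H`. -/
lemma jointlyMono_whiskerLeft {V X Y : K} {U : V ⟶ X} {T' P' E' : V ⟶ V} {T : X ⟶ X} {n : ℕ}
    {r : Fin n → (P' ⟶ E')} (H : Y ⟶ V)
    (h : JointlyMono fun i => ((shift T' H 0).map (r i) ▷ U) ▷ T) :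
    JointlyMono fun i => ((H ◁ r i) ▷ U) ▷ T := by
  let j : ((H ≫ P') ≫ U) ≫ T ≅ ((shift T' H 0).obj P' ≫ U) ≫ T :=
    whiskerRightIso (whiskerRightIso (ρ_ (H ≫ P')).symm U) T
  refine h.of_comp j.hom (fun i => ((ρ_ (H ≫ E')).inv ▷ U) ▷ T) fun i => ?_
  have k := congrArg (fun a => (a ▷ U) ▷ T) (rightUnitor_inv_naturality (H ◁ r i))
  simp only [comp_whiskerRight] at k
  exact k

/-- The joint monicity of the image under `T` of a lifted family, postcomposed with `T'`. -/
lemma jointlyMono_whiskerRight {V X : K} {U : V ⟶ X} {T' P' E' : V ⟶ V} {T : X ⟶ X} {n : ℕ}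
    {r : Fin n → (P' ⟶ E')}
    (h : JointlyMono fun i => ((shift T' (𝟙 V) 1).map (r i) ▷ U) ▷ T) :
    JointlyMono fun i => ((r i ▷ T') ▷ U) ▷ T := by
  let j : ((P' ≫ T') ≫ U) ≫ T ≅ ((shift T' (𝟙 V) 1).obj P' ≫ U) ≫ T :=
    whiskerRightIso (whiskerRightIso
      (whiskerRightIso (λ_ P').symm T' ≪≫ whiskerLeftIso (𝟙 V ≫ P') (λ_ T').symm) U) T
  refine h.of_comp j.hom
    (fun i => (((λ_ E').inv ▷ T' ≫ (𝟙 V ≫ E') ◁ (λ_ T').inv) ▷ U) ▷ T) fun i => ?_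
  have e : r i ▷ T' ≫ (λ_ E').inv ▷ T' ≫ (𝟙 V ≫ E') ◁ (λ_ T').inv =
      ((λ_ P').inv ▷ T' ≫ (𝟙 V ≫ P') ◁ (λ_ T').inv) ≫ (𝟙 V ◁ r i) ▷ (𝟙 V ≫ T') := by
    rw [Category.assoc, whisker_exchange, ← comp_whiskerRight_assoc, ← comp_whiskerRight_assoc,
      leftUnitor_inv_naturality]
  have k := congrArg (fun a => (a ▷ U) ▷ T) e
  simp only [comp_whiskerRight] at k
  simp only [comp_whiskerRight, j, Iso.trans_hom, whiskerRightIso_hom, whiskerLeftIso_hom,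
    Iso.symm_hom, Category.assoc] at k ⊢
  exact k.trans (Category.assoc _ _ _).symm

end Squares

/-! ### Interaction of the canonical flip with the vertical lift -/

section VerticalLift

/-- Compatibility of the mediating morphism of the vertical lift with the canonical flip. -/
lemma aux_flip_lift {C : Type u₁} [Category.{v₁} C] {T E : C ⥤ C} {c : T ⋙ T ⟶ T ⋙ T}
    {π : E ⟶ T} {g : ∀ M, T.obj (E.obj M) ⟶ E.obj (T.obj M)} {ν : ∀ M, E.obj M ⟶ T.obj (E.obj M)}
    {x : ∀ M, T.obj M ⟶ T.obj (T.obj M)}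
    (hν : ∀ M, ν M ≫ T.map (π.app M) = π.app M ≫ x M)
    (hg : ∀ M, g M ≫ π.app (T.obj M) = T.map (π.app M) ≫ c.app M)
    (hx : ∀ M, T.map (x M) ≫ c.app (T.obj M) ≫ T.map (c.app M) = c.app M ≫ x (T.obj M)) (M : C) :
    (g M ≫ ν (T.obj M)) ≫ T.map (π.app (T.obj M)) =
      (T.map (ν M) ≫ c.app (E.obj M) ≫ T.map (g M)) ≫ T.map (π.app (T.obj M)) := by
  have hc := c.naturality (π.app M)
  simp only [Functor.comp_map] at hc
  rw [Category.assoc, hν, reassoc_of% (hg M), Category.assoc, Category.assoc, ← T.map_comp, hg,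
    T.map_comp, ← reassoc_of% hc, ← T.map_comp_assoc, hν, T.map_comp_assoc, hx]

variable {𝕏 : Tangentad MndCat.{v₁, max u₁ v₁}}

/-- This is `tanLift_flip` with all flips moved to the other side, using that they are involutions.
-/
lemma map_tanLift_flip (M : 𝕏.base.C) : (tanF 𝕏).map ((tanLift 𝕏).app M) ≫
      (tanFlip 𝕏).app ((tanF 𝕏).obj M) ≫ (tanF 𝕏).map ((tanFlip 𝕏).app M) =
    (tanFlip 𝕏).app M ≫ (tanLift 𝕏).app ((tanF 𝕏).obj M) := by
  have h := congrArg (fun a => (tanFlip 𝕏).app M ≫ a ≫ (tanFlip 𝕏).app ((tanF 𝕏).obj M) ≫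
    (tanF 𝕏).map ((tanFlip 𝕏).app M)) (tanLift_flip M)
  have k : ∀ M, (tanFlip 𝕏).app M ≫ (tanFlip 𝕏).app M = 𝟙 ((tanF 𝕏).obj ((tanF 𝕏).obj M)) :=
    tanFlip_tanFlip
  have k' : (tanF 𝕏).map ((tanFlip 𝕏).app M) ≫ (tanF 𝕏).map ((tanFlip 𝕏).app M) =
      𝟙 ((tanF 𝕏).obj ((tanF 𝕏).obj ((tanF 𝕏).obj M))) := by
    rw [← CategoryTheory.Functor.map_comp, k]
    exact CategoryTheory.Functor.map_id _ _
  simp only [Category.assoc] at h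
  rw [reassoc_of% (k M), reassoc_of% (k ((tanF 𝕏).obj M)), k'] at h
  exact h.symm.trans (congrArg (fun a => _ ≫ a) (Category.comp_id _))

lemma map_tanZero_flip (M : 𝕏.base.C) :
    (tanF 𝕏).map ((tanZero 𝕏).app ((tanF 𝕏).obj M)) ≫
      (tanFlip 𝕏).app ((tanF 𝕏).obj M) ≫ (tanF 𝕏).map ((tanFlip 𝕏).app M) =
    (tanFlip 𝕏).app M ≫ (tanZero 𝕏).app ((tanF 𝕏).obj ((tanF 𝕏).obj M)) := by
  have k : ∀ M, (tanFlip 𝕏).app M ≫ (tanFlip 𝕏).app M = 𝟙 ((tanF 𝕏).obj ((tanF 𝕏).obj M)) :=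
    tanFlip_tanFlip
  rw [← tanZero_flip, Category.assoc, reassoc_of% (k ((tanF 𝕏).obj M))]
  exact ((tanZero 𝕏).naturality ((tanFlip 𝕏).app M)).symm

/-- The components of the 2-morphisms `ν : T₂ ⟶ T T₂` and `g : T T₂ ⟶ T₂ T`. -/
lemma flip_vertical {g : 𝕏.str.p.E₂ ≫ 𝕏.str.T ⟶ 𝕏.str.T ≫ 𝕏.str.p.E₂}
    (h₁ : g ≫ 𝕏.str.T ◁ 𝕏.str.p.π₁ = 𝕏.str.p.π₁ ▷ 𝕏.str.T ≫ 𝕏.str.c)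
    (h₂ : g ≫ 𝕏.str.T ◁ 𝕏.str.p.π₂ = 𝕏.str.p.π₂ ▷ 𝕏.str.T ≫ 𝕏.str.c)
    {ν : 𝕏.str.p.E₂ ⟶ 𝕏.str.p.E₂ ≫ 𝕏.str.T}
    (k₁ : ν ≫ 𝕏.str.p.π₁ ▷ 𝕏.str.T = 𝕏.str.p.π₁ ≫ 𝕏.str.l)
    (k₂ : ν ≫ 𝕏.str.p.π₂ ▷ 𝕏.str.T =
      𝕏.str.p.π₂ ≫ (ρ_ 𝕏.str.T).inv ≫ 𝕏.str.T ◁ 𝕏.str.p.z) :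
    (g ≫ 𝕏.str.T ◁ ν) ≫ (α_ _ _ _).inv = (ν ▷ 𝕏.str.T ≫ (α_ _ _ _).hom ≫ 𝕏.str.p.E₂ ◁ 𝕏.str.c ≫
      (α_ _ _ _).inv ≫ g ▷ 𝕏.str.T) := by
  have hg (i : Fin 2) (M : 𝕏.base.C) :
      (MonadMorTwoCell.τ g).app M ≫ (tanPairProj 𝕏 i).app ((tanF 𝕏).obj M) =
        (tanF 𝕏).map ((tanPairProj 𝕏 i).app M) ≫ (tanFlip 𝕏).app M := by
    fin_cases i
    · exact cell_congr h₁ M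
    · exact cell_congr h₂ M
  have hν₁ (M : 𝕏.base.C) :
      (MonadMorTwoCell.τ ν).app M ≫ (tanF 𝕏).map ((tanPairProj 𝕏 0).app M) =
        (tanPairProj 𝕏 0).app M ≫ (tanLift 𝕏).app M := cell_congr k₁ M
  have hν₂ (M : 𝕏.base.C) :
      (MonadMorTwoCell.τ ν).app M ≫ (tanF 𝕏).map ((tanPairProj 𝕏 1).app M) =
        (tanPairProj 𝕏 1).app M ≫ (tanZero 𝕏).app ((tanF 𝕏).obj M) :=
    (cell_congr k₂ M).trans (congrArg (_ ≫ ·) (Category.id_comp _))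
  refine (IsPointwisePower.isFibrePower_precomp_postcomp (isPointwisePower_two 𝕏)
    𝕏.str.T).hom_ext fun i => cell_ext fun M => ?_
  -- The mediating morphism ν has components l on the first projection and z at T on the second.
  -- Both satisfy the flip relation that `aux_flip_lift` asks for.
  have key : ((MonadMorTwoCell.τ g).app M ≫ (MonadMorTwoCell.τ ν).app ((tanF 𝕏).obj M)) ≫
        (tanF 𝕏).map ((tanPairProj 𝕏 i).app ((tanF 𝕏).obj M)) =
      ((tanF 𝕏).map ((MonadMorTwoCell.τ ν).app M) ≫ (tanFlip 𝕏).app ((tanPair 𝕏).obj M) ≫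
        (tanF 𝕏).map ((MonadMorTwoCell.τ g).app M)) ≫
        (tanF 𝕏).map ((tanPairProj 𝕏 i).app ((tanF 𝕏).obj M)) := by
    fin_cases i
    · exact aux_flip_lift (T := tanF 𝕏) (E := tanPair 𝕏) (c := tanFlip 𝕏) (π := tanPairProj 𝕏 0)
        (g := fun M => (MonadMorTwoCell.τ g).app M) (ν := fun M => (MonadMorTwoCell.τ ν).app M)
        (x := fun M => (tanLift 𝕏).app M) hν₁ (hg 0) map_tanLift_flip M
    · exact aux_flip_lift (T := tanF 𝕏) (E := tanPair 𝕏) (c := tanFlip 𝕏) (π := tanPairProj 𝕏 1)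
        (g := fun M => (MonadMorTwoCell.τ g).app M) (ν := fun M => (MonadMorTwoCell.τ ν).app M)
        (x := fun M => (tanZero 𝕏).app ((tanF 𝕏).obj M)) hν₂ (hg 1) map_tanZero_flip M
  refine Eq.trans ?_ (key.trans ?_)
  · exact congrArg (· ≫ _) (Category.comp_id _)
  · refine congrArg (fun a => (_ ≫ a) ≫ _) ?_
    exact Eq.trans (congrArg (_ ≫ ·) (Category.id_comp _).symm) (Category.id_comp _).symm

end VerticalLift

/-! ### The axioms of the lifted tangent structure -/

section LiftedStructure

variable {𝕏 : Tangentad MndCat.{v₁, max u₁ v₁}}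

/-- Write x for the top edge of the universal square. The comparison g relates T x to x at T up to
invertible flips: `flip_vertical` handles the factor ν, and additivity of c handles the sum. -/
lemma flip_vertical_sum {g : 𝕏.str.p.E₂ ≫ 𝕏.str.T ⟶ 𝕏.str.T ≫ 𝕏.str.p.E₂}
    (h₁ : g ≫ 𝕏.str.T ◁ 𝕏.str.p.π₁ = 𝕏.str.p.π₁ ▷ 𝕏.str.T ≫ 𝕏.str.c)
    (h₂ : g ≫ 𝕏.str.T ◁ 𝕏.str.p.π₂ = 𝕏.str.p.π₂ ▷ 𝕏.str.T ≫ 𝕏.str.c)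
    (hs : 𝕏.str.p.s ▷ 𝕏.str.T ≫ 𝕏.str.c = g ≫ 𝕏.str.T ◁ 𝕏.str.p.s)
    {ν : 𝕏.str.p.E₂ ⟶ 𝕏.str.p.E₂ ≫ 𝕏.str.T}
    (k₁ : ν ≫ 𝕏.str.p.π₁ ▷ 𝕏.str.T = 𝕏.str.p.π₁ ≫ 𝕏.str.l)
    (k₂ : ν ≫ 𝕏.str.p.π₂ ▷ 𝕏.str.T =
      𝕏.str.p.π₂ ≫ (ρ_ 𝕏.str.T).inv ≫ 𝕏.str.T ◁ 𝕏.str.p.z) :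
    g ≫ 𝕏.str.T ◁ (ν ≫ 𝕏.str.p.s ▷ 𝕏.str.T) = (ν ≫ 𝕏.str.p.s ▷ 𝕏.str.T) ▷ 𝕏.str.T ≫
      (α_ _ _ _).hom ≫ 𝕏.str.T ◁ 𝕏.str.c ≫ (α_ _ _ _).inv ≫ 𝕏.str.c ▷ 𝕏.str.T ≫
        (α_ _ _ _).hom := by
  have hν := flip_vertical h₁ h₂ k₁ k₂
  rw [whiskerLeft_comp, ← cancel_mono (α_ _ _ _).inv]
  have e : (g ≫ 𝕏.str.T ◁ ν ≫ 𝕏.str.T ◁ 𝕏.str.p.s ▷ 𝕏.str.T) ≫ (α_ 𝕏.str.T 𝕏.str.T 𝕏.str.T).inv =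
      ((g ≫ 𝕏.str.T ◁ ν) ≫ (α_ _ _ _).inv) ≫ (𝕏.str.T ◁ 𝕏.str.p.s) ▷ 𝕏.str.T := by
    simp
  rw [e, hν]
  simp only [Category.assoc]
  rw [← comp_whiskerRight g, ← hs]
  have x : (α_ 𝕏.str.p.E₂ 𝕏.str.T 𝕏.str.T).hom ≫ 𝕏.str.p.E₂ ◁ 𝕏.str.c ≫ (α_ _ _ _).inv ≫
      𝕏.str.p.s ▷ 𝕏.str.T ▷ 𝕏.str.T =
        𝕏.str.p.s ▷ 𝕏.str.T ▷ 𝕏.str.T ≫ (α_ _ _ _).hom ≫ 𝕏.str.T ◁ 𝕏.str.c ≫ (α_ _ _ _).inv := by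
    have y := whisker_exchange 𝕏.str.p.s 𝕏.str.c
    rw [whiskerRight_comp] at y
    rw [← cancel_mono (α_ _ _ _).hom, ← cancel_epi (α_ _ _ _).inv]
    simpa using y
  simp [reassoc_of% x]

lemma whiskerLeft_square {K : Type u} [Bicategory.{w, v} K] {X Y : K} {T E A : X ⟶ X}
    {g : E ≫ T ⟶ T ≫ E} {x : E ⟶ A} {k : A ≫ T ⟶ T ≫ A} (h : g ≫ T ◁ x = x ▷ T ≫ k)
    (G : Y ⟶ X) :
    (G ◁ g ≫ (α_ _ _ _).inv) ≫ (G ≫ T) ◁ x = G ◁ (x ▷ T) ≫ G ◁ k ≫ (α_ _ _ _).inv := by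
  rw [← whiskerLeft_comp_assoc, ← h]
  simp

/-- The image under `T` of the universal square of the vertical lift is jointly monic. -/
lemma vertical_jointlyMono {ν : 𝕏.str.p.E₂ ⟶ 𝕏.str.p.E₂ ≫ 𝕏.str.T}
    (k₁ : ν ≫ 𝕏.str.p.π₁ ▷ 𝕏.str.T = 𝕏.str.p.π₁ ≫ 𝕏.str.l)
    (k₂ : ν ≫ 𝕏.str.p.π₂ ▷ 𝕏.str.T =
      𝕏.str.p.π₂ ≫ (ρ_ 𝕏.str.T).inv ≫ 𝕏.str.T ◁ 𝕏.str.p.z)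
    (hν : ∀ {Y : MndCat.{v₁, max u₁ v₁}} (F : Y ⟶ 𝕏.base), IsPullback
      (F ◁ (ν ≫ 𝕏.str.p.s ▷ 𝕏.str.T)) (F ◁ (𝕏.str.p.π₁ ≫ 𝕏.str.p.q))
        (F ◁ (𝕏.str.p.q ▷ 𝕏.str.T)) (F ◁ (𝕏.str.p.z ≫ (λ_ 𝕏.str.T).inv)))
    {Y : MndCat.{v₁, max u₁ v₁}} (G : Y ⟶ 𝕏.base) {A : Y ⟶ 𝕏.base}
    {a b : A ⟶ G ≫ 𝕏.str.p.E₂ ≫ 𝕏.str.T}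
    (e₁ : a ≫ G ◁ ((ν ≫ 𝕏.str.p.s ▷ 𝕏.str.T) ▷ 𝕏.str.T) =
      b ≫ G ◁ ((ν ≫ 𝕏.str.p.s ▷ 𝕏.str.T) ▷ 𝕏.str.T))
    (e₂ : a ≫ G ◁ ((𝕏.str.p.π₁ ≫ 𝕏.str.p.q) ▷ 𝕏.str.T) =
      b ≫ G ◁ ((𝕏.str.p.π₁ ≫ 𝕏.str.p.q) ▷ 𝕏.str.T)) : a = b := by
  obtain ⟨g, h₁, h₂, hs⟩ : ∃ g : 𝕏.str.p.E₂ ≫ 𝕏.str.T ⟶ 𝕏.str.T ≫ 𝕏.str.p.E₂,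
    g ≫ 𝕏.str.T ◁ 𝕏.str.p.π₁ = 𝕏.str.p.π₁ ▷ 𝕏.str.T ≫ 𝕏.str.c ∧
    g ≫ 𝕏.str.T ◁ 𝕏.str.p.π₂ = 𝕏.str.p.π₂ ▷ 𝕏.str.T ≫ 𝕏.str.c ∧
    𝕏.str.p.s ▷ 𝕏.str.T ≫ 𝕏.str.c = g ≫ 𝕏.str.T ◁ 𝕏.str.p.s := 𝕏.str.c_hom.s_comm
  have hq : 𝕏.str.c ≫ 𝕏.str.T ◁ 𝕏.str.p.q =
    𝕏.str.p.q ▷ 𝕏.str.T ≫ (λ_ 𝕏.str.T).hom ≫ (ρ_ 𝕏.str.T).inv := 𝕏.str.c_hom.q_comm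
  have q₁ := flip_vertical_sum h₁ h₂ hs k₁ k₂
  have q₂ : g ≫ 𝕏.str.T ◁ (𝕏.str.p.π₁ ≫ 𝕏.str.p.q) = (𝕏.str.p.π₁ ≫ 𝕏.str.p.q) ▷ 𝕏.str.T ≫
      (λ_ 𝕏.str.T).hom ≫ (ρ_ 𝕏.str.T).inv := by
    rw [whiskerLeft_comp, reassoc_of% h₁, hq, comp_whiskerRight, Category.assoc]
  -- Universality is available at the 1-morphism `G ≫ 𝕏.str.T`, that is, for the square at T. The
  -- relations `q₁` and `q₂` translate the hypotheses about the image of the square under T into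
  -- that situation.
  have hab : a ≫ G ◁ g ≫ (α_ _ _ _).inv = b ≫ G ◁ g ≫ (α_ _ _ _).inv := by
    apply (hν (G ≫ 𝕏.str.T)).hom_ext
    · have s₁ := whiskerLeft_square q₁ G
      simp only [Category.assoc] at s₁ ⊢
      rw [s₁, reassoc_of% e₁]
    · have s₂ := whiskerLeft_square q₂ G
      simp only [Category.assoc] at s₂ ⊢
      rw [s₂, reassoc_of% e₂]
  rw [← Category.assoc, ← Category.assoc, cancel_mono] at hab
  have hc : G ◁ 𝕏.str.c ≫ G ◁ 𝕏.str.c = 𝟙 _ := by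
    rw [← whiskerLeft_comp, 𝕏.str.c_c, whiskerLeft_id]
  -- It remains to cancel g. Followed by a projection at T it equals T of the projection followed by
  -- the involution c, and the projections of T₂ are jointly monic after T.
  have key : ∀ π : 𝕏.str.p.E₂ ⟶ 𝕏.str.T, g ≫ 𝕏.str.T ◁ π = π ▷ 𝕏.str.T ≫ 𝕏.str.c →
      (a ≫ (α_ _ _ _).inv) ≫ (G ◁ π) ▷ 𝕏.str.T = (b ≫ (α_ _ _ _).inv) ≫ (G ◁ π) ▷ 𝕏.str.T := by
    intro π hπ
    have e := congrArg (fun x => x ≫ G ◁ 𝕏.str.T ◁ π ≫ G ◁ 𝕏.str.c ≫ (α_ G 𝕏.str.T 𝕏.str.T).inv)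
      hab
    simp only [Category.assoc] at e
    rw [← whiskerLeft_comp_assoc, hπ, whiskerLeft_comp_assoc, reassoc_of% hc] at e
    simpa using e
  have k := (IsPointwisePower.isFibrePower_precomp_postcomp (isPointwisePower_two 𝕏) G).hom_ext
    (a := a ≫ (α_ _ _ _).inv) (b := b ≫ (α_ _ _ _).inv) (fun i => by
      fin_cases i
      · exact key _ h₁
      · exact key _ h₂)
  rwa [cancel_mono] at k

namespace VFEndo

lemma naturality_of_cell {A B : VFEndo 𝕏} {f : A.toMor ⟶ B.toMor} {x : A.A ⟶ B.A}
    (h : f ▷ vfForget 𝕏 = cell x) :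
    f ▷ vfForget 𝕏 ≫ B.forgetIso.hom = A.forgetIso.hom ≫ vfForget 𝕏 ◁ x := by
  rw [h]
  exact cell_ext fun V => (Category.comp_id _).trans
    (Category.id_comp ((MonadMorTwoCell.τ x).app (VectorField.M V))).symm

variable (𝕏) in
lemma jointlyMono_twoProj_whiskerRight :
    JointlyMono fun i => ((twoProj 𝕏 i ▷ vfT 𝕏) ▷ vfForget 𝕏) ▷ 𝕏.str.T :=
  jointlyMono_whiskerRight (jointlyMono_powProj (isPointwisePower_two 𝕏) (𝟙 _) 1)

lemma jointlyMono_whiskerLeft_twoProj {Y : MndCat.{v₁, max u₁ v₁}} (H : Y ⟶ vfBase 𝕏) :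
    JointlyMono fun i => ((H ◁ twoProj 𝕏 i) ▷ vfForget 𝕏) ▷ 𝕏.str.T :=
  jointlyMono_whiskerLeft H (jointlyMono_powProj (isPointwisePower_two 𝕏) H 0)

variable (𝕏) in
-- All equations are those of the base, since a morphism of vector fields is determined by its
-- underlying morphism. Only the comparison on T₂ must be shown to lift, and its projections are
-- composites of lifted 2-morphisms.
lemma vlift_hom : IsAddBundleHom (bundle 𝕏) ((bundle 𝕏).map (postcomp (vfBase 𝕏) (vfT 𝕏)))
    (zero 𝕏 ≫ (λ_ (vfT 𝕏)).inv) (vlift 𝕏) where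
  q_comm := cell_ext fun V => VectorField.hom_ext (cell_congr 𝕏.str.l_hom.q_comm (VectorField.M V))
  z_comm := cell_ext fun V => VectorField.hom_ext (cell_congr 𝕏.str.l_hom.z_comm (VectorField.M V))
  s_comm := by
    obtain ⟨g, h₁, h₂, hs⟩ := 𝕏.str.l_hom.s_comm
    let a : Fin 2 → ((two 𝕏).toMor ⟶ vfT 𝕏 ≫ vfT 𝕏) := fun i => twoProj 𝕏 i ≫ vlift 𝕏
    have hg : IsVFCell (cell (A := two 𝕏) (B := (two 𝕏).comp (tan 𝕏)) g) := by
      refine isVFCell_of_jointlyMono (jointlyMono_twoProj_whiskerRight 𝕏) a fun i => ?_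
      fin_cases i
      · exact cell_ext fun V => cell_congr h₁ (VectorField.M V)
      · exact cell_ext fun V => cell_congr h₂ (VectorField.M V)
    exact ⟨lift (A := two 𝕏) (B := (two 𝕏).comp (tan 𝕏)) g hg,
      cell_ext fun V => VectorField.hom_ext (cell_congr h₁ (VectorField.M V)),
      cell_ext fun V => VectorField.hom_ext (cell_congr h₂ (VectorField.M V)),
      cell_ext fun V => VectorField.hom_ext (cell_congr hs (VectorField.M V))⟩

variable (𝕏) in
lemma flip_hom : IsAddBundleHom ((bundle 𝕏).map (postcomp (vfBase 𝕏) (vfT 𝕏)))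
    ((bundle 𝕏).map (precomp (vfBase 𝕏) (vfT 𝕏))) ((λ_ (vfT 𝕏)).hom ≫ (ρ_ (vfT 𝕏)).inv)
    (flip 𝕏) where
  q_comm := cell_ext fun V => VectorField.hom_ext (cell_congr 𝕏.str.c_hom.q_comm (VectorField.M V))
  z_comm := cell_ext fun V => VectorField.hom_ext (cell_congr 𝕏.str.c_hom.z_comm (VectorField.M V))
  s_comm := by
    obtain ⟨g, h₁, h₂, hs⟩ := 𝕏.str.c_hom.s_comm
    let a : Fin 2 → ((two 𝕏).toMor ≫ vfT 𝕏 ⟶ vfT 𝕏 ≫ vfT 𝕏) := fun i =>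
      twoProj 𝕏 i ▷ vfT 𝕏 ≫ flip 𝕏
    have hg : IsVFCell (cell (A := (two 𝕏).comp (tan 𝕏)) (B := (tan 𝕏).comp (two 𝕏)) g) := by
      refine isVFCell_of_jointlyMono (jointlyMono_whiskerLeft_twoProj (vfT 𝕏)) a fun i => ?_
      fin_cases i
      · exact cell_ext fun V => cell_congr h₁ (VectorField.M V)
      · exact cell_ext fun V => cell_congr h₂ (VectorField.M V)
    exact ⟨lift (A := (two 𝕏).comp (tan 𝕏)) (B := (tan 𝕏).comp (two 𝕏)) g hg,
      cell_ext fun V => VectorField.hom_ext (cell_congr h₁ (VectorField.M V)),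
      cell_ext fun V => VectorField.hom_ext (cell_congr h₂ (VectorField.M V)),
      cell_ext fun V => VectorField.hom_ext (cell_congr hs (VectorField.M V))⟩

variable (𝕏) in
-- The mediating morphism lifts because its two projections do. The square is then created by the
-- forgetful 1-morphism, by universality in the base and `vertical_jointlyMono`.
lemma vlift_universal : ∃ ν : (bundle 𝕏).E₂ ⟶ (bundle 𝕏).E₂ ≫ vfT 𝕏,
    ν ≫ (bundle 𝕏).π₁ ▷ vfT 𝕏 = (bundle 𝕏).π₁ ≫ vlift 𝕏 ∧
      ν ≫ (bundle 𝕏).π₂ ▷ vfT 𝕏 =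
        (bundle 𝕏).π₂ ≫ (ρ_ (vfT 𝕏)).inv ≫ vfT 𝕏 ◁ (bundle 𝕏).z ∧
      ∀ {Y : MndCat.{v₁, max u₁ v₁}} (F : Y ⟶ vfBase 𝕏),
        IsPullback (F ◁ (ν ≫ (bundle 𝕏).s ▷ vfT 𝕏)) (F ◁ ((bundle 𝕏).π₁ ≫ (bundle 𝕏).q))
          (F ◁ ((bundle 𝕏).q ▷ vfT 𝕏)) (F ◁ ((bundle 𝕏).z ≫ (λ_ (vfT 𝕏)).inv)) := by
  obtain ⟨ν, k₁, k₂, hν⟩ := 𝕏.str.l_universal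
  let a : Fin 2 → ((two 𝕏).toMor ⟶ vfT 𝕏 ≫ vfT 𝕏) :=
    ![twoProj 𝕏 0 ≫ vlift 𝕏, twoProj 𝕏 1 ≫ (ρ_ (vfT 𝕏)).inv ≫ vfT 𝕏 ◁ zero 𝕏]
  have hg : IsVFCell (cell (A := two 𝕏) (B := (two 𝕏).comp (tan 𝕏)) ν) := by
    refine isVFCell_of_jointlyMono (jointlyMono_twoProj_whiskerRight 𝕏) a fun i => ?_
    fin_cases i
    · exact cell_ext fun V => cell_congr k₁ (VectorField.M V)
    · exact cell_ext fun V => cell_congr k₂ (VectorField.M V)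
  let ν' : (two 𝕏).toMor ⟶ (two 𝕏).toMor ≫ vfT 𝕏 :=
    lift (A := two 𝕏) (B := (two 𝕏).comp (tan 𝕏)) ν hg
  have n₁ := naturality_of_cell (A := two 𝕏) (B := (tan 𝕏).comp (tan 𝕏))
    (f := ν' ≫ sum 𝕏 ▷ vfT 𝕏) (x := ν ≫ 𝕏.str.p.s ▷ 𝕏.str.T) (cell_ext fun _ => rfl)
  have n₂ := naturality_of_cell (A := two 𝕏) (B := one 𝕏) (f := twoProj 𝕏 0 ≫ proj 𝕏)
    (x := 𝕏.str.p.π₁ ≫ 𝕏.str.p.q) (cell_ext fun _ => rfl)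
  have n₃ := naturality_of_cell (A := (tan 𝕏).comp (tan 𝕏)) (B := (one 𝕏).comp (tan 𝕏))
    (f := proj 𝕏 ▷ vfT 𝕏) (x := 𝕏.str.p.q ▷ 𝕏.str.T) (cell_ext fun _ => rfl)
  have n₄ := naturality_of_cell (A := one 𝕏) (B := (one 𝕏).comp (tan 𝕏))
    (f := zero 𝕏 ≫ (λ_ (vfT 𝕏)).inv) (x := 𝕏.str.p.z ≫ (λ_ 𝕏.str.T).inv) (cell_ext fun _ => rfl)
  refine ⟨ν', cell_ext fun V => VectorField.hom_ext (cell_congr k₁ (VectorField.M V)),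
    cell_ext fun V => VectorField.hom_ext (cell_congr k₂ (VectorField.M V)), fun F => ?_⟩
  refine isPullback_of_forget ?_ ?_
  · exact (hν (F ≫ vfForget 𝕏)).of_iso (precompLaw F (two 𝕏).forgetIso).symm
      (precompLaw F ((tan 𝕏).comp (tan 𝕏)).forgetIso).symm (precompLaw F (one 𝕏).forgetIso).symm
      (precompLaw F ((one 𝕏).comp (tan 𝕏)).forgetIso).symm
      (precompLaw_naturality_inv F n₁) (precompLaw_naturality_inv F n₂)
      (precompLaw_naturality_inv F n₃) (precompLaw_naturality_inv F n₄)
  -- The isomorphism j identifies the image of the lifted square under T with that of the base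
  -- square at `F ≫ vfForget 𝕏`.
  · intro A a b e₁ e₂
    have m₁ := precompLaw_naturality_map F 𝕏.str.T n₁
    have m₂ := precompLaw_naturality_map F 𝕏.str.T n₂
    let j : ((F ≫ (two 𝕏).toMor) ≫ vfForget 𝕏) ≫ 𝕏.str.T ≅
        (F ≫ vfForget 𝕏) ≫ 𝕏.str.p.E₂ ≫ 𝕏.str.T :=
      whiskerRightIso (precompLaw F (two 𝕏).forgetIso) 𝕏.str.T ≪≫ α_ _ _ _
    refine (cancel_mono j.hom).1
      (vertical_jointlyMono k₁ k₂ (fun F => hν F) (F ≫ vfForget 𝕏) ?_ ?_)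
    · exact (Category.assoc _ _ _).trans ((congrArg (a ≫ ·) m₁.symm).trans
        ((Category.assoc _ _ _).symm.trans ((congrArg (· ≫ _) e₁).trans
          ((Category.assoc _ _ _).trans ((congrArg (b ≫ ·) m₁).trans
            (Category.assoc _ _ _).symm)))))
    · exact (Category.assoc _ _ _).trans ((congrArg (a ≫ ·) m₂.symm).trans
        ((Category.assoc _ _ _).symm.trans ((congrArg (· ≫ _) e₂).trans
          ((Category.assoc _ _ _).trans ((congrArg (b ≫ ·) m₂).trans
            (Category.assoc _ _ _).symm)))))

variable (𝕏) in
/-- The tangent structure of the lifted tangent monad. -/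
noncomputable def tangentStructure : TangentStructure (vfBase 𝕏) where
  T := vfT 𝕏
  p := bundle 𝕏
  isAdditive := isAdditive_bundle 𝕏
  isPullback F m := (isFibrePower_two_iff _ _).1 (isPointwisePower_twoProj 𝕏 F m)
  fibrePower n hn := by
    obtain ⟨P, π, h⟩ := 𝕏.str.fibrePower n hn
    have h' : IsPointwisePower 𝕏.str.p.q π := h
    exact ⟨_, powProj h', isPointwisePower_powProj h'⟩
  l := vlift 𝕏
  l_hom := vlift_hom 𝕏
  c := flip 𝕏
  c_hom := flip_hom 𝕏
  l_coassoc := cell_ext fun V => VectorField.hom_ext (cell_congr 𝕏.str.l_coassoc (VectorField.M V))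
  l_c := cell_ext fun V => VectorField.hom_ext (cell_congr 𝕏.str.l_c (VectorField.M V))
  l_c_c := cell_ext fun V => VectorField.hom_ext (cell_congr 𝕏.str.l_c_c (VectorField.M V))
  c_c := cell_ext fun V => VectorField.hom_ext (cell_congr 𝕏.str.c_c (VectorField.M V))
  c_braid := cell_ext fun V => VectorField.hom_ext (cell_congr 𝕏.str.c_braid (VectorField.M V))
  l_universal := vlift_universal 𝕏

end VFEndo

end LiftedStructure

/-! ## The universal vector field -/

section Generalities

lemma VectorField.isIso_of_isIso {C : Type u₁} [Category.{v₁} C] {T : C ⥤ C} {p : T ⟶ 𝟭 C}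
    {V W : VectorField p} (a : V ⟶ W) (h : IsIso (VectorField.Hom.f a)) : IsIso a := by
  refine ⟨VectorField.Hom.mk (inv (VectorField.Hom.f a)) ?_, ?_, ?_⟩
  · rw [T.map_inv, IsIso.comp_inv_eq, Category.assoc, VectorField.Hom.comm, IsIso.inv_hom_id_assoc]
  · exact VectorField.hom_ext (IsIso.hom_inv_id (VectorField.Hom.f a))
  · exact VectorField.hom_ext (IsIso.inv_hom_id (VectorField.Hom.f a))

lemma VectorField.ext_of_eqToHom {C : Type u₁} [Category.{v₁} C] {T : C ⥤ C} {p : T ⟶ 𝟭 C}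
    {V W : VectorField p} (hM : V.M = W.M) (hv : V.v ≫ T.map (eqToHom hM) = eqToHom hM ≫ W.v) :
    V = W := by
  obtain ⟨M, x, _⟩ := V
  obtain ⟨N, y, _⟩ := W
  obtain rfl : M = N := hM
  obtain rfl : x = y := by simpa using hv
  rfl

lemma VectorField.eqToHom_f {C : Type u₁} [Category.{v₁} C] {T : C ⥤ C} {p : T ⟶ 𝟭 C}
    {V W : VectorField p} (h : V = W) :
    VectorField.Hom.f (eqToHom h) = eqToHom (congrArg VectorField.M h) := by
  subst h; rfl

variable {K : Type u} [Bicategory.{w, v} K]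

lemma isIso_GamLaw {𝕍 𝕏 : Tangentad K} (m : HomVF 𝕍 𝕏) (h : IsIso (LaxTangentHom.α m.M))
    (𝕏' : Tangentad K) : IsIso (GamLaw m 𝕏') := by
  have hl : IsIso (lawCell m.M) :=
    (mkIso (f := compHom (tangentHom 𝕍) m.M) (g := compHom m.M (tangentHom 𝕏))
      (@asIso _ _ _ _ _ h) (lawCell m.M).comm).isIso_hom
  have : ∀ H, IsIso ((GamLaw m 𝕏').app H) := fun H => by
    apply VectorField.isIso_of_isIso
    change IsIso ((α_ H _ _).hom ≫ H ◁ lawCell m.M ≫ (α_ H _ _).inv)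
    infer_instance
  exact NatIso.isIso_of_isIso_app _

lemma laxTangentHom_ext {𝕏' 𝕏 : Tangentad K} {f g : 𝕏' ⟶ 𝕏}
    (hF : LaxTangentHom.F f = LaxTangentHom.F g)
    (hα : LaxTangentHom.α f ≫ eqToHom (congrArg (· ≫ 𝕏.str.T) hF) =
      eqToHom (congrArg (𝕏'.str.T ≫ ·) hF) ≫ LaxTangentHom.α g) : f = g := by
  obtain ⟨F, a, _⟩ := f
  obtain ⟨G, b, _⟩ := g
  obtain rfl : F = G := hF
  obtain rfl : a = b := by simpa using hα
  rfl

lemma eqToHom_φ {𝕏' 𝕏 : Tangentad K} {f g : 𝕏' ⟶ 𝕏} (h : f = g) :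
    TangentTwoCell.φ (eqToHom h) = eqToHom (congrArg LaxTangentHom.F h) := by
  subst h; rfl

/-- An invertible β cancels from the composite law. With the faithfulness of the forgetful
1-morphism, this recovers a distributive law into `vfBase` from its composite with that of the
forgetful 1-morphism. -/
lemma compLaw_injective {X'' X' X : K} {T'' : X'' ⟶ X''} {T' : X' ⟶ X'} {T : X ⟶ X}
    {F : X'' ⟶ X'} {G : X' ⟶ X} {α α' : T'' ≫ F ⟶ F ≫ T'} {β : T' ≫ G ⟶ G ≫ T} [IsIso β]
    (h : compLaw α β = compLaw α' β) : α ▷ G = α' ▷ G := by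
  simp only [compLaw, cancel_epi] at h
  rw [← Category.assoc, ← Category.assoc] at h
  simpa only [cancel_mono, Category.assoc] using h

end Generalities

section MonadMorphisms

variable {𝔸 𝔹 : MndCat.{v₁, u₁}}

lemma φ_app_of_eq {f g : 𝔸 ⟶ 𝔹} (h : f = g) (M : 𝔸.C) : (MonadMor.φ f).app M =
    𝔹.S.map (eqToHom (congrArg (fun k => (MonadMor.F k).obj M) h)) ≫ (MonadMor.φ g).app M ≫
      eqToHom (congrArg (fun k => (MonadMor.F k).obj (𝔸.S.obj M)) h.symm) := by
  subst h
  simp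

lemma eqToHom_τ {f g : 𝔸 ⟶ 𝔹} (h : f = g) (M : 𝔸.C) :
    (MonadMorTwoCell.τ (eqToHom h)).app M =
      eqToHom (congrArg (fun k => (MonadMor.F k).obj M) h) := by
  subst h; rfl

end MonadMorphisms

/-! ### Vector fields as 1-morphisms into the monad of vector fields -/

section Universal

variable {𝕏 : Tangentad MndCat.{v₁, max u₁ v₁}} {Y : MndCat.{v₁, max u₁ v₁}}

/-- A 1-morphism to the monad of vector fields is determined by its vector field. -/
lemma vfMor_ext {F G : Y ⟶ vfBase 𝕏} (h : F ≫ vfForget 𝕏 = G ≫ vfForget 𝕏)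
    (hv : ∀ M, (vfAt F M).v ≫ (tanF 𝕏).map
        (eqToHom (congrArg (fun k => (MonadMor.F k).obj M) h)) =
      eqToHom (congrArg (fun k => (MonadMor.F k).obj M) h) ≫ (vfAt G M).v) : F = G := by
  have hM : ∀ M, vfAt F M = vfAt G M := fun M => VectorField.ext_of_eqToHom
    (congrArg (fun k => (MonadMor.F k).obj M) h) (hv M)
  have hF : MonadMor.F F = MonadMor.F G := by
    refine CategoryTheory.Functor.ext hM fun M N f => VectorField.hom_ext ?_
    have e := CategoryTheory.Functor.congr_hom (congrArg MonadMor.F h) f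
    refine e.trans ?_
    exact congrArg₂ (fun a b => a ≫ VectorField.Hom.f ((MonadMor.F G).map f) ≫ b)
      (VectorField.eqToHom_f (hM M)).symm (VectorField.eqToHom_f (hM N).symm).symm
  refine MonadMor.ext_of_app hF fun M => VectorField.hom_ext ?_
  have e := φ_app_of_eq h M
  have e₁ : (MonadMor.φ (F ≫ vfForget 𝕏)).app M = VectorField.Hom.f ((MonadMor.φ F).app M) :=
    Category.id_comp (VectorField.Hom.f ((MonadMor.φ F).app M))
  have e₂ : (MonadMor.φ (G ≫ vfForget 𝕏)).app M = VectorField.Hom.f ((MonadMor.φ G).app M) :=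
    Category.id_comp (VectorField.Hom.f ((MonadMor.φ G).app M))
  rw [e₁, e₂] at e
  refine e.trans ?_
  exact congrArg₂ (fun a b => 𝕏.base.S.map a ≫ VectorField.Hom.f ((MonadMor.φ G).app M) ≫ b)
    (VectorField.eqToHom_f (hM M)).symm (VectorField.eqToHom_f (hM (Y.S.obj M)).symm).symm

/-- The 1-morphism to the monad of vector fields induced by a vector field. -/
def vfMk (G : Y ⟶ 𝕏.base) (x : G ⟶ G ≫ 𝕏.str.T)
    (sec : x ≫ G ◁ 𝕏.str.p.q ≫ (ρ_ G).hom = 𝟙 G) : Y ⟶ vfBase 𝕏 :=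
  MonadMor.mk
    { obj := fun M => VectorField.mk (p := tanProj 𝕏) ((MonadMor.F G).obj M)
        ((MonadMorTwoCell.τ x).app M)
        ((congrArg (_ ≫ ·) (Category.comp_id _).symm).trans (cell_congr sec M))
      map := fun f => VectorField.Hom.mk ((MonadMor.F G).map f)
        ((MonadMorTwoCell.τ x).naturality f).symm
      map_id := fun M => VectorField.hom_ext ((MonadMor.F G).map_id M)
      map_comp := fun f g => VectorField.hom_ext ((MonadMor.F G).map_comp f g) }
    -- The compatibility of x with the monads is, after reassociation, the statement that the
    -- distributive law of G is a morphism of vector fields.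
    { app := fun M => VectorField.Hom.mk ((MonadMor.φ G).app M)
        ((Category.assoc _ _ _).trans (MonadMorTwoCell.comm x M))
      naturality := fun _ _ f => VectorField.hom_ext ((MonadMor.φ G).naturality f) }
    (fun M => VectorField.hom_ext (MonadMor.unit G M))
    (fun M => VectorField.hom_ext (MonadMor.mult G M))

lemma vfMk_forget (G : Y ⟶ 𝕏.base) (x : G ⟶ G ≫ 𝕏.str.T)
    (sec : x ≫ G ◁ 𝕏.str.p.q ≫ (ρ_ G).hom = 𝟙 G) : vfMk G x sec ≫ vfForget 𝕏 = G :=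
  MonadMor.ext_of_app rfl fun M => aux_eq 𝕏.base.S.toFunctor
    (Category.id_comp ((MonadMor.φ G).app M))

/-- A 2-morphism `G ∘ A' ⟶ A ∘ G`, as a 2-morphism between the composites of the induced
1-morphism to the monad of vector fields with the forgetful 1-morphism. -/
def vfMkCell {G : Y ⟶ 𝕏.base} {x : G ⟶ G ≫ 𝕏.str.T}
    (sec : x ≫ G ◁ 𝕏.str.p.q ≫ (ρ_ G).hom = 𝟙 G) {A' : Y ⟶ Y} {A : VFEndo 𝕏}
    (a : A' ≫ G ⟶ G ≫ A.A) :
    (A' ≫ vfMk G x sec) ≫ vfForget 𝕏 ⟶ (vfMk G x sec ≫ A.toMor) ≫ vfForget 𝕏 :=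
  MonadMorTwoCell.mk
    { app := fun M => (MonadMorTwoCell.τ a).app M
      naturality := fun _ _ f => (MonadMorTwoCell.τ a).naturality f }
    (fun M => by
      have e := MonadMorTwoCell.comm a M
      have e₁ := Category.id_comp ((MonadMor.φ (A' ≫ G)).app M)
      have e₂ := Category.id_comp ((MonadMor.φ (G ≫ A.A)).app M)
      exact (congrArg (_ ≫ ·) e₂).trans (e.trans (congrArg (· ≫ _) e₁.symm)))

end Universal

/-! ### The universal vector field and the invertibility of Γ -/

section Main

variable (𝕏 : Tangentad MndCat.{v₁, max u₁ v₁})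

/-- The lifted tangent monad. -/
noncomputable def vfTangentad : Tangentad MndCat.{v₁, max u₁ v₁} :=
  Tangentad.mk (vfBase 𝕏) (VFEndo.tangentStructure 𝕏)

/-- The distributive law of the forgetful 1-morphism. -/
def vfForgetLaw : vfT 𝕏 ≫ vfForget 𝕏 ⟶ vfForget 𝕏 ≫ 𝕏.str.T := (VFEndo.tan 𝕏).forgetIso.hom

instance : IsIso (vfForgetLaw 𝕏) := (VFEndo.tan 𝕏).forgetIso.isIso_hom

lemma aux_distSq {C : Type u₁} [Category.{v₁} C] (T : C ⥤ C) {x y : C} (a : x ⟶ T.obj y) :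
    a ≫ 𝟙 _ ≫ 𝟙 _ ≫ 𝟙 _ ≫ T.map (𝟙 _) ≫ 𝟙 _ = 𝟙 _ ≫ a := by simp

lemma aux_distSq' {C : Type u₁} [Category.{v₁} C] (T : C ⥤ C) {x y : C} (a : T.obj x ⟶ T.obj y) :
    a ≫ 𝟙 _ ≫ 𝟙 _ ≫ 𝟙 _ ≫ T.map (𝟙 _) ≫ 𝟙 _ = (𝟙 _ ≫ 𝟙 _ ≫ 𝟙 _ ≫ T.map (𝟙 _) ≫ 𝟙 _) ≫ a := by
  simp

lemma isLaxLaw_vfForgetLaw :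
    IsLaxLaw (VFEndo.tangentStructure 𝕏) 𝕏.str (vfForget 𝕏) (vfForgetLaw 𝕏) where
  p_comm := VFEndo.proj_naturality.symm
  z_comm := cell_ext fun V => by
    change (tanZero 𝕏).app (VectorField.M V) ≫ 𝟙 _ =
      𝟙 _ ≫ 𝟙 _ ≫ (tanZero 𝕏).app (VectorField.M V)
    rw [Category.comp_id, Category.id_comp]
    exact (Category.id_comp _).symm
  s_comm := ⟨(VFEndo.two 𝕏).forgetIso.hom,
    (VFEndo.forgetIso_naturality (A := VFEndo.two 𝕏) (B := VFEndo.tan 𝕏) 𝕏.str.p.π₁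
      (VFEndo.isVFCell_pow (isPointwisePower_two 𝕏) 0)).symm,
    (VFEndo.forgetIso_naturality (A := VFEndo.two 𝕏) (B := VFEndo.tan 𝕏) 𝕏.str.p.π₂
      (VFEndo.isVFCell_pow (isPointwisePower_two 𝕏) 1)).symm,
    VFEndo.forgetIso_naturality (A := VFEndo.two 𝕏) (B := VFEndo.tan 𝕏) 𝕏.str.p.s
      (VFEndo.isVFCell_sum 𝕏)⟩
  l_comm := cell_ext fun V => aux_distSq (tanF 𝕏) ((tanLift 𝕏).app (VectorField.M V))
  c_comm := cell_ext fun V => aux_distSq' (tanF 𝕏) ((tanFlip 𝕏).app (VectorField.M V))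

lemma aux_univ {C : Type u₁} [Category.{v₁} C] (T : C ⥤ C) {x y : C} {a : T.obj x ⟶ T.obj y}
    {c : T.obj y ⟶ T.obj y} (h : c ≫ c = 𝟙 _) :
    𝟙 _ ≫ a = (a ≫ c) ≫ 𝟙 _ ≫ T.map (𝟙 _) ≫ 𝟙 _ ≫ c ≫ 𝟙 _ := by simp [h]

/-- At (M, v) both sides are T v. On the right the flip occurs twice, once in the vector field on T
M and once in the law of (T, c), and the two cancel. -/
lemma vfUniv_law : vfForgetLaw 𝕏 ≫ vfUniv 𝕏 ▷ 𝕏.str.T =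
    vfT 𝕏 ◁ vfUniv 𝕏 ≫ compLaw (vfForgetLaw 𝕏) 𝕏.str.c :=
  cell_ext fun V => aux_univ (tanF 𝕏) (a := (tanF 𝕏).map (VectorField.v V))
    (tanFlip_tanFlip (VectorField.M V))

lemma vfUniv_sec : vfUniv 𝕏 ≫ vfForget 𝕏 ◁ 𝕏.str.p.q ≫ (ρ_ (vfForget 𝕏)).hom = 𝟙 (vfForget 𝕏) :=
  cell_ext fun V => (congrArg (_ ≫ ·) (Category.comp_id _)).trans (VectorField.sec V)

/-- The universal vector field. -/
noncomputable def universalVF : HomVF (vfTangentad 𝕏) 𝕏 :=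
  mkHomVF (𝕍 := vfTangentad 𝕏) (vfForget 𝕏) (vfForgetLaw 𝕏) (isLaxLaw_vfForgetLaw 𝕏) (vfUniv 𝕏)
    (vfUniv_law 𝕏) (vfUniv_sec 𝕏)

/-- The two composites have the same underlying functor, and their monad laws differ only by
composition with identities. They are therefore equal 1-morphisms, and the law between them has
identity components. -/
lemma isStrict_universalVF : LaxTangentHom.IsStrict (universalVF 𝕏).M := by
  have h : vfT 𝕏 ≫ vfForget 𝕏 = vfForget 𝕏 ≫ 𝕏.str.T :=
    MonadMor.ext_of_app rfl fun V => aux_eq 𝕏.base.S.toFunctor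
      ((Category.id_comp _).trans (comp_map_id (tanF 𝕏) ((tanLaw 𝕏).app (VectorField.M V))).symm)
  exact ⟨h, cell_ext fun V => (eqToHom_τ h V).symm⟩

variable {𝕏}
variable {𝕏' : Tangentad MndCat.{v₁, max u₁ v₁}}

lemma Gam_faithful : (Gam (universalVF 𝕏) 𝕏').Faithful where
  map_injective h := twoCell_ext (whiskerRight_vfForget_injective
    (congrArg (fun k => TangentTwoCell.φ (VectorField.Hom.f k)) h))

lemma isVFCell_of_hom {H H' : 𝕏' ⟶ vfTangentad 𝕏}
    (a : (Gam (universalVF 𝕏) 𝕏').obj H ⟶ (Gam (universalVF 𝕏) 𝕏').obj H') :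
    IsVFCell (F := LaxTangentHom.F H) (G := LaxTangentHom.F H')
      (TangentTwoCell.φ (VectorField.Hom.f a)) :=
  congrArg TangentTwoCell.φ (VectorField.Hom.comm a)

lemma aux_full {C : Type u₁} [Category.{v₁} C] {x x' y y' : C} {a : x ⟶ y} {a' : x' ⟶ y'}
    {s : x ⟶ x'} {t : y ⟶ y'}
    (h : (𝟙 _ ≫ a ≫ 𝟙 _ ≫ 𝟙 _ ≫ 𝟙 _) ≫ t = s ≫ 𝟙 _ ≫ a' ≫ 𝟙 _ ≫ 𝟙 _ ≫ 𝟙 _) : a ≫ t = s ≫ a' := by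
  simpa using h

/-- Compatibility with the vector fields makes the 2-morphism lift. Compatibility with the
distributive laws then holds for the lift, since it can be checked on underlying morphisms. -/
lemma Gam_full : (Gam (universalVF 𝕏) 𝕏').Full where
  map_surjective {H H'} a := by
    have hl := liftCell_whiskerRight _ (isVFCell_of_hom a)
    refine ⟨TangentTwoCell.mk (liftCell _ (isVFCell_of_hom a)) ?_,
      VectorField.hom_ext (twoCell_ext hl)⟩
    have e := TangentTwoCell.comm (VectorField.Hom.f a)
    exact cell_ext fun M => VectorField.hom_ext (aux_full (cell_congr e M))

lemma VectorField.v_eqToHom {C : Type u₁} [Category.{v₁} C] {T : C ⥤ C} {p : T ⟶ 𝟭 C}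
    {V W : VectorField p} (h : V = W) :
    V.v ≫ T.map (eqToHom (congrArg VectorField.M h)) =
      eqToHom (congrArg VectorField.M h) ≫ W.v := by
  subst h; simp

lemma Gam_injective : Function.Injective (Gam (universalVF 𝕏) 𝕏').obj := by
  intro H H' h
  have hF : LaxTangentHom.F H = LaxTangentHom.F H' := by
    have e := congrArg TangentTwoCell.φ (VectorField.v_eqToHom h)
    have hM := congrArg VectorField.M h
    refine vfMor_ext (congrArg LaxTangentHom.F hM) fun M => ?_
    have k := eqToHom_φ hM
    have e' : vfCell (LaxTangentHom.F H) ≫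
          eqToHom (congrArg LaxTangentHom.F hM) ▷ 𝕏.str.T =
        eqToHom (congrArg LaxTangentHom.F hM) ≫ vfCell (LaxTangentHom.F H') := by
      rw [← k]; exact e
    have l := (isVFCell_iff _).1 e' M
    rw [eqToHom_τ] at l
    exact l
  obtain ⟨F, a, _⟩ := H
  obtain ⟨F', a', _⟩ := H'
  obtain rfl : F = F' := hF
  have e := congrArg VectorField.M h
  have e' : compLaw (T' := vfT 𝕏) (G := vfForget 𝕏) a (vfForgetLaw 𝕏) =
      compLaw (T' := vfT 𝕏) (G := vfForget 𝕏) a' (vfForgetLaw 𝕏) := by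
    injection e
  -- With equal 1-morphisms, only the distributive laws a and a' remain to be compared; they agree
  -- after the forgetful 1-morphism, which is faithful on 2-morphisms.
  have e'' := compLaw_injective (T' := vfT 𝕏) (G := vfForget 𝕏) (β := vfForgetLaw 𝕏) e'
  obtain rfl : a = a' := whiskerRight_vfForget_injective e''
  rfl

lemma aux_surj {C : Type u₁} [Category.{v₁} C] {x y z w w' : C} {a : x ⟶ y} {b : y ⟶ w}
    {v : x ⟶ z} {b' : z ⟶ w'} {c : w' ⟶ w} {c' : w ⟶ w'}
    (h : a ≫ b = v ≫ 𝟙 _ ≫ b' ≫ 𝟙 _ ≫ c ≫ 𝟙 _) (hc : c ≫ c' = 𝟙 _) : v ≫ b' = a ≫ b ≫ c' := by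
  rw [← Category.assoc, h]
  simp [hc]

lemma aux_surj_law {C : Type u₁} [Category.{v₁} C] {x y : C} (a : x ⟶ y) :
    (𝟙 _ ≫ a ≫ 𝟙 _ ≫ 𝟙 _ ≫ 𝟙 _) ≫ 𝟙 _ = 𝟙 _ ≫ a := by simp

lemma aux_surj_v {C : Type u₁} [Category.{v₁} C] (T : C ⥤ C) {x y : C} (a : x ⟶ T.obj y) :
    (a ≫ 𝟙 _) ≫ T.map (𝟙 _) = 𝟙 _ ≫ a := by simp

lemma Gam_surjective : Function.Surjective (Gam (universalVF 𝕏) 𝕏').obj := by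
  intro W
  let G := LaxTangentHom.F W.M
  let x : G ⟶ G ≫ 𝕏.str.T := TangentTwoCell.φ W.v
  have sec : x ≫ G ◁ 𝕏.str.p.q ≫ (ρ_ G).hom = 𝟙 G := congrArg TangentTwoCell.φ W.sec
  let α : 𝕏'.str.T ≫ G ⟶ G ≫ 𝕏.str.T := LaxTangentHom.α W.M
  have hα : IsLaxLaw 𝕏'.str 𝕏.str G α := LaxTangentHom.isLaxLaw W.M
  have comm : α ≫ x ▷ 𝕏.str.T = 𝕏'.str.T ◁ x ≫ compLaw α 𝕏.str.c := TangentTwoCell.comm W.v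
  -- That the given vector field is a tangent 2-morphism means that α respects the vector fields,
  -- once the flip in the law of (T, c) is moved to the other side by c² = 1.
  have hl : IsVFCell (vfMkCell sec (A' := 𝕏'.str.T) (A := VFEndo.tan 𝕏) α) :=
    (isVFCell_iff _).2 fun M => aux_surj (cell_congr comm M) (tanFlip_tanFlip _)
  let a : 𝕏'.str.T ≫ vfMk G x sec ⟶ vfMk G x sec ≫ vfT 𝕏 := liftCell _ hl
  have ha : IsLaxLaw 𝕏'.str (VFEndo.tangentStructure 𝕏) (vfMk G x sec) a :=
    { p_comm := cell_ext fun M => VectorField.hom_ext (cell_congr hα.p_comm M)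
      z_comm := cell_ext fun M => VectorField.hom_ext (cell_congr hα.z_comm M)
      s_comm := by
        obtain ⟨α₂, h₁, h₂, h₃⟩ := hα.s_comm
        -- The comparison `α₂` lifts because its projections are the projections of the source
        -- followed by the lifted law a.
        have h : IsVFCell (vfMkCell sec (A' := 𝕏'.str.p.E₂) (A := VFEndo.two 𝕏) α₂) := by
          refine isVFCell_of_jointlyMono (VFEndo.jointlyMono_whiskerLeft_twoProj (vfMk G x sec))
            (fun i => ![𝕏'.str.p.π₁, 𝕏'.str.p.π₂] i ▷ vfMk G x sec ≫ a) fun i => ?_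
          fin_cases i
          · exact cell_ext fun M => cell_congr h₁ M
          · exact cell_ext fun M => cell_congr h₂ M
        exact ⟨liftCell _ h, cell_ext fun M => VectorField.hom_ext (cell_congr h₁ M),
          cell_ext fun M => VectorField.hom_ext (cell_congr h₂ M),
          cell_ext fun M => VectorField.hom_ext (cell_congr h₃ M)⟩
      l_comm := cell_ext fun M => VectorField.hom_ext (cell_congr hα.l_comm M)
      c_comm := cell_ext fun M => VectorField.hom_ext (cell_congr hα.c_comm M) }
  have hF : vfMk G x sec ≫ vfForget 𝕏 = G := vfMk_forget G x sec
  have hM : LaxTangentHom.mk (vfMk G x sec) a ha ≫ (universalVF 𝕏).M = W.M := by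
    refine laxTangentHom_ext hF (cell_ext fun M => ?_)
    refine (congrArg (_ ≫ ·) (eqToHom_τ (congrArg (· ≫ 𝕏.str.T) hF) M)).trans (Eq.trans ?_
      (congrArg (· ≫ _) (eqToHom_τ (congrArg (𝕏'.str.T ≫ ·) hF) M).symm))
    exact aux_surj_law ((MonadMorTwoCell.τ α).app M)
  refine ⟨LaxTangentHom.mk (vfMk G x sec) a ha, VectorField.ext_of_eqToHom hM (twoCell_ext ?_)⟩
  -- The base of the constructed vector field equals the given one only propositionally, so the
  -- vector fields are compared along a transport whose components are identities.
  have k : TangentTwoCell.φ (eqToHom hM) = eqToHom hF := eqToHom_φ hM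
  have e : vfCell (vfMk G x sec) ≫ eqToHom hF ▷ 𝕏.str.T = eqToHom hF ≫ x := by
    refine cell_ext fun M => ?_
    refine (congrArg (_ ≫ (tanF 𝕏).map ·) (eqToHom_τ hF M)).trans (Eq.trans ?_
      (congrArg (· ≫ _) (eqToHom_τ hF M).symm))
    exact aux_surj_v (tanF 𝕏) ((MonadMorTwoCell.τ x).app M)
  rw [← k] at e
  exact e

variable (𝕏) in
lemma isUniversalVectorField_universalVF : IsUniversalVectorField (universalVF 𝕏) where
  isStrict := isStrict_universalVF 𝕏
  invertible 𝕏' :=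
    ⟨@exists_inverse_of_bijective _ _ _ _ (Gam (universalVF 𝕏) 𝕏') Gam_full Gam_faithful
      ⟨Gam_injective, Gam_surjective⟩,
      isIso_GamLaw _ (inferInstanceAs (IsIso (vfForgetLaw 𝕏))) 𝕏'⟩

end Main

end TangentTheory

theorem mainTheorem8 :
    AdmitsVectorFields MndCat.{v, max u v} ∧
    ∀ 𝕏 : Tangentad MndCat.{v, max u v},
      ∃ S : TangentStructure (vfBase 𝕏), S.T = vfT 𝕏 ∧
        ∃ (α : S.T ≫ vfForget 𝕏 ⟶ vfForget 𝕏 ≫ 𝕏.str.T)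
          (hα : IsLaxLaw S 𝕏.str (vfForget 𝕏) α)
          (hv : α ≫ vfUniv 𝕏 ▷ 𝕏.str.T = S.T ◁ vfUniv 𝕏 ≫ compLaw α 𝕏.str.c)
          (sec : vfUniv 𝕏 ≫ vfForget 𝕏 ◁ 𝕏.str.p.q ≫ (ρ_ (vfForget 𝕏)).hom = 𝟙 (vfForget 𝕏)),
          IsUniversalVectorField
            (mkHomVF (𝕍 := Tangentad.mk (vfBase 𝕏) S) (vfForget 𝕏) α hα (vfUniv 𝕏) hv sec) :=
  ⟨fun 𝕏 => ⟨vfTangentad 𝕏, universalVF 𝕏, isUniversalVectorField_universalVF 𝕏⟩,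
    fun 𝕏 => ⟨VFEndo.tangentStructure 𝕏, rfl, vfForgetLaw 𝕏, isLaxLaw_vfForgetLaw 𝕏,
      vfUniv_law 𝕏, vfUniv_sec 𝕏, isUniversalVectorField_universalVF 𝕏⟩⟩
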